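/- **Theorem 2.1.** Let $\mu>0$, $3\lambda+2\mu\ge 0$, and let $\kappa,\nu,\sigma_a,\tilde\sigma,\bar\rho,\bar\theta$ be positive constants. Let $P=P(\rho,\theta)$ and $e=e(\rho,\theta)$ be smooth functions on $(0,\infty)^2$ with $P_\rho>0$ and $e_\theta>0$ there. Below, $P_\rho,P_\theta,e_\theta$ stand for the values of these derivatives at $(\bar\rho,\bar\theta)$, and $\bar\mu=\mu/\bar\rho$, $\bar\lambda=\lambda/\bar\rho$. Let $N\ge 3$ be an integer, and let $0<M_0\le M_1<\infty$. For $\delta>0$ and $0<T<\infty$, consider on $\mathbb R^3\times(0,T)$ the linearized system $$ \begin{aligned} &\tilde n_t+\operatorname{div}\mathbf m=0,\\ &\mathbf m_t-\bar\mu\operatorname{div}(A\nabla\mathbf m)-(\bar\lambda+\bar\mu)\nabla(A\operatorname{div}\mathbf m)+\frac{\bar\rho P_\rho}{\delta^2}\nabla\tilde n+\frac{P_\theta}{\delta^2}\nabla\zeta=\mathbf G_1,\\ &\zeta_t+\frac{\bar\theta P_\theta}{\bar\rho e_\theta}\operatorname{div}\mathbf m=\frac{\kappa}{\bar\rho e_\theta}\Delta\zeta-\frac{4\tilde\sigma\bar\theta^3\zeta-\sigma_a\mathcal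 G}{\bar\rho e_\theta}+G_2,\\ &\delta\,\mathcal G_t-\nu\Delta\mathcal G=4\tilde\sigma\bar\theta^3\zeta-\sigma_a\mathcal G+G_3,\\ &(\tilde n,\mathbf m,\zeta,\mathcal G)(\cdot,0)=(\tilde n_0,\mathbf m_0,\zeta_0,\mathcal G_0)\in H^N(\mathbb R^3), \end{aligned} $$ where the scalar coefficient $A$ satisfies $M_0\le A(\mathbf x,t)\le M_1$ and, for some constant $A_\infty\in\mathbb R$, $$A-A_\infty\in L^\infty(0,T;H^N(\mathbb R^3)),\qquad \mathbf G_1,G_2,G_3\in L^2(0,T;H^{N-1}(\mathbb R^3)).$$ Here the norm $\|(f_1,\dots,f_l)\|_{H^k}$ of a tuple means $\sum_i\|f_i\|_{H^k}$. There exist constants $C_0,c_0>0$, depending only on $N$, $M_0$, $M_1$, $\mu,\lambda,\kappa,\nu,\sigma_a,\tilde\sigma,\bar\rho,\bar\theta$ and the functions $P,e$ (in particular independent of $\delta$, $T$, $t$, $A$, $A_\infty$, the sources, the data and the solution), such that every solution (in the sense of distributions) of this system with $$(\tilde n,\mathbf m,\zeta,\mathcal G)\in C([0,T];H^N(\mathbb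 R^3)),\quad \nabla\tilde n\in L^2(0,T;H^{N-1}(\mathbb R^3)),\quad (\nabla\mathbf m,\nabla\zeta,\nabla\mathcal G)\in L^2(0,T;H^N(\mathbb R^3))$$ satisfies, for all $t\in[0,T]$, $$ \begin{aligned} &\big\|(\mathbf m,\delta^{-1}\tilde n,\delta^{-1}\zeta,\delta^{-1/2}\mathcal G)(t)\big\|_{H^N}^2+\delta^{-2}\int_0^t\|\nabla\tilde n\|_{H^{N-1}}^2\,d\tau\\ &\quad+\int_0^t\|\nabla\mathbf m\|_{H^N}^2\,d\tau+\delta^{-2}\int_0^t\big\|(\nabla\zeta,\nabla\mathcal G,\,4\tilde\sigma\bar\theta^3\zeta-\sigma_a\mathcal G)\big\|_{H^N}^2\,d\tau\\ &\le C_0\Big[\big\|(\mathbf m_0,\delta^{-1}\tilde n_0,\delta^{-1}\zeta_0,\delta^{-1/2}\mathcal G_0)\big\|_{H^N}^2+\int_0^t\big\|(\mathbf G_1,\delta^{-1}G_2,\delta^{-1}G_3)\big\|_{H^{N-1}}^2\,d\tau\Big]\\ &\quad\times\Big[1+e^{c_0\int_0^T(1+\|A-A_\infty\|_{H^N}^2)\,d\tau}\int_0^T\big(1+\|A-A_\infty\|_{H^N}^2\big)\,d\tau\Big].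 \end{aligned} $$ -/

import Mathlib

open MeasureTheory Set
open scoped ContDiff

noncomputable section

namespace RadHydro

/-! ### Sobolev spaces `H^k(ℝ³)` through weak derivatives -/

/-- The physical space `ℝ³`. -/
abbrev E3 : Type := EuclideanSpace ℝ (Fin 3)

/-- The classical partial derivative `∂ᵢ φ`. -/
def partialDeriv (i : Fin 3) (φ : E3 → ℝ) : E3 → ℝ :=
  fun x => fderiv ℝ φ x (EuclideanSpace.single i 1)

/-- The classical derivative `D^α φ = ∂₁^{α₁} ∂₂^{α₂} ∂₃^{α₃} φ` for a multi-index `α`. -/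
def multiDeriv (α : Fin 3 → ℕ) (φ : E3 → ℝ) : E3 → ℝ :=
  (partialDeriv 0)^[α 0] ((partialDeriv 1)^[α 1] ((partialDeriv 2)^[α 2] φ))

/-- Test functions: `φ ∈ C_c^∞(ℝ³)`. -/
structure IsTest (φ : E3 → ℝ) : Prop where
  smooth : ContDiff ℝ ∞ φ
  compact : HasCompactSupport φ

theorem IsTest.partialDeriv {φ : E3 → ℝ} (h : IsTest φ) (i : Fin 3) :
    IsTest (partialDeriv i φ) := by
  refine ⟨?_, ?_⟩
  · have h1 : ContDiff ℝ ∞ (fderiv ℝ φ) := h.smooth.fderiv_right (by simp)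
    exact h1.clm_apply contDiff_const
  · exact h.compact.fderiv_apply (𝕜 := ℝ) (EuclideanSpace.single i 1)

theorem IsTest.iterate_partialDeriv {φ : E3 → ℝ} (h : IsTest φ) (i : Fin 3) (n : ℕ) :
    IsTest ((RadHydro.partialDeriv i)^[n] φ) := by
  induction n with
  | zero => exact h
  | succ n ih => rw [Function.iterate_succ_apply']; exact ih.partialDeriv i

theorem IsTest.multiDeriv {φ : E3 → ℝ} (h : IsTest φ) (α : Fin 3 → ℕ) :
    IsTest (multiDeriv α φ) :=
  ((h.iterate_partialDeriv 2 _).iterate_partialDeriv 1 _).iterate_partialDeriv 0 _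

/-- The real Hilbert space `L²(ℝ³)`. -/
abbrev L2 : Type := Lp ℝ 2 (volume : Measure E3)

theorem integrable_mul_test (f : L2) {φ : E3 → ℝ} (h : IsTest φ) :
    Integrable (fun x => f x * φ x) :=
  have hφ : MemLp φ 2 (volume : Measure E3) :=
    h.smooth.continuous.memLp_of_hasCompactSupport h.compact
  (Lp.memLp f).integrable_mul hφ

/-- The pairing `∫ f φ dx`. -/
def pair (f φ : E3 → ℝ) : ℝ := ∫ x, f x * φ x

theorem pair_zero (φ : E3 → ℝ) : pair (0 : L2) φ = 0 := by
  unfold pair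
  rw [← integral_zero E3 ℝ (μ := volume)]
  refine integral_congr_ae ?_
  filter_upwards [Lp.coeFn_zero ℝ 2 (volume : Measure E3)] with x hx
  rw [hx, Pi.zero_apply, zero_mul]

theorem pair_add (f g : L2) {φ : E3 → ℝ} (h : IsTest φ) :
    pair (f + g : L2) φ = pair f φ + pair g φ := by
  unfold pair
  rw [← integral_add (integrable_mul_test f h) (integrable_mul_test g h)]
  refine integral_congr_ae ?_
  filter_upwards [Lp.coeFn_add f g] with x hx
  rw [hx, Pi.add_apply, add_mul]

theorem pair_smul (c : ℝ) (f : L2) (φ : E3 → ℝ) :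
    pair (c • f : L2) φ = c * pair f φ := by
  unfold pair
  rw [← integral_const_mul]
  refine integral_congr_ae ?_
  filter_upwards [Lp.coeFn_smul c f] with x hx
  rw [hx, Pi.smul_apply, smul_eq_mul, mul_assoc]

/-- `g` is the weak derivative `D^α f`. -/
def IsWeakDeriv (α : Fin 3 → ℕ) (f g : L2) : Prop :=
  ∀ φ : E3 → ℝ, IsTest φ → pair f (multiDeriv α φ) = (-1) ^ (∑ i, α i) * pair g φ

/-- The multi-indices `α` with `|α| ≤ k`. -/
abbrev MultiIndex (k : ℕ) : Type := {α : Fin 3 → Fin (k + 1) // ∑ i, (α i : ℕ) ≤ k}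

/-- The multi-index as a tuple of natural numbers. -/
def MultiIndex.val {k : ℕ} (α : MultiIndex k) : Fin 3 → ℕ := fun i => (α.1 i : ℕ)

/-- The multi-index `0`. -/
def MultiIndex.zero (k : ℕ) : MultiIndex k := ⟨fun _ => 0, by simp⟩

/-- The Sobolev space `H^k(ℝ³)` as a subspace of a finite product of copies of `L²`. An element is
the family `(D^α u)_{|α| ≤ k}` of all weak derivatives up to order `k` of an `L²` function `u`, which
is the entry at `α = 0` and determines the family. -/
def sobolevSubmodule (k : ℕ) : Submodule ℝ (PiLp 2 (fun _ : MultiIndex k => L2)) where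
  carrier := {F | ∀ α : MultiIndex k, IsWeakDeriv α.val (F (MultiIndex.zero k)) (F α)}
  zero_mem' := by
    intro α φ _
    simp only [PiLp.zero_apply, pair_zero, mul_zero]
  add_mem' := by
    intro F G hF hG α φ hφ
    simp only [PiLp.add_apply]
    rw [pair_add _ _ (hφ.multiDeriv _), pair_add _ _ hφ, hF α φ hφ, hG α φ hφ, mul_add]
  smul_mem' := by
    intro c F hF α φ hφ
    simp only [PiLp.smul_apply]
    rw [pair_smul, pair_smul, hF α φ hφ]
    ring

/-- `H^k(ℝ³)` with the norm `‖u‖_{H^k} = (∑_{|α| ≤ k} ‖D^α u‖²)^{1/2}` (inherited from the `ℓ²`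
product). -/
abbrev SobolevH (k : ℕ) : Type := sobolevSubmodule k

/-- The underlying function of `u ∈ H^k(ℝ³)`, defined almost everywhere. -/
def fn {k : ℕ} (u : SobolevH k) : E3 → ℝ := (u.1 (MultiIndex.zero k) : L2)

/-- `H^k(ℝ³; ℝ³)`. -/
abbrev VecH (k : ℕ) : Type := PiLp 2 (fun _ : Fin 3 => SobolevH k)

/-- `H^k(ℝ³; ℝ^{3×3})`. -/
abbrev MatH (k : ℕ) : Type := PiLp 2 (fun _ : Fin 3 => VecH k)

/-- `V ∈ H^l(ℝ³; ℝ³)` is the weak gradient of `u`. -/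
def IsGradient {k l : ℕ} (u : SobolevH k) (V : VecH l) : Prop :=
  ∀ (j : Fin 3) (φ : E3 → ℝ), IsTest φ →
    pair (fn u) (partialDeriv j φ) = -pair (fn (V j)) φ

/-! ### The physical data -/

/-- Viscosities `μ, lam`, heat conductivity `κ`, radiation diffusion `ν`, absorption coefficients
`σa, σt`, constant reference state `(ρbar, θbar)`, pressure law `P(ρ, θ)` and internal energy law
`e(ρ, θ)`. -/
structure GasModel where
  μ : ℝ
  lam : ℝ
  κ : ℝ
  ν : ℝ
  σa : ℝ
  σt : ℝ
  ρbar : ℝ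
  θbar : ℝ
  P : ℝ → ℝ → ℝ
  e : ℝ → ℝ → ℝ
  μ_pos : 0 < μ
  lam_bound : 0 ≤ 3 * lam + 2 * μ
  κ_pos : 0 < κ
  ν_pos : 0 < ν
  σa_pos : 0 < σa
  σt_pos : 0 < σt
  ρbar_pos : 0 < ρbar
  θbar_pos : 0 < θbar
  P_smooth : ContDiffOn ℝ ∞ (fun p : ℝ × ℝ => P p.1 p.2) (Ioi 0 ×ˢ Ioi 0)
  e_smooth : ContDiffOn ℝ ∞ (fun p : ℝ × ℝ => e p.1 p.2) (Ioi 0 ×ˢ Ioi 0)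
  P_ρ_pos : ∀ ρ θ : ℝ, 0 < ρ → 0 < θ → 0 < deriv (fun r => P r θ) ρ
  e_θ_pos : ∀ ρ θ : ℝ, 0 < ρ → 0 < θ → 0 < deriv (fun s => e ρ s) θ

namespace GasModel

variable (g : GasModel)

/-- `P_ρ(ρbar, θbar)` -/
def Pρ : ℝ := deriv (fun r => g.P r g.θbar) g.ρbar

/-- `P_θ(ρbar, θbar)` -/
def Pθ : ℝ := deriv (fun s => g.P g.ρbar s) g.θbar

/-- `e_θ(ρbar, θbar)` -/
def eθ : ℝ := deriv (fun s => g.e g.ρbar s) g.θbar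

/-- The scaled viscosity `μ / ρbar`. -/
def μbar : ℝ := g.μ / g.ρbar

/-- The scaled viscosity `lam / ρbar`. -/
def lambar : ℝ := g.lam / g.ρbar

end GasModel

/-! ### The linearized system -/

/-- Lebesgue measure on the time interval `(0, T)`. -/
def timeMeasure (T : ℝ) : Measure ℝ := volume.restrict (Ioo 0 T)

/-- The regularity class
`(n, m, ζ, G) ∈ C([0,T]; H^N)`, `∇n ∈ L²(0,T; H^{N-1})`, `(∇m, ∇ζ, ∇G) ∈ L²(0,T; H^N)`,
where `Dn, Dm, Dζ, DG` are the weak gradients of `n, m, ζ, G`; `Dm t i j = ∂ⱼ mᵢ(t)`. -/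
structure InEnergyClass (N : ℕ) (T : ℝ)
    (n : ℝ → SobolevH N) (m : ℝ → VecH N) (ζ G : ℝ → SobolevH N)
    (Dn : ℝ → VecH (N - 1)) (Dm : ℝ → MatH N) (Dζ DG : ℝ → VecH N) : Prop where
  n_cont : ContinuousOn n (Icc 0 T)
  m_cont : ContinuousOn m (Icc 0 T)
  ζ_cont : ContinuousOn ζ (Icc 0 T)
  G_cont : ContinuousOn G (Icc 0 T)
  Dn_memLp : MemLp Dn 2 (timeMeasure T)
  Dm_memLp : MemLp Dm 2 (timeMeasure T)
  Dζ_memLp : MemLp Dζ 2 (timeMeasure T)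
  DG_memLp : MemLp DG 2 (timeMeasure T)
  Dn_grad : ∀ᵐ t ∂timeMeasure T, IsGradient (n t) (Dn t)
  Dm_grad : ∀ᵐ t ∂timeMeasure T, ∀ i, IsGradient (m t i) (Dm t i)
  Dζ_grad : ∀ᵐ t ∂timeMeasure T, IsGradient (ζ t) (Dζ t)
  DG_grad : ∀ᵐ t ∂timeMeasure T, IsGradient (G t) (DG t)

/-- `(n, m, ζ, G)` solves on `[0, T]` the linearized system

* `n_t + div m = 0`,
* `m_t - μbar div (A ∇m) - (lambar + μbar) ∇(A div m)
    + (ρbar P_ρ / δ²) ∇n + (P_θ / δ²) ∇ζ = S₁`,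
* `ζ_t + (θbar P_θ / (ρbar e_θ)) div m
    = (κ / (ρbar e_θ)) Δζ - (4 σt θbar³ ζ - σa G) / (ρbar e_θ) + S₂`,
* `δ G_t - ν ΔG = 4 σt θbar³ ζ - σa G + S₃`,

with initial values `(n₀, m₀, ζ₀, G₀)`: each equation is tested with an arbitrary
`φ ∈ C_c^∞(ℝ³)` (derivatives falling on `φ` by parts) and integrated over `(0, t)`. -/
structure IsSolution (g : GasModel) (δ : ℝ) {N : ℕ} (T : ℝ) (A : ℝ → E3 → ℝ)
    (S₁ : ℝ → VecH (N - 1)) (S₂ S₃ : ℝ → SobolevH (N - 1))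
    (n₀ : SobolevH N) (m₀ : VecH N) (ζ₀ G₀ : SobolevH N)
    (n : ℝ → SobolevH N) (m : ℝ → VecH N) (ζ G : ℝ → SobolevH N)
    (Dm : ℝ → MatH N) (Dζ DG : ℝ → VecH N) : Prop where
  n_init : n 0 = n₀
  m_init : m 0 = m₀
  ζ_init : ζ 0 = ζ₀
  G_init : G 0 = G₀
  mass : ∀ φ : E3 → ℝ, IsTest φ → ∀ t ∈ Icc 0 T,
    pair (fn (n t)) φ - pair (fn (n 0)) φ =
      ∫ τ in 0..t, (∑ j, pair (fn (m τ j)) (partialDeriv j φ))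
  momentum : ∀ i : Fin 3, ∀ φ : E3 → ℝ, IsTest φ → ∀ t ∈ Icc 0 T,
    pair (fn (m t i)) φ - pair (fn (m 0 i)) φ =
      ∫ τ in 0..t,
        (-g.μbar * (∑ j, pair (fun x => A τ x * fn (Dm τ i j) x) (partialDeriv j φ))
          - (g.lambar + g.μbar) *
              pair (fun x => A τ x * (∑ j, fn (Dm τ j j) x)) (partialDeriv i φ)
          + g.ρbar * g.Pρ / δ ^ 2 * pair (fn (n τ)) (partialDeriv i φ)
          + g.Pθ / δ ^ 2 * pair (fn (ζ τ)) (partialDeriv i φ)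
          + pair (fn (S₁ τ i)) φ)
  temperature : ∀ φ : E3 → ℝ, IsTest φ → ∀ t ∈ Icc 0 T,
    pair (fn (ζ t)) φ - pair (fn (ζ 0)) φ =
      ∫ τ in 0..t,
        (g.θbar * g.Pθ / (g.ρbar * g.eθ) * (∑ j, pair (fn (m τ j)) (partialDeriv j φ))
          - g.κ / (g.ρbar * g.eθ) * (∑ j, pair (fn (Dζ τ j)) (partialDeriv j φ))
          - (4 * g.σt * g.θbar ^ 3 * pair (fn (ζ τ)) φ - g.σa * pair (fn (G τ)) φ)
              / (g.ρbar * g.eθ)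
          + pair (fn (S₂ τ)) φ)
  radiation : ∀ φ : E3 → ℝ, IsTest φ → ∀ t ∈ Icc 0 T,
    δ * (pair (fn (G t)) φ - pair (fn (G 0)) φ) =
      ∫ τ in 0..t,
        (-g.ν * (∑ j, pair (fn (DG τ j)) (partialDeriv j φ))
          + (4 * g.σt * g.θbar ^ 3 * pair (fn (ζ τ)) φ - g.σa * pair (fn (G τ)) φ)
          + pair (fn (S₃ τ)) φ)

/-- The weighted norm `‖(m, δ⁻¹ n, δ⁻¹ ζ, δ^{-1/2} G)‖_{H^N}`, the sum of the norms of the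
entries. -/
def energyNorm (δ : ℝ) {N : ℕ} (n : SobolevH N) (m : VecH N) (ζ G : SobolevH N) : ℝ :=
  ‖m‖ + δ⁻¹ * ‖n‖ + δ⁻¹ * ‖ζ‖ + δ ^ (-(1 / 2) : ℝ) * ‖G‖

end RadHydro

end

open RadHydro

/-!
The theorem is an energy estimate in `H^N`, closed by Gronwall's inequality.

*The energy.* Pair the four equations in `H^N` with `m`, `n`, `ζ`, `G` and add them with the weights
`1`, `ρbar P_ρ / δ²`, `ρbar e_θ / (θbar δ²)` and `σa / (4 σt θbar⁴ δ)`. The terms with `∇n`, `∇ζ`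
and `div m` cancel, and the exchange terms between matter and radiation combine to minus a multiple of
`δ⁻² ‖4 σt θbar³ ζ - σa G‖²` (`balance_algebra`, `exists_energy_balance`). All constants are
independent of `δ` because every remaining term is quadratic in the rescaled quantities of the
statement.

*The viscous terms.* `⟪A v, v⟫ ≥ M₀ ‖v‖²` in `H^N` up to commutators `D^α (B v) - B D^α v`, which are
bounded in `L²` by `‖B‖_{H^N} ‖v‖_{H^{N-1}}` (`exists_isSobolevProduct`, `inner_coefficient_mul_ge`).
For `v = ∂ⱼ mᵢ` they cost `‖B‖ ‖m‖ ‖∇m‖`, which Young's inequality absorbs in the dissipation at the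
price of `(1 + ‖B‖²) ‖m‖²` (`viscous_ge`, `exists_energyRate_le`). The commutator estimate rests on
`H² ⊆ L^∞` and `H¹ · H¹ ⊆ L²` in three dimensions (`exists_test_sup_bound`,
`exists_test_mul_bound`).

*Justification for distributional solutions.* `H^k` is a space of families of weak derivatives, in
which test functions are dense (`dense_toH`). The equations, tested with
`∑_{|α| ≤ N} (-1)^{|α|} D^{2α} φ`, become equations for the inner product of `H^N` (`inner_toH`), with
right hand sides in the dual of `H^{N+1}`; a source in `H^{N-1}` acts there by moving one derivative
onto the test function (`sourceFunctional`). For such equations the chain rule for `‖u‖²` is the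
theorem of Lions and Magenes (`energy_identity`): with `ι : H^{N+1} → H^N` the inclusion, it holds
for the regularized pairings `⟪u, ι (ε + ι*ι)⁻¹ ι* u⟫`, and passes to the limit `ε → 0`
(`exists_regularization`, `regularized_energy_identity`).

*Conclusion.* Gronwall's inequality bounds the energy and the dissipation by the data times `exp
(c ∫ (1 + ‖B‖²))` (`exists_energy_estimate`). The density term `δ⁻² ∫ ‖∇n‖²` is not part of the
dissipation, but it is at most a multiple of `t` times the supremum of the energy, and `t ≤ ∫ (1 +
‖B‖²)`, a factor that the bracket of the statement provides (`integral_norm_sq_gradient_le`).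
Finally `exp x ≤ 1 + x exp x` gives the bracket its form (`collect_constants`).
-/

noncomputable section

namespace RadHydro

/-! ### Classical multi-index calculus -/

theorem contDiff_partialDeriv {φ : E3 → ℝ} (h : ContDiff ℝ ∞ φ) (i : Fin 3) :
    ContDiff ℝ ∞ (partialDeriv i φ) := by
  have h1 : ContDiff ℝ ∞ (fderiv ℝ φ) := h.fderiv_right (by simp)
  exact h1.clm_apply contDiff_const

theorem contDiff_iterate_partialDeriv {φ : E3 → ℝ} (h : ContDiff ℝ ∞ φ) (i : Fin 3) (n : ℕ) :
    ContDiff ℝ ∞ ((partialDeriv i)^[n] φ) := by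
  induction n with
  | zero => exact h
  | succ n ih => rw [Function.iterate_succ_apply']; exact contDiff_partialDeriv ih i

theorem contDiff_multiDeriv {φ : E3 → ℝ} (h : ContDiff ℝ ∞ φ) (α : Fin 3 → ℕ) :
    ContDiff ℝ ∞ (multiDeriv α φ) :=
  contDiff_iterate_partialDeriv
    (contDiff_iterate_partialDeriv (contDiff_iterate_partialDeriv h 2 _) 1 _) 0 _

theorem differentiable_of_smooth {φ : E3 → ℝ} (h : ContDiff ℝ ∞ φ) : Differentiable ℝ φ :=
  h.differentiable (by simp)

theorem smooth_add {f g : E3 → ℝ} (hf : ContDiff ℝ ∞ f) (hg : ContDiff ℝ ∞ g) :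
    ContDiff ℝ ∞ (f + g) := hf.add hg

theorem smooth_mul {f g : E3 → ℝ} (hf : ContDiff ℝ ∞ f) (hg : ContDiff ℝ ∞ g) :
    ContDiff ℝ ∞ (f * g) := hf.mul hg

theorem smooth_smul {f : E3 → ℝ} (hf : ContDiff ℝ ∞ f) (c : ℝ) :
    ContDiff ℝ ∞ (c • f) := hf.const_smul c

/-- Symmetry of the second derivatives. -/
theorem partialDeriv_comm {φ : E3 → ℝ} (h : ContDiff ℝ ∞ φ) (i j : Fin 3) :
    partialDeriv i (partialDeriv j φ) = partialDeriv j (partialDeriv i φ) := by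
  have h1 : Differentiable ℝ (fderiv ℝ φ) :=
    (h.fderiv_right (m := ∞) (by simp)).differentiable (by simp)
  have key : ∀ (k l : Fin 3) (x : E3), partialDeriv k (partialDeriv l φ) x =
      fderiv ℝ (fderiv ℝ φ) x (EuclideanSpace.single k 1) (EuclideanSpace.single l 1) := by
    intro k l x
    have : HasFDerivAt (partialDeriv l φ) _ x :=
      (h1 x).hasFDerivAt.clm_apply (hasFDerivAt_const (EuclideanSpace.single l (1 : ℝ)) x)
    rw [partialDeriv, this.fderiv]
    simp
  funext x
  rw [key, key]
  have hs : IsSymmSndFDerivAt ℝ φ x := by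
    refine (h.contDiffAt).isSymmSndFDerivAt ?_
    simp only [minSmoothness_of_isRCLikeNormedField]
    exact WithTop.coe_le_coe.2 (le_top : (2 : ℕ∞) ≤ ⊤)
  exact hs.eq _ _

theorem partialDeriv_add {f g : E3 → ℝ} (hf : ContDiff ℝ ∞ f) (hg : ContDiff ℝ ∞ g) (i : Fin 3) :
    partialDeriv i (f + g) = partialDeriv i f + partialDeriv i g := by
  funext x
  simp only [partialDeriv, Pi.add_apply]
  rw [fderiv_add (differentiable_of_smooth hf x) (differentiable_of_smooth hg x)]
  rfl

theorem partialDeriv_smul {f : E3 → ℝ} (hf : ContDiff ℝ ∞ f) (c : ℝ) (i : Fin 3) :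
    partialDeriv i (c • f) = c • partialDeriv i f := by
  funext x
  simp only [partialDeriv, Pi.smul_apply]
  rw [fderiv_const_smul (differentiable_of_smooth hf x)]
  rfl

theorem partialDeriv_mul {f g : E3 → ℝ} (hf : ContDiff ℝ ∞ f) (hg : ContDiff ℝ ∞ g) (i : Fin 3) :
    partialDeriv i (f * g) = partialDeriv i f * g + f * partialDeriv i g := by
  funext x
  simp only [partialDeriv, Pi.add_apply, Pi.mul_apply]
  rw [fderiv_mul (differentiable_of_smooth hf x) (differentiable_of_smooth hg x)]
  simp only [add_apply, smul_apply, smul_eq_mul]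
  ring

theorem partialDeriv_iterate_comm {φ : E3 → ℝ} (h : ContDiff ℝ ∞ φ) (i j : Fin 3) (n : ℕ) :
    partialDeriv i ((partialDeriv j)^[n] φ) = (partialDeriv j)^[n] (partialDeriv i φ) := by
  induction n with
  | zero => rfl
  | succ n ih =>
    rw [Function.iterate_succ_apply', Function.iterate_succ_apply',
      partialDeriv_comm (contDiff_iterate_partialDeriv h j n), ih]

theorem partialDeriv_multiDeriv_comm {φ : E3 → ℝ} (h : ContDiff ℝ ∞ φ) (i : Fin 3)
    (α : Fin 3 → ℕ) : partialDeriv i (multiDeriv α φ) = multiDeriv α (partialDeriv i φ) := by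
  have h2 := contDiff_iterate_partialDeriv h 2 (α 2)
  have h1 := contDiff_iterate_partialDeriv h2 1 (α 1)
  rw [multiDeriv, partialDeriv_iterate_comm h1, partialDeriv_iterate_comm h2,
    partialDeriv_iterate_comm h, multiDeriv]

theorem multiDeriv_zero (φ : E3 → ℝ) : multiDeriv 0 φ = φ := rfl

theorem multiDeriv_add_single {φ : E3 → ℝ} (h : ContDiff ℝ ∞ φ) (α : Fin 3 → ℕ) (i : Fin 3) :
    multiDeriv (α + Pi.single i 1) φ = partialDeriv i (multiDeriv α φ) := by
  have h2 := contDiff_iterate_partialDeriv h 2 (α 2)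
  have h1 := contDiff_iterate_partialDeriv h2 1 (α 1)
  fin_cases i
  · simp [multiDeriv, Function.iterate_succ_apply']
  · simp only [multiDeriv, Fin.mk_one, Pi.add_apply, Pi.single_apply]
    simp only [Fin.isValue, zero_ne_one, if_false, add_zero, if_true, Fin.reduceEq]
    rw [Function.iterate_succ_apply', ← partialDeriv_iterate_comm h1]
  · simp only [multiDeriv, Fin.reduceFinMk, Pi.add_apply, Pi.single_apply]
    simp only [Fin.isValue, Fin.reduceEq, if_false, add_zero, if_true]
    rw [Function.iterate_succ_apply', ← partialDeriv_iterate_comm h2,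
      ← partialDeriv_iterate_comm h1]

/-- Every multi-index is reached from `0` by adding unit vectors. -/
theorem multiIndex_induction {p : (Fin 3 → ℕ) → Prop} (zero : p 0)
    (add_single : ∀ α i, p α → p (α + Pi.single i 1)) (α : Fin 3 → ℕ) : p α := by
  have key : ∀ (n : ℕ) (α : Fin 3 → ℕ), ∑ i, α i = n → p α := by
    intro n
    induction n with
    | zero =>
      intro α hα
      have : α = 0 := by
        funext i
        exact (Finset.sum_eq_zero_iff.mp hα) i (Finset.mem_univ i)
      rwa [this]
    | succ n ih =>
      intro α hα
      obtain ⟨i, hi⟩ : ∃ i, α i ≠ 0 := by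
        by_contra! hcon
        simp [hcon] at hα
      have hsub : α - Pi.single i 1 + Pi.single i 1 = α := by
        funext j
        by_cases hj : j = i
        · subst hj
          simp only [Pi.add_apply, Pi.sub_apply, Pi.single_eq_same]
          omega
        · simp [hj]
      rw [← hsub]
      refine add_single _ _ (ih _ ?_)
      have := congrArg (fun β : Fin 3 → ℕ => ∑ j, β j) hsub
      simp only [Pi.add_apply, Finset.sum_add_distrib, Finset.sum_pi_single', Finset.mem_univ,
        if_true, hα] at this
      simpa using this
  exact key _ α rfl

theorem sum_add_single (α : Fin 3 → ℕ) (i : Fin 3) :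
    ∑ j, (α + Pi.single i 1 : Fin 3 → ℕ) j = ∑ j, α j + 1 := by
  simp [Finset.sum_add_distrib]

theorem multiDeriv_multiDeriv {φ : E3 → ℝ} (h : ContDiff ℝ ∞ φ) (α β : Fin 3 → ℕ) :
    multiDeriv α (multiDeriv β φ) = multiDeriv (α + β) φ := by
  induction α using multiIndex_induction with
  | zero => simp [multiDeriv_zero]
  | add_single α i ih =>
    rw [multiDeriv_add_single (contDiff_multiDeriv h β), ih, ← multiDeriv_add_single h,
      add_right_comm]

theorem multiDeriv_single {φ : E3 → ℝ} (h : ContDiff ℝ ∞ φ) (i : Fin 3) :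
    multiDeriv (Pi.single i 1) φ = partialDeriv i φ := by
  have := multiDeriv_add_single h 0 i
  rwa [zero_add, multiDeriv_zero] at this

theorem contDiff_list_sum {ι : Type*} (L : List ι) (F : ι → E3 → ℝ)
    (hF : ∀ p ∈ L, ContDiff ℝ ∞ (F p)) : ContDiff ℝ ∞ (L.map F).sum := by
  induction L with
  | nil => exact contDiff_const (c := (0 : ℝ))
  | cons a L ih =>
    simp only [List.map_cons, List.sum_cons]
    exact (hF a (by simp)).add (ih fun p hp => hF p (by simp [hp]))

theorem partialDeriv_list_sum {ι : Type*} (L : List ι) (F : ι → E3 → ℝ)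
    (hF : ∀ p ∈ L, ContDiff ℝ ∞ (F p)) (i : Fin 3) :
    partialDeriv i (L.map F).sum = (L.map fun p => partialDeriv i (F p)).sum := by
  induction L with
  | nil =>
    funext x
    simp only [List.map_nil, List.sum_nil, partialDeriv]
    have : fderiv ℝ (0 : E3 → ℝ) x = 0 := by
      have := fderiv_const (𝕜 := ℝ) (E := E3) (F := ℝ) (0 : ℝ)
      exact congrFun this x
    rw [this]; rfl
  | cons a L ih =>
    have hL : ∀ p ∈ L, ContDiff ℝ ∞ (F p) := fun p hp => hF p (by simp [hp])
    simp only [List.map_cons, List.sum_cons]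
    rw [partialDeriv_add (hF a (by simp)) (contDiff_list_sum L F hL), ih hL]

/-- The Leibniz rule with the coefficients hidden in a list `L` of pairs of multi-indices (repeated
according to the binomial coefficients). What matters below is that in every term other than
`b D^α v` at least one derivative falls on `b`. -/
theorem exists_leibniz (α : Fin 3 → ℕ) :
    ∃ L : List ((Fin 3 → ℕ) × (Fin 3 → ℕ)),
      (∀ p ∈ L, 1 ≤ ∑ i, p.1 i ∧ ∑ i, p.1 i + ∑ i, p.2 i ≤ ∑ i, α i) ∧
      ∀ b v : E3 → ℝ, ContDiff ℝ ∞ b → ContDiff ℝ ∞ v →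
        multiDeriv α (b * v) =
          b * multiDeriv α v + (L.map fun p => multiDeriv p.1 b * multiDeriv p.2 v).sum := by
  induction α using multiIndex_induction with
  | zero => exact ⟨[], by simp, fun b v _ _ => by simp [multiDeriv_zero]⟩
  | add_single α i ih =>
    obtain ⟨L, hL, h⟩ := ih
    refine ⟨(Pi.single i 1, α) :: (L.map (fun p => (p.1 + Pi.single i 1, p.2)) ++
      L.map (fun p => (p.1, p.2 + Pi.single i 1))), ?_, ?_⟩
    · intro p hp
      simp only [List.mem_cons, List.mem_append, List.mem_map] at hp
      rcases hp with rfl | ⟨q, hq, rfl⟩ | ⟨q, hq, rfl⟩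
      · rw [sum_add_single]
        simp [add_comm]
      · have := hL q hq
        simp only [sum_add_single]
        omega
      · have := hL q hq
        simp only [sum_add_single]
        omega
    · intro b v hb hv
      have hsm : ∀ p ∈ L, ContDiff ℝ ∞ (multiDeriv p.1 b * multiDeriv p.2 v) := fun p _ =>
        (contDiff_multiDeriv hb _).mul (contDiff_multiDeriv hv _)
      rw [multiDeriv_add_single (smooth_mul hb hv), h b v hb hv,
        partialDeriv_add (smooth_mul hb (contDiff_multiDeriv hv α)) (contDiff_list_sum L _ hsm),
        partialDeriv_mul hb (contDiff_multiDeriv hv α), ← multiDeriv_add_single hv,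
        partialDeriv_list_sum L _ hsm]
      have e : (fun p : (Fin 3 → ℕ) × (Fin 3 → ℕ) =>
          partialDeriv i (multiDeriv p.1 b * multiDeriv p.2 v)) =
          fun p => multiDeriv (p.1 + Pi.single i 1) b * multiDeriv p.2 v +
            multiDeriv p.1 b * multiDeriv (p.2 + Pi.single i 1) v := by
        funext p
        rw [partialDeriv_mul (contDiff_multiDeriv hb _) (contDiff_multiDeriv hv _),
          ← multiDeriv_add_single hb, ← multiDeriv_add_single hv]
      rw [e, List.sum_map_add]
      simp only [List.map_cons, List.map_append, List.map_map, List.sum_cons, List.sum_append,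
        Function.comp_def, multiDeriv_single hb]
      abel

/-! ### Test functions in `L²` and weak derivatives -/

theorem IsTest.memLp {φ : E3 → ℝ} (h : IsTest φ) : MemLp φ 2 (volume : Measure E3) :=
  h.smooth.continuous.memLp_of_hasCompactSupport h.compact

/-- A test function as an element of `L²`. -/
def IsTest.toL2 {φ : E3 → ℝ} (h : IsTest φ) : L2 := h.memLp.toLp φ

theorem IsTest.coeFn_toL2 {φ : E3 → ℝ} (h : IsTest φ) : h.toL2 =ᵐ[volume] φ :=
  h.memLp.coeFn_toLp

theorem IsTest.add {φ ψ : E3 → ℝ} (h : IsTest φ) (h' : IsTest ψ) : IsTest (φ + ψ) :=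
  ⟨smooth_add h.smooth h'.smooth, h.compact.add h'.compact⟩

theorem IsTest.smul {φ : E3 → ℝ} (h : IsTest φ) (c : ℝ) : IsTest (c • φ) :=
  ⟨smooth_smul h.smooth c, h.compact.smul_left (f := fun _ => c)⟩

theorem IsTest.mul_smooth {φ ψ : E3 → ℝ} (h : IsTest φ) (h' : ContDiff ℝ ∞ ψ) : IsTest (φ * ψ) :=
  ⟨smooth_mul h.smooth h', h.compact.mul_right⟩

theorem isTest_zero : IsTest 0 := ⟨contDiff_const, HasCompactSupport.zero⟩

theorem isTest_sum {ι : Type*} (s : Finset ι) (F : ι → E3 → ℝ) (hF : ∀ i ∈ s, IsTest (F i)) :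
    IsTest (∑ i ∈ s, F i) := by
  classical
  induction s using Finset.induction_on with
  | empty => simpa using isTest_zero
  | insert a s ha ih =>
    rw [Finset.sum_insert ha]
    exact (hF a (by simp)).add (ih fun i hi => hF i (by simp [hi]))

/-- The distributional pairing with a test function is an inner product of `L²`. -/
theorem pair_eq_inner (f : L2) {φ : E3 → ℝ} (h : IsTest φ) : pair f φ = inner ℝ h.toL2 f := by
  rw [L2.inner_def, pair]
  refine integral_congr_ae ?_
  filter_upwards [h.coeFn_toL2] with x hx
  rw [hx]
  simp

theorem pair_congr {f g : E3 → ℝ} (h : f =ᵐ[volume] g) (φ : E3 → ℝ) : pair f φ = pair g φ :=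
  integral_congr_ae (by filter_upwards [h] with x hx; rw [hx])

theorem pair_finset_sum_right {ι : Type*} (s : Finset ι) (f : L2) (F : ι → E3 → ℝ)
    (hF : ∀ i ∈ s, IsTest (F i)) : pair f (∑ i ∈ s, F i) = ∑ i ∈ s, pair f (F i) := by
  unfold pair
  rw [← integral_finsetSum _ fun i hi => integrable_mul_test f (hF i hi)]
  refine integral_congr_ae (.of_forall fun x => ?_)
  simp [Finset.mul_sum]

theorem pair_smul_right (f φ : E3 → ℝ) (c : ℝ) : pair f (c • φ) = c * pair f φ := by
  unfold pair
  rw [← integral_const_mul]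
  refine integral_congr_ae (.of_forall fun x => ?_)
  simp only [Pi.smul_apply, smul_eq_mul]
  ring

/-- Integration by parts against a test function. -/
theorem pair_partialDeriv {f φ : E3 → ℝ} (hf : ContDiff ℝ ∞ f) (h : IsTest φ) (i : Fin 3) :
    pair f (partialDeriv i φ) = -pair (partialDeriv i f) φ := by
  have h1 : IsTest (fun x => f x * φ x) := by
    have := h.mul_smooth hf
    rwa [mul_comm] at this
  have hint : ∀ {ψ : E3 → ℝ}, Continuous ψ → HasCompactSupport ψ → Integrable ψ volume :=
    fun h1 h2 => h1.integrable_of_hasCompactSupport h2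
  unfold pair partialDeriv
  refine integral_mul_fderiv_eq_neg_fderiv_mul_of_integrable ?_ ?_ ?_
    (fun x _ => differentiable_of_smooth hf x) (fun x _ => differentiable_of_smooth h.smooth x)
  · exact hint ((contDiff_partialDeriv hf i).continuous.mul h.smooth.continuous)
      h.compact.mul_left
  · exact hint (hf.continuous.mul (h.partialDeriv i).smooth.continuous)
      (h.partialDeriv i).compact.mul_left
  · exact hint h1.smooth.continuous h1.compact

theorem pair_multiDeriv {f φ : E3 → ℝ} (hf : ContDiff ℝ ∞ f) (h : IsTest φ) (α : Fin 3 → ℕ) :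
    pair f (multiDeriv α φ) = (-1) ^ (∑ i, α i) * pair (multiDeriv α f) φ := by
  induction α using multiIndex_induction generalizing φ with
  | zero => simp [multiDeriv_zero]
  | add_single α i ih =>
    rw [multiDeriv_add_single h.smooth, partialDeriv_multiDeriv_comm h.smooth,
      ih (h.partialDeriv i), pair_partialDeriv (contDiff_multiDeriv hf α) h,
      ← multiDeriv_add_single hf, sum_add_single, pow_succ]
    ring

/-- An element of `L²` is determined by its pairings with test functions. -/
theorem L2_ext {f g : L2} (h : ∀ φ : E3 → ℝ, IsTest φ → pair f φ = pair g φ) : f = g := by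
  refine Lp.ext (ae_eq_of_integral_contDiff_smul_eq
    ((Lp.memLp f).locallyIntegrable (by norm_num)) ((Lp.memLp g).locallyIntegrable (by norm_num))
    fun φ h1 h2 => ?_)
  have := h φ ⟨h1, h2⟩
  simp only [pair] at this
  simpa [mul_comm] using this

theorem IsWeakDeriv.unique {α : Fin 3 → ℕ} {f g g' : L2} (h : IsWeakDeriv α f g)
    (h' : IsWeakDeriv α f g') : g = g' := by
  refine L2_ext fun φ hφ => ?_
  have := (h φ hφ).symm.trans (h' φ hφ)
  exact mul_left_cancel₀ (pow_ne_zero _ (by norm_num)) this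

theorem isWeakDeriv_zero (f : L2) : IsWeakDeriv 0 f f := fun φ _ => by simp [multiDeriv_zero]

theorem IsTest.isWeakDeriv {φ : E3 → ℝ} (h : IsTest φ) (α : Fin 3 → ℕ) :
    IsWeakDeriv α h.toL2 (h.multiDeriv α).toL2 := by
  intro ψ hψ
  rw [pair_congr h.coeFn_toL2, pair_congr (h.multiDeriv α).coeFn_toL2]
  exact pair_multiDeriv h.smooth hψ α

theorem IsWeakDeriv.trans_single {α : Fin 3 → ℕ} {i : Fin 3} {f g w : L2}
    (h : IsWeakDeriv (Pi.single i 1) f g) (h' : IsWeakDeriv α g w) :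
    IsWeakDeriv (α + Pi.single i 1) f w := by
  intro φ hφ
  have h1 := h _ (hφ.multiDeriv α)
  rw [multiDeriv_single (hφ.multiDeriv α).smooth, ← multiDeriv_add_single hφ.smooth, h' φ hφ]
    at h1
  rw [h1, sum_add_single, pow_succ]
  simp

theorem continuous_pair {φ : E3 → ℝ} (h : IsTest φ) : Continuous fun f : L2 => pair f φ := by
  simp_rw [pair_eq_inner _ h]
  fun_prop

/-! ### The spaces `H^k` -/

/-- The multi-index `α`, as an index of `H^k`. -/
def MultiIndex.of {k : ℕ} (α : Fin 3 → ℕ) (h : ∑ i, α i ≤ k) : MultiIndex k :=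
  ⟨fun i => ⟨α i, Nat.lt_succ_of_le
    ((Finset.single_le_sum (f := α) (fun _ _ => Nat.zero_le _) (Finset.mem_univ i)).trans h)⟩, h⟩

@[simp] theorem MultiIndex.val_of {k : ℕ} (α : Fin 3 → ℕ) (h : ∑ i, α i ≤ k) :
    (MultiIndex.of α h).val = α := rfl

theorem MultiIndex.sum_val_le {k : ℕ} (α : MultiIndex k) : ∑ i, α.val i ≤ k := α.2

@[simp] theorem MultiIndex.of_val {k : ℕ} (α : MultiIndex k) :
    MultiIndex.of α.val α.sum_val_le = α := rfl

theorem MultiIndex.of_zero {k : ℕ} : MultiIndex.of (k := k) 0 (by simp) = MultiIndex.zero k := rfl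

/-- The derivative `D^α : H^k → L²`, with the value `0` if `|α| > k`. -/
def wderiv (k : ℕ) (α : Fin 3 → ℕ) : SobolevH k →L[ℝ] L2 :=
  if h : ∑ i, α i ≤ k then
    (PiLp.proj 2 (fun _ : MultiIndex k => L2) (MultiIndex.of α h)).comp
      (sobolevSubmodule k).subtypeL
  else 0

theorem wderiv_of_le {k : ℕ} {α : Fin 3 → ℕ} (h : ∑ i, α i ≤ k) (u : SobolevH k) :
    wderiv k α u = u.1 (MultiIndex.of α h) := by
  simp [wderiv, h]

theorem wderiv_val {k : ℕ} (α : MultiIndex k) (u : SobolevH k) : wderiv k α.val u = u.1 α := by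
  rw [wderiv_of_le α.sum_val_le, MultiIndex.of_val]

theorem fn_eq {k : ℕ} (u : SobolevH k) : fn u = (wderiv k 0 u : L2) := by
  rw [wderiv_of_le (by simp), MultiIndex.of_zero]; rfl

theorem isWeakDeriv_wderiv {k : ℕ} {α : Fin 3 → ℕ} (h : ∑ i, α i ≤ k) (u : SobolevH k) :
    IsWeakDeriv α (wderiv k 0 u) (wderiv k α u) := by
  rw [wderiv_of_le h, wderiv_of_le (by simp), MultiIndex.of_zero]
  exact u.2 (MultiIndex.of α h)

/-- An element of `H^k` is determined by its underlying function. -/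
theorem sobolev_ext {k : ℕ} {u v : SobolevH k} (h : wderiv k 0 u = wderiv k 0 v) : u = v := by
  refine Subtype.ext (PiLp.ext fun α => ?_)
  rw [← wderiv_val, ← wderiv_val]
  have h1 := isWeakDeriv_wderiv α.sum_val_le u
  rw [h] at h1
  exact h1.unique (isWeakDeriv_wderiv α.sum_val_le v)

theorem inner_sobolev {k : ℕ} (u v : SobolevH k) :
    inner ℝ u v = ∑ α : MultiIndex k, inner ℝ (wderiv k α.val u) (wderiv k α.val v) := by
  rw [Submodule.coe_inner, PiLp.inner_apply]
  exact Finset.sum_congr rfl fun α _ => by rw [wderiv_val, wderiv_val]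

theorem norm_sq_sobolev {k : ℕ} (u : SobolevH k) :
    ‖u‖ ^ 2 = ∑ α : MultiIndex k, ‖wderiv k α.val u‖ ^ 2 := by
  rw [← real_inner_self_eq_norm_sq, inner_sobolev]
  simp

theorem norm_wderiv_le {k : ℕ} (α : Fin 3 → ℕ) (u : SobolevH k) : ‖wderiv k α u‖ ≤ ‖u‖ := by
  by_cases h : ∑ i, α i ≤ k
  · have h1 := Finset.single_le_sum (s := Finset.univ)
      (f := fun β : MultiIndex k => ‖wderiv k β.val u‖ ^ 2)
      (fun _ _ => sq_nonneg _) (Finset.mem_univ (MultiIndex.of α h))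
    rw [← norm_sq_sobolev, MultiIndex.val_of] at h1
    exact (sq_le_sq₀ (norm_nonneg _) (norm_nonneg _)).1 h1
  · simp [wderiv, h]

/-- The element of `H^k` with given weak derivatives. -/
def sobolevMk (k : ℕ) (g : (Fin 3 → ℕ) → L2)
    (h : ∀ α, ∑ i, α i ≤ k → IsWeakDeriv α (g 0) (g α)) : SobolevH k :=
  ⟨WithLp.toLp 2 fun α => g α.val, fun α => h α.val α.sum_val_le⟩

theorem wderiv_sobolevMk {k : ℕ} {g : (Fin 3 → ℕ) → L2}
    (h : ∀ α, ∑ i, α i ≤ k → IsWeakDeriv α (g 0) (g α)) {α : Fin 3 → ℕ} (hα : ∑ i, α i ≤ k) :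
    wderiv k α (sobolevMk k g h) = g α := by
  rw [wderiv_of_le hα]; rfl

/-- Weak derivatives pass to `L²` limits, so `H^k` is complete. -/
theorem isClosed_sobolevSubmodule (k : ℕ) :
    IsClosed (sobolevSubmodule k : Set (PiLp 2 (fun _ : MultiIndex k => L2))) := by
  have : (sobolevSubmodule k : Set (PiLp 2 (fun _ : MultiIndex k => L2))) =
      ⋂ (α : MultiIndex k) (φ : E3 → ℝ) (_ : IsTest φ),
        {F | pair (F (MultiIndex.zero k)) (multiDeriv α.val φ) =
          (-1) ^ (∑ i, α.val i) * pair (F α) φ} := by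
    ext F
    simp only [mem_iInter]
    exact Iff.rfl
  rw [this]
  refine isClosed_iInter fun α => isClosed_iInter fun φ => isClosed_iInter fun hφ => ?_
  refine isClosed_eq ?_ (continuous_const.mul ?_)
  · exact (continuous_pair (hφ.multiDeriv _)).comp (PiLp.continuous_apply 2 _ _)
  · exact (continuous_pair hφ).comp (PiLp.continuous_apply 2 _ _)

instance instCompleteSpaceSobolevH (k : ℕ) : CompleteSpace (SobolevH k) :=
  (isClosed_sobolevSubmodule k).completeSpace_coe

/-- A test function as an element of `H^k`. -/
def IsTest.toH {φ : E3 → ℝ} (h : IsTest φ) (k : ℕ) : SobolevH k :=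
  sobolevMk k (fun α => (h.multiDeriv α).toL2) fun α _ => h.isWeakDeriv α

theorem IsTest.wderiv_toH {φ : E3 → ℝ} (h : IsTest φ) {k : ℕ} {α : Fin 3 → ℕ}
    (hα : ∑ i, α i ≤ k) : wderiv k α (h.toH k) = (h.multiDeriv α).toL2 :=
  wderiv_sobolevMk _ hα

theorem IsTest.fn_toH {φ : E3 → ℝ} (h : IsTest φ) (k : ℕ) : fn (h.toH k) =ᵐ[volume] φ := by
  rw [fn_eq, h.wderiv_toH (by simp)]
  exact h.coeFn_toL2

/-- The formally self-adjoint operator `∑_{|α| ≤ k} (-1)^{|α|} D^{2α}`, which represents the inner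
product of `H^k` against a test function. -/
def sobolevOp (k : ℕ) (φ : E3 → ℝ) : E3 → ℝ :=
  ∑ α : MultiIndex k, ((-1 : ℝ) ^ ∑ i, α.val i) • multiDeriv (α.val + α.val) φ

theorem IsTest.sobolevOp {φ : E3 → ℝ} (h : IsTest φ) (k : ℕ) : IsTest (sobolevOp k φ) :=
  isTest_sum _ _ fun _ _ => (h.multiDeriv _).smul _

theorem partialDeriv_finset_sum {ι : Type*} (s : Finset ι) (F : ι → E3 → ℝ)
    (hF : ∀ i ∈ s, IsTest (F i)) (j : Fin 3) :
    partialDeriv j (∑ i ∈ s, F i) = ∑ i ∈ s, partialDeriv j (F i) := by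
  classical
  induction s using Finset.induction_on with
  | empty =>
    have := partialDeriv_list_sum (ι := ℕ) [] (fun _ => 0) (by simp) j
    simpa using this
  | insert a s ha ih =>
    have hs : ∀ i ∈ s, IsTest (F i) := fun i hi => hF i (by simp [hi])
    rw [Finset.sum_insert ha, Finset.sum_insert ha,
      partialDeriv_add (hF a (by simp)).smooth (isTest_sum s F hs).smooth, ih hs]

theorem partialDeriv_sobolevOp {φ : E3 → ℝ} (h : IsTest φ) (k : ℕ) (j : Fin 3) :
    partialDeriv j (sobolevOp k φ) = sobolevOp k (partialDeriv j φ) := by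
  unfold sobolevOp
  rw [partialDeriv_finset_sum _ _ (fun α _ => (h.multiDeriv _).smul _)]
  refine Finset.sum_congr rfl fun α _ => ?_
  rw [partialDeriv_smul (h.multiDeriv _).smooth, partialDeriv_multiDeriv_comm h.smooth]

/-- The `H^k` inner product with a test function is a distributional pairing. This is how an
equation in the sense of distributions turns into a statement about the Hilbert space `H^k`. -/
theorem inner_toH {k : ℕ} (u : SobolevH k) {φ : E3 → ℝ} (h : IsTest φ) :
    inner ℝ u (h.toH k) = pair (fn u) (sobolevOp k φ) := by
  rw [inner_sobolev, sobolevOp, fn_eq,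
    pair_finset_sum_right _ _ _ (fun α _ => (h.multiDeriv _).smul _)]
  refine Finset.sum_congr rfl fun α _ => ?_
  have h1 := isWeakDeriv_wderiv α.sum_val_le u _ (h.multiDeriv α.val)
  rw [h.wderiv_toH α.sum_val_le, real_inner_comm, ← pair_eq_inner, pair_smul_right,
    ← multiDeriv_multiDeriv h.smooth, h1, ← mul_assoc, ← mul_pow]
  simp

theorem isGradient_iff {k l : ℕ} {u : SobolevH k} {V : VecH l} :
    IsGradient u V ↔ ∀ j, IsWeakDeriv (Pi.single j 1) (wderiv k 0 u) (wderiv l 0 (V j)) := by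
  unfold IsGradient IsWeakDeriv
  refine forall_congr' fun j => forall_congr' fun φ => forall_congr' fun h => ?_
  rw [multiDeriv_single h.smooth, fn_eq, fn_eq]
  simp

/-- The derivatives of a weak gradient are the higher derivatives of the function. -/
theorem IsGradient.isWeakDeriv {k l : ℕ} {u : SobolevH k} {V : VecH l} (h : IsGradient u V)
    (j : Fin 3) {α : Fin 3 → ℕ} (hα : ∑ i, α i ≤ l) :
    IsWeakDeriv (α + Pi.single j 1) (wderiv k 0 u) (wderiv l α (V j)) :=
  (isGradient_iff.1 h j).trans_single (isWeakDeriv_wderiv hα _)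

theorem IsGradient.wderiv_eq {k l : ℕ} {u : SobolevH k} {V : VecH l} (h : IsGradient u V)
    (j : Fin 3) {α : Fin 3 → ℕ} (hα : ∑ i, α i ≤ l) (hk : ∑ i, α i + 1 ≤ k) :
    wderiv l α (V j) = wderiv k (α + Pi.single j 1) u :=
  (h.isWeakDeriv j hα).unique (isWeakDeriv_wderiv (by rwa [sum_add_single]) u)

/-! ### Mollification and density of test functions -/

open Filter Topology Convolution

theorem lintegral_enorm_sq {X : Type*} [MeasurableSpace X] (μ : Measure X) (f : X → ℝ) :
    ∫⁻ x, ‖f x‖ₑ ^ 2 ∂μ = eLpNorm f 2 μ ^ 2 := by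
  have := eLpNorm_nnreal_pow_eq_lintegral (μ := μ) (f := f) (p := 2) (by norm_num)
  simpa using this.symm

/-- The convolution `g * η`. -/
def mollify (g η : E3 → ℝ) : E3 → ℝ := g ⋆[ContinuousLinearMap.lsmul ℝ ℝ, volume] η

theorem mollify_apply (g η : E3 → ℝ) (x : E3) : mollify g η x = pair g fun y => η (x - y) := rfl

theorem L2_locallyIntegrable (g : L2) : LocallyIntegrable g (volume : Measure E3) :=
  (Lp.memLp g).locallyIntegrable (by norm_num)

theorem contDiff_mollify (g : L2) {η : E3 → ℝ} (h : IsTest η) : ContDiff ℝ ∞ (mollify g η) :=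
  h.compact.contDiff_convolution_right (n := ⊤) _ (L2_locallyIntegrable g) h.smooth

theorem partialDeriv_mollify (g : L2) {η : E3 → ℝ} (h : IsTest η) (i : Fin 3) :
    partialDeriv i (mollify g η) = mollify g (partialDeriv i η) := by
  funext x
  have h1 := h.compact.hasFDerivAt_convolution_right (ContinuousLinearMap.lsmul ℝ ℝ)
    (L2_locallyIntegrable g) (h.smooth.of_le (by simp)) x
  unfold mollify
  rw [partialDeriv, h1.fderiv]
  exact convolution_precompR_apply (L := ContinuousLinearMap.lsmul ℝ ℝ)
    (L2_locallyIntegrable g) (h.compact.fderiv ℝ)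
    (h.smooth.fderiv_right (m := ∞) (by simp)).continuous x _

theorem multiDeriv_mollify (g : L2) {η : E3 → ℝ} (h : IsTest η) (α : Fin 3 → ℕ) :
    multiDeriv α (mollify g η) = mollify g (multiDeriv α η) := by
  induction α using multiIndex_induction with
  | zero => simp [multiDeriv_zero]
  | add_single α i ih =>
    rw [multiDeriv_add_single (contDiff_mollify g h), ih, multiDeriv_add_single h.smooth,
      partialDeriv_mollify g (h.multiDeriv α)]

theorem partialDeriv_reflect {η : E3 → ℝ} (h : ContDiff ℝ ∞ η) (x : E3) (i : Fin 3) :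
    partialDeriv i (fun y => η (x - y)) = fun y => -partialDeriv i η (x - y) := by
  funext y
  have h1 : HasFDerivAt (fun y => η (x - y)) _ y :=
    ((differentiable_of_smooth h (x - y)).hasFDerivAt).comp y
      ((hasFDerivAt_const x y).sub (hasFDerivAt_id y))
  rw [partialDeriv, h1.fderiv]
  simp [partialDeriv]

theorem IsTest.reflect {η : E3 → ℝ} (h : IsTest η) (x : E3) : IsTest fun y => η (x - y) :=
  ⟨h.smooth.comp (contDiff_const.sub contDiff_id),
    h.compact.comp_homeomorph (Homeomorph.subLeft x)⟩

theorem multiDeriv_reflect {η : E3 → ℝ} (h : IsTest η) (x : E3) (α : Fin 3 → ℕ) :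
    multiDeriv α (fun y => η (x - y)) =
      ((-1 : ℝ) ^ ∑ i, α i) • fun y => multiDeriv α η (x - y) := by
  induction α using multiIndex_induction with
  | zero => simp [multiDeriv_zero]
  | add_single α i ih =>
    rw [multiDeriv_add_single (h.reflect x).smooth, ih,
      partialDeriv_smul ((h.multiDeriv α).reflect x).smooth,
      partialDeriv_reflect (h.multiDeriv α).smooth, sum_add_single, multiDeriv_add_single h.smooth]
    funext y
    simp [pow_succ]

/-- Weak derivatives commute with mollification. -/
theorem IsWeakDeriv.mollify {α : Fin 3 → ℕ} {f g : L2} (hfg : IsWeakDeriv α f g) {η : E3 → ℝ}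
    (h : IsTest η) : multiDeriv α (mollify f η) = mollify g η := by
  rw [multiDeriv_mollify f h]
  funext x
  have h1 := hfg _ (h.reflect x)
  rw [multiDeriv_reflect h, pair_smul_right] at h1
  rw [mollify_apply, mollify_apply]
  exact mul_left_cancel₀ (pow_ne_zero _ (by norm_num)) h1

/-- Continuity of translations in `L²`. -/
theorem exists_translation_small (g : L2) {ρ : ℝ} (hρ : 0 < ρ) :
    ∃ ε > 0, ∀ z : E3, ‖z‖ < ε →
      eLpNorm (fun x => g (x - z) - g x) 2 volume ≤ ENNReal.ofReal ρ := by
  let τ : C(E3, C(E3, E3)) := ContinuousMap.curry ⟨fun p : E3 × E3 => p.2 - p.1, by fun_prop⟩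
  have hτ : ∀ z, MeasurePreserving (τ z) (volume : Measure E3) volume := fun z =>
    measurePreserving_sub_right volume z
  have hc : Continuous fun z => Lp.compMeasurePreserving (τ z) (hτ z) g :=
    continuous_const.compMeasurePreservingLp τ.continuous hτ (by norm_num)
  have h0 : Lp.compMeasurePreserving (τ 0) (hτ 0) g = g := by
    refine Lp.ext ((Lp.coeFn_compMeasurePreserving g (hτ 0)).trans (.of_forall fun x => ?_))
    have : τ 0 x = x := sub_zero x
    simp [this]
  obtain ⟨ε, hε, h⟩ := Metric.continuousAt_iff.1 (hc.continuousAt (x := 0)) ρ hρ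
  refine ⟨ε, hε, fun z hz => ?_⟩
  have h1 := h (by simpa using hz : dist z 0 < ε)
  rw [h0, dist_eq_norm] at h1
  have h2 : eLpNorm (fun x => g (x - z) - g x) 2 volume =
      ENNReal.ofReal ‖Lp.compMeasurePreserving (τ z) (hτ z) g - g‖ := by
    rw [Lp.norm_def, ENNReal.ofReal_toReal (Lp.eLpNorm_ne_top _)]
    refine eLpNorm_congr_ae ?_
    filter_upwards [Lp.coeFn_sub (Lp.compMeasurePreserving (τ z) (hτ z) g) g,
      Lp.coeFn_compMeasurePreserving g (hτ z)] with x hx1 hx2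
    rw [hx1, Pi.sub_apply, hx2]
    rfl
  rw [h2]
  exact ENNReal.ofReal_le_ofReal h1.le

/-- A probability average of translates of `g` is as close to `g` as the translates are. -/
theorem eLpNorm_mollify_sub_le (g : L2) {η : E3 → ℝ} (h : IsTest η) (hη0 : ∀ z, 0 ≤ η z)
    (hη1 : ∫ z, η z = 1) {ε : ℝ} (hε : ∀ z, η z ≠ 0 → ‖z‖ < ε) {M : ENNReal}
    (hM : ∀ z : E3, ‖z‖ < ε → eLpNorm (fun x => g (x - z) - g x) 2 volume ≤ M) :
    eLpNorm (fun x => mollify g η x - g x) 2 volume ≤ M := by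
  have hgm : Measurable (g : E3 → ℝ) := (Lp.stronglyMeasurable g).measurable
  have hηint : Integrable η volume := h.smooth.continuous.integrable_of_hasCompactSupport h.compact
  set w : E3 → ENNReal := fun z => ENNReal.ofReal (η z) with hw
  have hwm : Measurable w := h.smooth.continuous.measurable.ennreal_ofReal
  have hw1 : ∫⁻ z, w z = 1 := by
    rw [hw, ← ofReal_integral_eq_lintegral_ofReal hηint (.of_forall hη0), hη1]
    simp
  have hprob : IsProbabilityMeasure ((volume : Measure E3).withDensity w) :=
    ⟨by rw [withDensity_apply _ MeasurableSet.univ, Measure.restrict_univ, hw1]⟩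
  have hpt : ∀ x, ‖mollify g η x - g x‖ₑ ^ 2 ≤ ∫⁻ z, w z * ‖g (x - z) - g x‖ₑ ^ 2 := by
    intro x
    have e1 : mollify g η x = ∫ z, g (x - z) * η z := by
      have := integral_sub_left_eq_self (fun z => g (x - z) * η z) (volume : Measure E3) x
      rw [← this]
      simp [mollify_apply, pair]
    have hi : Integrable (fun z => g (x - z) * η z) := by
      have := (integrable_mul_test g (h.reflect x)).comp_sub_left x
      simpa using this
    have e2 : mollify g η x - g x = ∫ z, (g (x - z) - g x) * η z := by
      simp_rw [sub_mul]
      rw [integral_sub hi (hηint.const_mul _), integral_const_mul, hη1, e1, mul_one]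
    have hm : Measurable fun z => g (x - z) - g x :=
      (hgm.comp (measurable_const.sub measurable_id)).sub measurable_const
    -- Jensen's inequality for the probability measure `η dz`
    calc ‖mollify g η x - g x‖ₑ ^ 2
        ≤ (∫⁻ z, ‖(g (x - z) - g x) * η z‖ₑ) ^ 2 := by
          rw [e2]; gcongr; exact enorm_integral_le_lintegral_enorm _
      _ = (∫⁻ z, ‖g (x - z) - g x‖ₑ ∂((volume : Measure E3).withDensity w)) ^ 2 := by
          rw [lintegral_withDensity_eq_lintegral_mul _ hwm hm.enorm]
          congr 1
          refine lintegral_congr fun z => ?_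
          rw [enorm_mul, Pi.mul_apply, mul_comm, hw, Real.enorm_eq_ofReal (hη0 z)]
      _ ≤ ∫⁻ z, ‖g (x - z) - g x‖ₑ ^ 2 ∂((volume : Measure E3).withDensity w) := by
          rw [lintegral_enorm_sq, ← eLpNorm_one_eq_lintegral_enorm]
          gcongr
          exact eLpNorm_le_eLpNorm_of_exponent_le (by norm_num) hm.aestronglyMeasurable
      _ = ∫⁻ z, w z * ‖g (x - z) - g x‖ₑ ^ 2 := by
          rw [lintegral_withDensity_eq_lintegral_mul _ hwm (hm.enorm.pow_const 2)]
          rfl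
  have hjm : Measurable fun p : E3 × E3 => w p.2 * ‖g (p.1 - p.2) - g p.1‖ₑ ^ 2 :=
    (hwm.comp measurable_snd).mul
      (((hgm.comp (measurable_fst.sub measurable_snd)).sub (hgm.comp measurable_fst)).enorm.pow_const
        2)
  have key : eLpNorm (fun x => mollify g η x - g x) 2 volume ^ 2 ≤ M ^ 2 :=
    calc eLpNorm (fun x => mollify g η x - g x) 2 volume ^ 2
        = ∫⁻ x, ‖mollify g η x - g x‖ₑ ^ 2 := (lintegral_enorm_sq _ _).symm
      _ ≤ ∫⁻ x, ∫⁻ z, w z * ‖g (x - z) - g x‖ₑ ^ 2 := lintegral_mono hpt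
      _ = ∫⁻ z, ∫⁻ x, w z * ‖g (x - z) - g x‖ₑ ^ 2 := lintegral_lintegral_swap hjm.aemeasurable
      _ ≤ ∫⁻ z, w z * M ^ 2 := by
          refine lintegral_mono fun z => ?_
          have hm : Measurable fun x => ‖g (x - z) - g x‖ₑ ^ 2 :=
            ((hgm.comp (measurable_id.sub measurable_const)).sub hgm).enorm.pow_const 2
          rw [lintegral_const_mul _ hm]
          by_cases hz : η z = 0
          · simp [hw, hz]
          · gcongr
            rw [lintegral_enorm_sq]
            gcongr
            exact hM z (hε z hz)
      _ = M ^ 2 := by rw [lintegral_mul_const _ hwm, hw1, one_mul]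
  exact (ENNReal.pow_le_pow_left_iff two_ne_zero).1 key

/-- Finitely many `L²` functions are approximated by one and the same mollification. -/
theorem exists_mollifier {ι : Type*} (s : Finset ι) (g : ι → L2) {ρ : ℝ} (hρ : 0 < ρ) :
    ∃ η : E3 → ℝ, IsTest η ∧
      ∀ i ∈ s, eLpNorm (fun x => mollify (g i) η x - g i x) 2 volume ≤ ENNReal.ofReal ρ := by
  classical
  have hex : ∃ ε > 0, ∀ i ∈ s, ∀ z : E3, ‖z‖ < ε →
      eLpNorm (fun x => g i (x - z) - g i x) 2 volume ≤ ENNReal.ofReal ρ := by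
    induction s using Finset.induction_on with
    | empty => exact ⟨1, one_pos, by simp⟩
    | insert a s ha ih =>
      obtain ⟨ε, hε, h⟩ := ih
      obtain ⟨ε', hε', h'⟩ := exists_translation_small (g a) hρ
      refine ⟨min ε ε', lt_min hε hε', fun i hi z hz => ?_⟩
      rcases Finset.mem_insert.1 hi with rfl | hi
      · exact h' z (hz.trans_le (min_le_right _ _))
      · exact h i hi z (hz.trans_le (min_le_left _ _))
  obtain ⟨ε, hε, h⟩ := hex
  let b : ContDiffBump (0 : E3) := ⟨ε / 2, ε, half_pos hε, half_lt_self hε⟩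
  have hb : IsTest (b.normed volume) := ⟨b.contDiff_normed (n := ⊤), b.hasCompactSupport_normed⟩
  refine ⟨b.normed volume, hb, fun i hi => eLpNorm_mollify_sub_le (g i) hb b.nonneg_normed
    b.integral_normed (ε := ε) (fun z hz => ?_) (h i hi)⟩
  have hz' : z ∈ Function.support (b.normed volume) := hz
  rw [b.support_normed_eq] at hz'
  simpa using hz'

/-! ### Cut-offs and density of test functions -/

theorem partialDeriv_scale {χ : E3 → ℝ} (h : ContDiff ℝ ∞ χ) (r : ℝ) (i : Fin 3) :
    partialDeriv i (fun x => χ (r • x)) = r • fun x => partialDeriv i χ (r • x) := by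
  funext x
  have h1 : HasFDerivAt (fun x => χ (r • x)) _ x :=
    ((differentiable_of_smooth h (r • x)).hasFDerivAt).comp x ((hasFDerivAt_id x).const_smul r)
  rw [partialDeriv, h1.fderiv]
  simp [partialDeriv]

theorem smooth_scale {χ : E3 → ℝ} (h : ContDiff ℝ ∞ χ) (r : ℝ) :
    ContDiff ℝ ∞ fun x => χ (r • x) := h.comp (contDiff_id.const_smul r)

theorem multiDeriv_scale {χ : E3 → ℝ} (h : ContDiff ℝ ∞ χ) (r : ℝ) (α : Fin 3 → ℕ) :
    multiDeriv α (fun x => χ (r • x)) = (r ^ ∑ i, α i) • fun x => multiDeriv α χ (r • x) := by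
  induction α using multiIndex_induction with
  | zero => simp [multiDeriv_zero]
  | add_single α i ih =>
    rw [multiDeriv_add_single (smooth_scale h r), ih,
      partialDeriv_smul (smooth_scale (contDiff_multiDeriv h α) r),
      partialDeriv_scale (contDiff_multiDeriv h α), sum_add_single, multiDeriv_add_single h,
      smul_smul, pow_succ]

/-- A bounded sequence of factors that tends to zero pointwise sends `L²` functions to zero in
`L²`, by dominated convergence. -/
theorem tendsto_eLpNorm_mul {c : ℕ → E3 → ℝ} {h : E3 → ℝ} (hh : MemLp h 2 volume)
    (hc : ∀ n, Continuous (c n)) {C : ℝ} (hC : ∀ n x, |c n x| ≤ C)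
    (h0 : ∀ x, Tendsto (fun n => c n x) atTop (𝓝 0)) :
    Tendsto (fun n => eLpNorm (c n * h) 2 volume) atTop (𝓝 0) := by
  have key : Tendsto (fun n => ∫⁻ x, ‖(c n * h) x‖ₑ ^ 2) atTop (𝓝 (∫⁻ _ : E3, 0)) := by
    refine tendsto_lintegral_of_dominated_convergence'
      (fun x => ENNReal.ofReal C ^ 2 * ‖h x‖ₑ ^ 2) ?_ ?_ ?_ ?_
    · intro n
      exact (((hc n).aestronglyMeasurable.mul hh.1).enorm.pow_const 2)
    · intro n
      refine .of_forall fun x => ?_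
      simp only [Pi.mul_apply, enorm_mul, mul_pow]
      gcongr
      rw [Real.enorm_eq_ofReal_abs]
      exact ENNReal.ofReal_le_ofReal (hC n x)
    · rw [lintegral_const_mul'' _ (hh.1.enorm.pow_const 2), lintegral_enorm_sq]
      exact (ENNReal.mul_lt_top (by simp) (ENNReal.pow_lt_top hh.2)).ne
    · refine .of_forall fun x => ?_
      have h1 : Tendsto (fun n => (c n * h) x) atTop (𝓝 0) := by
        simpa using (h0 x).mul_const (h x)
      have h2 := h1.enorm
      simp only [enorm_zero] at h2
      simpa using ENNReal.Tendsto.pow (n := 2) h2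
  simp only [lintegral_zero] at key
  have h3 : ∀ n, eLpNorm (c n * h) 2 volume =
      (∫⁻ x, ‖(c n * h) x‖ₑ ^ 2) ^ (1 / 2 : ℝ) := by
    intro n
    rw [lintegral_enorm_sq, ← ENNReal.rpow_natCast, ← ENNReal.rpow_mul]
    norm_num
  simp_rw [h3]
  have h4 := (ENNReal.continuous_rpow_const (y := (1 / 2 : ℝ))).tendsto 0 |>.comp key
  rwa [ENNReal.zero_rpow_of_pos (by norm_num)] at h4

theorem tendsto_eLpNorm_list_sum {ι : Type*} (L : List ι) (F : ι → ℕ → E3 → ℝ)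
    (hm : ∀ p ∈ L, ∀ n, AEStronglyMeasurable (F p n) volume)
    (hF : ∀ p ∈ L, Tendsto (fun n => eLpNorm (F p n) 2 volume) atTop (𝓝 0)) :
    Tendsto (fun n => eLpNorm (L.map fun p => F p n).sum 2 volume) atTop (𝓝 0) := by
  have hms : ∀ (L : List ι), (∀ p ∈ L, ∀ n, AEStronglyMeasurable (F p n) volume) →
      ∀ n, AEStronglyMeasurable (L.map fun p => F p n).sum volume := by
    intro L hL n
    refine List.aestronglyMeasurable_sum _ fun f hf => ?_
    obtain ⟨p, hp, rfl⟩ := List.mem_map.1 hf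
    exact hL p hp n
  induction L with
  | nil => simp
  | cons a L ih =>
    have hL : ∀ p ∈ L, ∀ n, AEStronglyMeasurable (F p n) volume :=
      fun p hp => hm p (by simp [hp])
    have h1 := (hF a (by simp)).add (ih hL fun p hp => hF p (by simp [hp]))
    rw [add_zero] at h1
    refine tendsto_of_tendsto_of_tendsto_of_le_of_le tendsto_const_nhds h1
      (fun _ => zero_le) fun n => ?_
    simp only [List.map_cons, List.sum_cons]
    exact eLpNorm_add_le (hm a (by simp) n) (hms L hL n) (by norm_num)

/-- Smooth functions with square integrable derivatives are approximated by their cut-offs. -/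
theorem exists_test_approx_smooth {F : E3 → ℝ} (hF : ContDiff ℝ ∞ F) (k : ℕ)
    (hL2 : ∀ α : Fin 3 → ℕ, ∑ i, α i ≤ k → MemLp (multiDeriv α F) 2 volume) {ρ : ENNReal}
    (hρ : 0 < ρ) :
    ∃ ψ : E3 → ℝ, IsTest ψ ∧ ∀ α : MultiIndex k,
      eLpNorm (multiDeriv α.val ψ - multiDeriv α.val F) 2 volume ≤ ρ := by
  let b : ContDiffBump (0 : E3) := ⟨1, 2, one_pos, one_lt_two⟩
  have hb : IsTest b := ⟨b.contDiff, b.hasCompactSupport⟩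
  let r : ℕ → ℝ := fun n => 1 / ((n : ℝ) + 1)
  have hr0 : ∀ n, 0 < r n := fun n => by positivity
  have hr1 : ∀ n, r n ≤ 1 := fun n => by
    simp only [r]; rw [div_le_one (by positivity)]; linarith [n.cast_nonneg (α := ℝ)]
  have hrt : Tendsto r atTop (𝓝 0) := tendsto_one_div_add_atTop_nhds_zero_nat
  -- the cut-off `χ n` is `1` near the origin and lives on the ball of radius `2 (n + 1)`; every
  -- derivative of it gains a factor `r n`
  let χ : ℕ → E3 → ℝ := fun n x => b (r n • x)
  have hχ : ∀ n, ContDiff ℝ ∞ (χ n) := fun n => smooth_scale hb.smooth _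
  have hχt : ∀ n, IsTest (χ n) := fun n =>
    ⟨hχ n, hb.compact.comp_homeomorph (Homeomorph.smulOfNeZero (r n) (hr0 n).ne')⟩
  have key : ∀ α : MultiIndex k, Tendsto
      (fun n => eLpNorm (multiDeriv α.val (χ n * F) - multiDeriv α.val F) 2 volume)
        atTop (𝓝 0) := by
    intro α
    obtain ⟨L, hL, hleib⟩ := exists_leibniz α.val
    have e : ∀ n, multiDeriv α.val (χ n * F) - multiDeriv α.val F =
        (χ n - 1) * multiDeriv α.val F +
          (L.map fun p => multiDeriv p.1 (χ n) * multiDeriv p.2 F).sum := by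
      intro n
      rw [hleib _ _ (hχ n) hF]
      ring
    -- only the term without derivatives of `χ n` survives in the limit
    simp_rw [e]
    have t1 : Tendsto (fun n => eLpNorm ((χ n - 1) * multiDeriv α.val F) 2 volume)
        atTop (𝓝 0) := by
      refine tendsto_eLpNorm_mul (hL2 _ α.sum_val_le)
        (fun n => (hχ n).continuous.sub continuous_const) (C := 1) (fun n x => ?_) fun x => ?_
      · simp only [Pi.sub_apply, Pi.one_apply, χ]
        rw [abs_le]
        have := b.nonneg (x := r n • x)
        have := b.le_one (x := r n • x)
        constructor <;> linarith
      · have h1 : Tendsto (fun n => r n • x) atTop (𝓝 0) := by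
          simpa using hrt.smul_const x
        have h2 := (hb.smooth.continuous.tendsto 0).comp h1
        have h3 : b 0 = 1 := b.one_of_mem_closedBall (by simp [b])
        rw [h3] at h2
        simpa [χ] using h2.sub_const 1
    have t2 := tendsto_eLpNorm_list_sum L
      (fun p n => multiDeriv p.1 (χ n) * multiDeriv p.2 F)
      (fun p _ n => ((contDiff_multiDeriv (hχ n) _).continuous.mul
        (contDiff_multiDeriv hF _).continuous).aestronglyMeasurable) fun p hp => by
        obtain ⟨hp1, hp2⟩ := hL p hp
        have hα := α.sum_val_le
        obtain ⟨C, hC⟩ := (hb.multiDeriv p.1).smooth.continuous.bounded_above_of_compact_support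
          (hb.multiDeriv p.1).compact
        have eχ : ∀ n x, multiDeriv p.1 (χ n) x =
            r n ^ (∑ i, p.1 i) * multiDeriv p.1 b (r n • x) := fun n x => by
          have := multiDeriv_scale hb.smooth (r n) p.1
          exact congrFun this x
        have hb1 : ∀ n x, |multiDeriv p.1 (χ n) x| ≤ r n * C := by
          intro n x
          rw [eχ, abs_mul, abs_of_nonneg (pow_nonneg (hr0 n).le _)]
          have h1 : r n ^ (∑ i, p.1 i) ≤ r n := pow_le_of_le_one (hr0 n).le (hr1 n) (by omega)
          exact mul_le_mul h1 (hC _) (abs_nonneg _) (hr0 n).le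
        have hC0 : 0 ≤ C := (norm_nonneg _).trans (hC 0)
        refine tendsto_eLpNorm_mul (hL2 _ (by omega))
          (fun n => (contDiff_multiDeriv (hχ n) _).continuous) (C := C)
          (fun n x => (hb1 n x).trans (mul_le_of_le_one_left hC0 (hr1 n))) fun x => ?_
        refine squeeze_zero_norm (fun n => hb1 n x) ?_
        simpa using hrt.mul_const C
    have t3 := t1.add t2
    rw [add_zero] at t3
    refine tendsto_of_tendsto_of_tendsto_of_le_of_le tendsto_const_nhds t3
      (fun _ => zero_le) fun n => ?_
    refine eLpNorm_add_le ?_ ?_ (by norm_num)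
    · exact (((hχ n).continuous.sub continuous_const).mul
        (contDiff_multiDeriv hF _).continuous).aestronglyMeasurable
    · refine List.aestronglyMeasurable_sum _ fun f hf => ?_
      obtain ⟨p, hp, rfl⟩ := List.mem_map.1 hf
      exact ((contDiff_multiDeriv (hχ n) _).continuous.mul
        (contDiff_multiDeriv hF _).continuous).aestronglyMeasurable
  have hev : ∀ᶠ n in atTop, ∀ α : MultiIndex k,
      eLpNorm (multiDeriv α.val (χ n * F) - multiDeriv α.val F) 2 volume < ρ :=
    eventually_all.2 fun α => (key α).eventually_lt_const hρ
  obtain ⟨n, hn⟩ := hev.exists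
  exact ⟨χ n * F, (hχt n).mul_smooth hF, fun α => (hn α).le⟩

/-- A function with weak derivatives up to order `k` in `L²` is approximated by test functions
together with these derivatives. -/
theorem exists_test_approx (k : ℕ) (g : (Fin 3 → ℕ) → L2)
    (hg : ∀ α, ∑ i, α i ≤ k → IsWeakDeriv α (g 0) (g α)) {ρ : ℝ} (hρ : 0 < ρ) :
    ∃ ψ : E3 → ℝ, ∃ h : IsTest ψ, ∀ α : Fin 3 → ℕ, ∑ i, α i ≤ k →
      ‖(h.multiDeriv α).toL2 - g α‖ ≤ ρ := by
  obtain ⟨η, hη, hηg⟩ := exists_mollifier (Finset.univ : Finset (MultiIndex k))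
    (fun α => g α.val) (half_pos hρ)
  have hD : ∀ α, ∑ i, α i ≤ k → multiDeriv α (mollify (g 0) η) = mollify (g α) η :=
    fun α hα => (hg α hα).mollify hη
  have hsub : ∀ α, ∑ i, α i ≤ k →
      eLpNorm (fun x => mollify (g α) η x - g α x) 2 volume ≤ ENNReal.ofReal (ρ / 2) :=
    fun α hα => hηg (MultiIndex.of α hα) (Finset.mem_univ _)
  have hmem : ∀ α, ∑ i, α i ≤ k → MemLp (multiDeriv α (mollify (g 0) η)) 2 volume := by
    intro α hα
    rw [hD α hα]
    have h1 : MemLp (fun x => mollify (g α) η x - g α x) 2 volume :=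
      ⟨(contDiff_mollify _ hη).continuous.aestronglyMeasurable.sub (Lp.memLp _).1,
        (hsub α hα).trans_lt ENNReal.ofReal_lt_top⟩
    convert! h1.add (Lp.memLp (g α)) using 1
    funext x
    simp
  obtain ⟨ψ, hψ, hψd⟩ := exists_test_approx_smooth (contDiff_mollify (g 0) hη) k hmem
    (ENNReal.ofReal_pos.2 (half_pos hρ))
  refine ⟨ψ, hψ, fun α hα => ?_⟩
  have e : eLpNorm ((hψ.multiDeriv α).toL2 - g α : L2) 2 volume =
      eLpNorm ((multiDeriv α ψ - multiDeriv α (mollify (g 0) η)) +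
        fun x => mollify (g α) η x - g α x) 2 volume := by
    refine eLpNorm_congr_ae ?_
    filter_upwards [Lp.coeFn_sub (hψ.multiDeriv α).toL2 (g α), (hψ.multiDeriv α).coeFn_toL2]
      with x hx1 hx2
    rw [hx1, Pi.sub_apply, hx2, hD α hα]
    simp
  rw [Lp.norm_def, e]
  refine ENNReal.toReal_le_of_le_ofReal hρ.le ?_
  refine (eLpNorm_add_le ?_ ?_ (by norm_num)).trans ?_
  · exact ((contDiff_multiDeriv hψ.smooth _).continuous.sub
      (contDiff_multiDeriv (contDiff_mollify _ hη) _).continuous).aestronglyMeasurable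
  · exact (contDiff_mollify _ hη).continuous.aestronglyMeasurable.sub (Lp.memLp _).1
  · have h2 := hψd (MultiIndex.of α hα)
    rw [MultiIndex.val_of] at h2
    calc _ ≤ ENNReal.ofReal (ρ / 2) + ENNReal.ofReal (ρ / 2) := add_le_add h2 (hsub α hα)
      _ = ENNReal.ofReal ρ := by
        rw [← ENNReal.ofReal_add (half_pos hρ).le (half_pos hρ).le, add_halves]

/-- The `H^k` norm is controlled by the largest of the weak derivatives. -/
theorem norm_sobolev_le {k : ℕ} (u : SobolevH k) {ρ : ℝ} (hρ : 0 ≤ ρ)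
    (h : ∀ α : Fin 3 → ℕ, ∑ i, α i ≤ k → ‖wderiv k α u‖ ≤ ρ) :
    ‖u‖ ≤ Fintype.card (MultiIndex k) * ρ := by
  have hc : (1 : ℝ) ≤ Fintype.card (MultiIndex k) := by
    have : 0 < Fintype.card (MultiIndex k) := Fintype.card_pos_iff.2 ⟨MultiIndex.zero k⟩
    exact_mod_cast this
  refine (sq_le_sq₀ (norm_nonneg _) (by positivity)).1 ?_
  rw [norm_sq_sobolev, mul_pow]
  calc ∑ α : MultiIndex k, ‖wderiv k α.val u‖ ^ 2 ≤ ∑ _α : MultiIndex k, ρ ^ 2 :=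
        Finset.sum_le_sum fun α _ => by
          gcongr
          exact h _ α.sum_val_le
    _ = Fintype.card (MultiIndex k) * ρ ^ 2 := by simp
    _ ≤ Fintype.card (MultiIndex k) ^ 2 * ρ ^ 2 := by
        gcongr
        nlinarith

theorem exists_toH_approx {k : ℕ} (u : SobolevH k) {ρ : ℝ} (hρ : 0 < ρ) :
    ∃ ψ : E3 → ℝ, ∃ h : IsTest ψ, ‖h.toH k - u‖ ≤ ρ := by
  have hc : (0 : ℝ) < Fintype.card (MultiIndex k) := by
    have : 0 < Fintype.card (MultiIndex k) := Fintype.card_pos_iff.2 ⟨MultiIndex.zero k⟩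
    exact_mod_cast this
  obtain ⟨ψ, h, hψ⟩ := exists_test_approx k (fun α => wderiv k α u)
    (fun α hα => isWeakDeriv_wderiv hα u) (div_pos hρ hc)
  refine ⟨ψ, h, (norm_sobolev_le _ (div_pos hρ hc).le fun α hα => ?_).trans_eq
    (mul_div_cancel₀ _ hc.ne')⟩
  rw [map_sub, h.wderiv_toH hα]
  exact hψ α hα

/-- `C_c^∞` is dense in `H^k`. -/
theorem dense_toH (k : ℕ) : Dense {u : SobolevH k | ∃ ψ, ∃ h : IsTest ψ, u = h.toH k} := by
  intro u
  refine Metric.mem_closure_iff.2 fun ρ hρ => ?_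
  obtain ⟨ψ, h, hψ⟩ := exists_toH_approx u (half_pos hρ)
  exact ⟨_, ⟨ψ, h, rfl⟩, by rw [dist_comm, dist_eq_norm]; linarith⟩

/-! ### Sobolev inequalities for test functions -/

open scoped SchwartzMap FourierTransform LineDeriv

/-- A test function as a complex-valued Schwartz function. -/
def IsTest.toSchwartz {φ : E3 → ℝ} (h : IsTest φ) : 𝓢(E3, ℂ) :=
  HasCompactSupport.toSchwartzMap (f := fun x => (φ x : ℂ))
    (h.compact.comp_left (g := fun r : ℝ => (r : ℂ)) (by simp))
    (Complex.ofRealCLM.contDiff.comp h.smooth)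

theorem IsTest.toSchwartz_apply {φ : E3 → ℝ} (h : IsTest φ) (x : E3) :
    h.toSchwartz x = (φ x : ℂ) := rfl

theorem IsTest.lineDeriv_toSchwartz {φ : E3 → ℝ} (h : IsTest φ) (i : Fin 3) :
    ∂_{EuclideanSpace.single i (1 : ℝ)} h.toSchwartz = (h.partialDeriv i).toSchwartz := by
  ext x
  rw [SchwartzMap.lineDerivOp_apply_eq_fderiv, IsTest.toSchwartz_apply]
  have h1 : HasFDerivAt (fun x => (φ x : ℂ)) _ x :=
    Complex.ofRealCLM.hasFDerivAt.comp x (differentiable_of_smooth h.smooth x).hasFDerivAt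
  have h2 : fderiv ℝ (h.toSchwartz : E3 → ℂ) x = _ := h1.fderiv
  rw [h2]
  rfl

theorem IsTest.norm_toSchwartz {φ : E3 → ℝ} (h : IsTest φ) :
    ‖h.toSchwartz.toLp 2‖ = ‖h.toL2‖ := by
  rw [SchwartzMap.norm_toLp, Lp.norm_def, eLpNorm_congr_ae h.coeFn_toL2]
  congr 1
  refine eLpNorm_congr_norm_ae (.of_forall fun x => ?_)
  rw [h.toSchwartz_apply]
  simp

theorem integrable_inv_one_add_norm_sq :
    Integrable fun ξ : E3 => ((1 + ‖ξ‖ ^ 2)⁻¹) ^ 2 := by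
  have h := integrable_rpow_neg_one_add_norm_sq (E := E3) (μ := volume) (r := 4)
    (by simp; norm_num)
  refine h.congr (.of_forall fun ξ => ?_)
  have h0 : (0 : ℝ) < 1 + ‖ξ‖ ^ 2 := by positivity
  simp only
  rw [show (-4 / 2 : ℝ) = -((2 : ℕ) : ℝ) by norm_num, Real.rpow_neg h0.le, Real.rpow_natCast,
    inv_pow]

/-- `f - Δf`, which the Fourier transform turns into multiplication by `1 + 4π²|ξ|²`. -/
def oneSubLaplacian (f : 𝓢(E3, ℂ)) : 𝓢(E3, ℂ) :=
  f - ∑ i : Fin 3, ∂_{EuclideanSpace.single i (1 : ℝ)} (∂_{EuclideanSpace.single i (1 : ℝ)} f)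

theorem fourierInv_second_lineDeriv (f : 𝓢(E3, ℂ)) (i : Fin 3) (ξ : E3) :
    (𝓕⁻ (∂_{EuclideanSpace.single i (1 : ℝ)} (∂_{EuclideanSpace.single i (1 : ℝ)} f))) ξ =
      -(((2 * Real.pi) ^ 2 * ξ i ^ 2 : ℝ) : ℂ) * 𝓕⁻ f ξ := by
  have hm : (fun ξ : E3 => inner ℝ ξ (EuclideanSpace.single i (1 : ℝ))).HasTemperateGrowth := by
    fun_prop
  rw [SchwartzMap.fourierInv_lineDerivOp_eq, SchwartzMap.fourierInv_lineDerivOp_eq,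
    smul_apply, SchwartzMap.smulLeftCLM_apply_apply hm,
    smul_apply, SchwartzMap.smulLeftCLM_apply_apply hm]
  simp only [EuclideanSpace.inner_single_right, smul_eq_mul, Complex.real_smul]
  push_cast
  simp
  linear_combination (4 * (Real.pi : ℂ) ^ 2 * (ξ i : ℂ) ^ 2 * 𝓕⁻ f ξ) * Complex.I_sq

theorem fourierInv_oneSubLaplacian (f : 𝓢(E3, ℂ)) (ξ : E3) :
    𝓕⁻ (oneSubLaplacian f) ξ = ((1 + (2 * Real.pi) ^ 2 * ‖ξ‖ ^ 2 : ℝ) : ℂ) * 𝓕⁻ f ξ := by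
  have hsum : 𝓕⁻ (oneSubLaplacian f) = 𝓕⁻ f - ∑ i : Fin 3,
      𝓕⁻ (∂_{EuclideanSpace.single i (1 : ℝ)} (∂_{EuclideanSpace.single i (1 : ℝ)} f)) := by
    have := map_sub (FourierTransform.fourierInvCLM ℂ 𝓢(E3, ℂ)) f
      (∑ i : Fin 3, ∂_{EuclideanSpace.single i (1 : ℝ)} (∂_{EuclideanSpace.single i (1 : ℝ)} f))
    rw [map_sum] at this
    exact this
  rw [hsum, sub_apply, sum_apply]
  simp_rw [fourierInv_second_lineDeriv]
  rw [EuclideanSpace.norm_sq_eq]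
  simp only [Fin.sum_univ_three, Real.norm_eq_abs, sq_abs]
  push_cast
  ring

/-- The Cauchy-Schwarz inequality with the weight `(1 + |ξ|²)⁻¹`, which is square integrable in
three dimensions. -/
theorem integral_norm_le_of_weight {F G : 𝓢(E3, ℂ)}
    (hb : ∀ ξ, (1 + ‖ξ‖ ^ 2) * ‖F ξ‖ ≤ ‖G ξ‖) :
    ∫ ξ, ‖F ξ‖ ≤ Real.sqrt (∫ ξ : E3, ((1 + ‖ξ‖ ^ 2)⁻¹) ^ 2) * ‖G.toLp 2‖ := by
  have hgm : MemLp (fun ξ => ‖G ξ‖) 2 volume := (G.memLp 2 volume).norm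
  have ham : MemLp (fun ξ : E3 => (1 + ‖ξ‖ ^ 2)⁻¹) 2 volume := by
    refine (memLp_two_iff_integrable_sq ?_).2 integrable_inv_one_add_norm_sq
    refine Continuous.aestronglyMeasurable ?_
    exact (by fun_prop : Continuous fun ξ : E3 => 1 + ‖ξ‖ ^ 2).inv₀ fun ξ => by positivity
  have h2 : ∫ ξ, ‖F ξ‖ ≤ ∫ ξ, (1 + ‖ξ‖ ^ 2)⁻¹ * ‖G ξ‖ := by
    refine integral_mono F.integrable.norm (ham.integrable_mul hgm) fun ξ => ?_
    have h0 : (0 : ℝ) < 1 + ‖ξ‖ ^ 2 := by positivity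
    have := hb ξ
    simp only
    rw [inv_mul_eq_div, le_div_iff₀ h0]
    linarith
  have h3 := integral_mul_le_Lp_mul_Lq_of_nonneg (μ := (volume : Measure E3))
    Real.HolderConjugate.two_two (f := fun ξ : E3 => (1 + ‖ξ‖ ^ 2)⁻¹) (g := fun ξ => ‖G ξ‖)
    (.of_forall fun ξ => by positivity) (.of_forall fun ξ => by positivity)
    (by simpa using ham) (by simpa using hgm)
  have h4 : (∫ ξ, ‖G ξ‖ ^ (2 : ℝ)) ^ (1 / 2 : ℝ) = ‖G.toLp 2‖ := by
    rw [SchwartzMap.norm_toLp' (by norm_num) (by norm_num)]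
    norm_num
  have h5 : (∫ ξ : E3, ((1 + ‖ξ‖ ^ 2)⁻¹) ^ (2 : ℝ)) ^ (1 / 2 : ℝ) =
      Real.sqrt (∫ ξ : E3, ((1 + ‖ξ‖ ^ 2)⁻¹) ^ 2) := by
    rw [Real.sqrt_eq_rpow]
    norm_num
  rw [h4, h5] at h3
  exact h2.trans h3

/-- The Fourier proof of `H²(ℝ³) ⊆ L^∞`, on Schwartz functions: `|f| ≤ ‖𝓕⁻ f‖_{L¹}`, and
`(1 + |ξ|²) |𝓕⁻ f|` is controlled in `L²` by Plancherel's identity. -/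
theorem exists_schwartz_sup_bound : ∃ C : ℝ, 0 < C ∧ ∀ (f : 𝓢(E3, ℂ)) (x : E3),
    ‖f x‖ ≤ C * ‖(oneSubLaplacian f).toLp 2‖ := by
  refine ⟨Real.sqrt (∫ ξ : E3, ((1 + ‖ξ‖ ^ 2)⁻¹) ^ 2) + 1, by positivity, fun f x => ?_⟩
  have h1 : ‖f x‖ ≤ ∫ ξ, ‖𝓕⁻ f ξ‖ := by
    have := SchwartzMap.norm_fourier_apply_le_toLp_one (𝓕⁻ f) x
    rwa [FourierTransform.fourier_fourierInv_eq, SchwartzMap.norm_toLp_one] at this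
  have hb : ∀ ξ, (1 + ‖ξ‖ ^ 2) * ‖𝓕⁻ f ξ‖ ≤ ‖𝓕⁻ (oneSubLaplacian f) ξ‖ := by
    intro ξ
    rw [fourierInv_oneSubLaplacian, norm_mul, Complex.norm_real,
      Real.norm_of_nonneg (by positivity)]
    gcongr
    have : (1 : ℝ) ≤ (2 * Real.pi) ^ 2 := by nlinarith [Real.pi_gt_three]
    nlinarith [sq_nonneg ‖ξ‖]
  have h2 := integral_norm_le_of_weight hb
  have e := SchwartzMap.norm_fourier_toL2_eq (𝓕⁻ (oneSubLaplacian f))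
  rw [FourierTransform.fourier_fourierInv_eq] at e
  rw [← e] at h2
  refine (h1.trans h2).trans ?_
  gcongr
  linarith

/-- `H²(ℝ³) ⊆ L^∞`, on test functions. -/
theorem exists_test_sup_bound : ∃ C : ℝ, 0 < C ∧ ∀ {φ : E3 → ℝ} (h : IsTest φ) (x : E3),
    |φ x| ≤ C * (‖h.toL2‖ +
      ∑ i, ‖((h.partialDeriv i).partialDeriv i).toL2‖) := by
  obtain ⟨C, hC, h⟩ := exists_schwartz_sup_bound
  refine ⟨C, hC, fun {φ} hφ x => ?_⟩
  have h1 := h hφ.toSchwartz x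
  simp_rw [oneSubLaplacian, IsTest.lineDeriv_toSchwartz] at h1
  rw [hφ.toSchwartz_apply, Complex.norm_real, Real.norm_eq_abs] at h1
  refine h1.trans (mul_le_mul_of_nonneg_left ?_ hC.le)
  rw [← SchwartzMap.toLpCLM_apply (𝕜 := ℝ), map_sub, map_sum]
  refine (norm_sub_le _ _).trans (add_le_add ?_ ((norm_sum_le _ _).trans ?_))
  · rw [SchwartzMap.toLpCLM_apply, hφ.norm_toSchwartz]
  · refine Finset.sum_le_sum fun i _ => ?_
    rw [SchwartzMap.toLpCLM_apply, IsTest.norm_toSchwartz]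

theorem IsTest.norm_toL2_sq {φ : E3 → ℝ} (h : IsTest φ) : ‖h.toL2‖ ^ 2 = ∫ x, φ x ^ 2 := by
  rw [← real_inner_self_eq_norm_sq, ← pair_eq_inner _ h, pair_congr h.coeFn_toL2, pair]
  simp_rw [sq]

theorem IsTest.eLpNorm_two {φ : E3 → ℝ} (h : IsTest φ) :
    eLpNorm φ 2 volume = ENNReal.ofReal ‖h.toL2‖ := by
  rw [Lp.norm_def, ENNReal.ofReal_toReal (Lp.eLpNorm_ne_top _), eLpNorm_congr_ae h.coeFn_toL2]

theorem norm_fderiv_le {φ : E3 → ℝ} (x : E3) :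
    ‖fderiv ℝ φ x‖ ≤ ∑ i, ‖partialDeriv i φ x‖ := by
  refine ContinuousLinearMap.opNorm_le_bound _ (by positivity) fun v => ?_
  have hv : v = ∑ i, v i • EuclideanSpace.single i (1 : ℝ) := by
    ext j
    simp [Fin.sum_univ_three]
    fin_cases j <;> simp
  conv_lhs => rw [hv]
  rw [map_sum, Finset.sum_mul]
  refine (norm_sum_le _ _).trans (Finset.sum_le_sum fun i _ => ?_)
  rw [map_smul, norm_smul, mul_comm]
  exact mul_le_mul_of_nonneg_left (PiLp.norm_apply_le v i) (norm_nonneg _)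

theorem eLpNorm_fderiv_le {φ : E3 → ℝ} (h : IsTest φ) :
    eLpNorm (fderiv ℝ φ) 2 volume ≤ ENNReal.ofReal (∑ i, ‖(h.partialDeriv i).toL2‖) := by
  calc eLpNorm (fderiv ℝ φ) 2 volume
      ≤ eLpNorm (fun x => ∑ i, ‖partialDeriv i φ x‖) 2 volume :=
        eLpNorm_mono fun x => (norm_fderiv_le x).trans (le_abs_self _)
    _ ≤ ∑ i, eLpNorm (fun x => ‖partialDeriv i φ x‖) 2 volume := by
        have := eLpNorm_sum_le (μ := (volume : Measure E3)) (p := 2) (s := Finset.univ)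
          (f := fun (i : Fin 3) x => ‖partialDeriv i φ x‖)
          (fun i _ => (h.partialDeriv i).smooth.continuous.norm.aestronglyMeasurable)
          (by norm_num)
        convert! this using 2
    _ = ENNReal.ofReal (∑ i, ‖(h.partialDeriv i).toL2‖) := by
        rw [ENNReal.ofReal_sum_of_nonneg fun _ _ => norm_nonneg _]
        refine Finset.sum_congr rfl fun i _ => ?_
        rw [eLpNorm_norm, (h.partialDeriv i).eLpNorm_two]

/-- The Gagliardo-Nirenberg-Sobolev inequality with exponents `2` and `6`. -/
theorem exists_gagliardo_nirenberg : ∃ K : NNReal, ∀ {φ : E3 → ℝ}, IsTest φ →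
    eLpNorm φ (6 : NNReal) volume ≤ K * eLpNorm (fderiv ℝ φ) 2 volume :=
  ⟨_, fun {φ} h => eLpNorm_le_eLpNorm_fderiv_of_eq (volume : Measure E3) (u := φ)
    (h.smooth.of_le (by simp)) h.compact (p := 2) (p' := 6) (by norm_num) (by simp)
    (by simp; norm_num)⟩

theorem IsTest.integrable_pow {φ : E3 → ℝ} (h : IsTest φ) {n : ℕ} (hn : n ≠ 0) :
    Integrable (fun x => φ x ^ n) volume :=
  (h.smooth.continuous.pow n).integrable_of_hasCompactSupport
    (h.compact.comp_left (g := fun r : ℝ => r ^ n) (zero_pow hn))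

/-- `H¹(ℝ³) ⊆ L⁶`, on test functions. -/
theorem exists_test_six_bound : ∃ C : ℝ, 0 < C ∧ ∀ {φ : E3 → ℝ} (h : IsTest φ),
    ∫ x, φ x ^ 6 ≤ C * (∑ i, ‖(h.partialDeriv i).toL2‖) ^ 6 := by
  obtain ⟨K, hK⟩ := exists_gagliardo_nirenberg
  refine ⟨(K : ℝ) ^ 6 + 1, by positivity, fun {φ} h => ?_⟩
  have h2 := eLpNorm_fderiv_le h
  have hS0 : 0 ≤ ∑ i, ‖(h.partialDeriv i).toL2‖ := by positivity
  generalize ∑ i, ‖(h.partialDeriv i).toL2‖ = S at h2 hS0 ⊢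
  have h3 : eLpNorm φ (6 : NNReal) volume ≤ ENNReal.ofReal (K * S) := by
    refine (hK h).trans ?_
    rw [ENNReal.ofReal_mul K.coe_nonneg, ENNReal.ofReal_coe_nnreal]
    gcongr
  have hint := h.integrable_pow (n := 6) (by norm_num)
  have e6 : ∀ a : ENNReal, a ^ ((6 : NNReal) : ℝ) = a ^ (6 : ℕ) := fun a => by
    rw [← ENNReal.rpow_natCast]
    norm_num
  have h5 := eLpNorm_nnreal_pow_eq_lintegral (μ := (volume : Measure E3)) (f := φ) (p := 6)
    (by norm_num)
  rw [e6] at h5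
  have h4 : ENNReal.ofReal (∫ x, φ x ^ 6) ≤ ENNReal.ofReal ((K * S) ^ 6) := by
    rw [ofReal_integral_eq_lintegral_ofReal hint (.of_forall fun x => by positivity),
      ENNReal.ofReal_pow (by positivity)]
    calc ∫⁻ x, ENNReal.ofReal (φ x ^ 6) = ∫⁻ x, ‖φ x‖ₑ ^ ((6 : NNReal) : ℝ) := by
          refine lintegral_congr fun x => ?_
          rw [e6, ← Even.pow_abs (by decide), ENNReal.ofReal_pow (abs_nonneg _),
            Real.enorm_eq_ofReal_abs]
      _ = eLpNorm φ (6 : NNReal) volume ^ 6 := h5.symm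
      _ ≤ ENNReal.ofReal (K * S) ^ 6 := by gcongr
  refine ((ENNReal.ofReal_le_ofReal_iff (by positivity)).1 h4).trans ?_
  rw [mul_pow]
  gcongr
  linarith

/-- The `H¹` norm of a test function, up to equivalence. -/
def IsTest.gradSum {φ : E3 → ℝ} (h : IsTest φ) : ℝ :=
  ‖h.toL2‖ + ∑ i, ‖(h.partialDeriv i).toL2‖

/-- `H¹ · H¹ ⊆ L²` in three dimensions, on test functions: both factors are in `L⁴`, by
interpolation between `L²` and `L⁶`. -/
theorem exists_test_mul_bound : ∃ C : ℝ, 0 < C ∧ ∀ {φ ψ : E3 → ℝ} (h : IsTest φ) (h' : IsTest ψ),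
    ‖(h.mul_smooth h'.smooth).toL2‖ ≤ C * (h.gradSum * h'.gradSum) := by
  obtain ⟨K, hK, hsix⟩ := exists_test_six_bound
  refine ⟨1 + K, by positivity, fun {φ ψ} h h' => ?_⟩
  have hint : ∀ {φ : E3 → ℝ}, IsTest φ → ∀ n : ℕ, n ≠ 0 → Integrable (fun x => φ x ^ n) volume :=
    fun h _ hn => h.integrable_pow hn
  -- interpolation in the form `φ⁴ ≤ s² φ² + s⁻² φ⁶`; the parameter `s ≥ ‖φ‖_{H¹}` is kept strictly
  -- positive, since the norm itself may vanish
  have hfour : ∀ {φ : E3 → ℝ} (h : IsTest φ) {s : ℝ}, 0 < s → h.gradSum ≤ s →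
      ∫ x, φ x ^ 4 ≤ (1 + K) * s ^ 4 := by
    intro φ h s hs hle
    have hg1 : ‖h.toL2‖ ≤ s := le_trans (le_add_of_nonneg_right (by positivity)) hle
    have hg2 : ∑ i, ‖(h.partialDeriv i).toL2‖ ≤ s :=
      le_trans (le_add_of_nonneg_left (by positivity)) hle
    have h6 : ∫ x, φ x ^ 6 ≤ K * s ^ 6 := (hsix h).trans (by gcongr)
    have h2 : ∫ x, φ x ^ 2 ≤ s ^ 2 := by rw [← h.norm_toL2_sq]; gcongr
    have hle : ∫ x, φ x ^ 4 ≤ ∫ x, (s ^ 2 * φ x ^ 2 + (s ^ 2)⁻¹ * φ x ^ 6) := by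
      refine integral_mono (hint h 4 (by norm_num))
        (((hint h 2 (by norm_num)).const_mul _).add ((hint h 6 (by norm_num)).const_mul _))
        fun x => ?_
      have e : s ^ 2 * φ x ^ 2 + (s ^ 2)⁻¹ * φ x ^ 6 - φ x ^ 4 =
          φ x ^ 2 * ((s - s⁻¹ * φ x ^ 2) ^ 2 + φ x ^ 2) := by
        field_simp
        ring
      have : 0 ≤ φ x ^ 2 * ((s - s⁻¹ * φ x ^ 2) ^ 2 + φ x ^ 2) := by positivity
      simp only
      linarith
    rw [integral_add ((hint h 2 (by norm_num)).const_mul _)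
      ((hint h 6 (by norm_num)).const_mul _), integral_const_mul, integral_const_mul] at hle
    calc ∫ x, φ x ^ 4 ≤ s ^ 2 * s ^ 2 + (s ^ 2)⁻¹ * (K * s ^ 6) := by
          refine hle.trans ?_
          gcongr
      _ = (1 + K) * s ^ 4 := by field_simp
  have hkey : ∀ s t : ℝ, 0 < s → 0 < t → h.gradSum ≤ s → h'.gradSum ≤ t →
      ‖(h.mul_smooth h'.smooth).toL2‖ ≤ (1 + K) * (s * t) := by
    intro s t hs ht hle hle'
    refine (sq_le_sq₀ (norm_nonneg _) (by positivity)).1 ?_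
    rw [IsTest.norm_toL2_sq]
    have hle2 : ∫ x, (φ * ψ) x ^ 2 ≤
        ∫ x, ((t / s) ^ 2 / 2 * φ x ^ 4 + (s / t) ^ 2 / 2 * ψ x ^ 4) := by
      refine integral_mono (hint (h.mul_smooth h'.smooth) 2 (by norm_num))
        (((hint h 4 (by norm_num)).const_mul _).add ((hint h' 4 (by norm_num)).const_mul _))
        fun x => ?_
      have e : (t / s) ^ 2 / 2 * φ x ^ 4 + (s / t) ^ 2 / 2 * ψ x ^ 4 - (φ x * ψ x) ^ 2 =
          ((t / s) * φ x ^ 2 - (s / t) * ψ x ^ 2) ^ 2 / 2 := by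
        field_simp
        ring
      have : 0 ≤ ((t / s) * φ x ^ 2 - (s / t) * ψ x ^ 2) ^ 2 / 2 := by positivity
      simp only [Pi.mul_apply]
      linarith
    rw [integral_add ((hint h 4 (by norm_num)).const_mul _)
      ((hint h' 4 (by norm_num)).const_mul _), integral_const_mul, integral_const_mul] at hle2
    have hA := hfour h hs hle
    have hB := hfour h' ht hle'
    calc ∫ x, (φ * ψ) x ^ 2
        ≤ (t / s) ^ 2 / 2 * ((1 + K) * s ^ 4) + (s / t) ^ 2 / 2 * ((1 + K) * t ^ 4) := by
          refine hle2.trans ?_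
          gcongr
      _ = (1 + K) * (s * t) ^ 2 := by field_simp; ring
      _ ≤ (1 + K) ^ 2 * (s * t) ^ 2 := by
          gcongr
          nlinarith
      _ = ((1 + K) * (s * t)) ^ 2 := by ring
  have hg0 : 0 ≤ h.gradSum := by unfold IsTest.gradSum; positivity
  have hg0' : 0 ≤ h'.gradSum := by unfold IsTest.gradSum; positivity
  -- let `s` and `t` decrease to the norms
  have hlim : Tendsto (fun ε : ℝ => (1 + K) * ((h.gradSum + ε) * (h'.gradSum + ε))) (𝓝[>] 0)
      (𝓝 ((1 + K) * ((h.gradSum + 0) * (h'.gradSum + 0)))) :=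
    ((by fun_prop : Continuous fun ε : ℝ =>
      (1 + K) * ((h.gradSum + ε) * (h'.gradSum + ε))).tendsto 0).mono_left nhdsWithin_le_nhds
  simp only [add_zero] at hlim
  refine ge_of_tendsto hlim ?_
  filter_upwards [self_mem_nhdsWithin] with ε hε
  have hε' : 0 < ε := hε
  exact hkey _ _ (by linarith) (by linarith) (by linarith) (by linarith)

/-! ### Products of Sobolev functions and their commutators with derivatives -/

theorem IsTest.toL2_congr {φ ψ : E3 → ℝ} (h : IsTest φ) (h' : IsTest ψ) (e : φ = ψ) :
    h.toL2 = h'.toL2 := by subst e; rfl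

theorem IsTest.toL2_add {φ ψ : E3 → ℝ} (h : IsTest φ) (h' : IsTest ψ) :
    (h.add h').toL2 = h.toL2 + h'.toL2 := rfl

theorem IsTest.norm_toL2_mul_le {φ ψ : E3 → ℝ} (h : IsTest φ) (h' : IsTest ψ) {S : ℝ}
    (hS : ∀ x, |φ x| ≤ S) : ‖(h.mul_smooth h'.smooth).toL2‖ ≤ S * ‖h'.toL2‖ := by
  refine Lp.norm_le_mul_norm_of_ae_le_mul ?_
  filter_upwards [(h.mul_smooth h'.smooth).coeFn_toL2, h'.coeFn_toL2] with x h1 h2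
  rw [h1, h2, Pi.mul_apply, norm_mul]
  exact mul_le_mul_of_nonneg_right (hS x) (norm_nonneg _)

theorem IsTest.toL2_mul_comm {φ ψ : E3 → ℝ} (h : IsTest φ) (h' : IsTest ψ) :
    (h.mul_smooth h'.smooth).toL2 = (h'.mul_smooth h.smooth).toL2 :=
  IsTest.toL2_congr _ _ (mul_comm _ _)

theorem IsTest.toL2_partialDeriv_multiDeriv {φ : E3 → ℝ} (h : IsTest φ) (α : Fin 3 → ℕ)
    (i : Fin 3) : ((h.multiDeriv α).partialDeriv i).toL2 = (h.multiDeriv (α + Pi.single i 1)).toL2 :=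
  IsTest.toL2_congr _ _ (multiDeriv_add_single h.smooth α i).symm

/-- `φ` and its derivatives up to order `k` have `L²` norm at most `M`. -/
def IsTest.BoundedBy {φ : E3 → ℝ} (h : IsTest φ) (k : ℕ) (M : ℝ) : Prop :=
  ∀ α : Fin 3 → ℕ, ∑ i, α i ≤ k → ‖(h.multiDeriv α).toL2‖ ≤ M

theorem IsTest.BoundedBy.gradSum_le {φ : E3 → ℝ} {h : IsTest φ} {k : ℕ} {M : ℝ}
    (hM : h.BoundedBy k M) {β : Fin 3 → ℕ} (hβ : ∑ i, β i + 1 ≤ k) :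
    (h.multiDeriv β).gradSum ≤ 4 * M := by
  unfold IsTest.gradSum
  have h1 : ∀ i, ‖((h.multiDeriv β).partialDeriv i).toL2‖ ≤ M := fun i => by
    rw [h.toL2_partialDeriv_multiDeriv]
    exact hM _ (by rwa [sum_add_single])
  have h2 := hM β (by omega)
  have h3 := Finset.sum_le_sum fun i (_ : i ∈ Finset.univ) => h1 i
  simp only [Finset.sum_const, Finset.card_univ, Fintype.card_fin, nsmul_eq_mul] at h3
  push_cast at h3
  linarith

/-- Up to order `k - 2`, the derivatives of a function bounded in `H^k` are bounded. -/
theorem exists_boundedBy_sup : ∃ C : ℝ, 0 < C ∧ ∀ {φ : E3 → ℝ} {h : IsTest φ} {k : ℕ} {M : ℝ},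
    h.BoundedBy k M → ∀ {β : Fin 3 → ℕ}, ∑ i, β i + 2 ≤ k → ∀ x, |multiDeriv β φ x| ≤ C * M := by
  obtain ⟨C, hC, hsup⟩ := exists_test_sup_bound
  refine ⟨4 * C, by positivity, fun {φ h k M} hM β hβ x => ?_⟩
  refine (hsup (h.multiDeriv β) x).trans ?_
  have h1 : ∀ i, ‖(((h.multiDeriv β).partialDeriv i).partialDeriv i).toL2‖ ≤ M := fun i => by
    have e : partialDeriv i (partialDeriv i (multiDeriv β φ)) =
        multiDeriv (β + Pi.single i 1 + Pi.single i 1) φ := by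
      rw [multiDeriv_add_single h.smooth, multiDeriv_add_single h.smooth]
    rw [IsTest.toL2_congr _ (h.multiDeriv _) e]
    exact hM _ (by rw [sum_add_single, sum_add_single]; omega)
  have h2 := hM β (by omega)
  have h3 := Finset.sum_le_sum fun i (_ : i ∈ Finset.univ) => h1 i
  simp only [Finset.sum_const, Finset.card_univ, Fintype.card_fin, nsmul_eq_mul] at h3
  push_cast at h3
  nlinarith

/-- A product `D^β b · D^γ v` with `|β| ≥ 1` and `|β| + |γ| ≤ N` costs `N` derivatives of `b` and
only `N - 1` of `v`: put `L^∞` on the factor with at most `N - 2` (resp. `N - 3`) derivatives if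
there is one, and use `H¹ · H¹ ⊆ L²` in the remaining case `|β| = N - 1`. -/
theorem exists_leibniz_term_bound : ∃ C : ℝ, 0 < C ∧ ∀ {N : ℕ}, 3 ≤ N →
    ∀ {b v : E3 → ℝ} {hb : IsTest b} {hv : IsTest v} {Mb Mv : ℝ},
    hb.BoundedBy N Mb → hv.BoundedBy (N - 1) Mv → ∀ {β γ : Fin 3 → ℕ}, 1 ≤ ∑ i, β i →
    ∑ i, β i + ∑ i, γ i ≤ N →
    ‖((hb.multiDeriv β).mul_smooth (hv.multiDeriv γ).smooth).toL2‖ ≤ C * (Mb * Mv) := by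
  obtain ⟨C, hC, hsup⟩ := exists_boundedBy_sup
  obtain ⟨K, hK, hmul⟩ := exists_test_mul_bound
  refine ⟨C + 16 * K, by positivity, fun {N} hN {b v hb hv Mb Mv} hMb hMv {β γ} h1 h2 => ?_⟩
  have hMb0 : 0 ≤ Mb := (norm_nonneg _).trans (hMb 0 (by simp))
  have hMv0 : 0 ≤ Mv := (norm_nonneg _).trans (hMv 0 (by simp))
  have hp : 0 ≤ Mb * Mv := mul_nonneg hMb0 hMv0
  have hle1 : C * (Mb * Mv) ≤ (C + 16 * K) * (Mb * Mv) := by gcongr; linarith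
  have hle2 : 16 * K * (Mb * Mv) ≤ (C + 16 * K) * (Mb * Mv) := by gcongr; linarith
  -- `L^∞` on the derivative of `b`
  by_cases c1 : ∑ i, β i + 2 ≤ N
  · refine le_trans ?_ hle1
    refine (IsTest.norm_toL2_mul_le (hb.multiDeriv β) (hv.multiDeriv γ) (hsup hMb c1)).trans ?_
    rw [mul_assoc]
    have := hMv γ (by omega)
    gcongr
  -- `γ = 0`: `L^∞` on `v`, which needs `2 ≤ N - 1`
  by_cases c2 : ∑ i, β i = N
  · refine le_trans ?_ hle1
    rw [IsTest.toL2_mul_comm (hb.multiDeriv β) (hv.multiDeriv γ)]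
    refine (IsTest.norm_toL2_mul_le (hv.multiDeriv γ) (hb.multiDeriv β)
      (hsup hMv (by omega : ∑ i, γ i + 2 ≤ N - 1))).trans ?_
    have := hMb β (by omega)
    calc C * Mv * ‖(hb.multiDeriv β).toL2‖ ≤ C * Mv * Mb := by gcongr
      _ = C * (Mb * Mv) := by ring
  -- `|β| = N - 1` and `|γ| ≤ 1`: both factors are in `H¹`
  · refine le_trans ?_ hle2
    refine (hmul (hb.multiDeriv β) (hv.multiDeriv γ)).trans ?_
    have g1 := hMb.gradSum_le (by omega : ∑ i, β i + 1 ≤ N)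
    have g2 := hMv.gradSum_le (by omega : ∑ i, γ i + 1 ≤ N - 1)
    have g0 : 0 ≤ (hv.multiDeriv γ).gradSum := by unfold IsTest.gradSum; positivity
    calc K * ((hb.multiDeriv β).gradSum * (hv.multiDeriv γ).gradSum)
        ≤ K * ((4 * Mb) * (4 * Mv)) := by gcongr
      _ = 16 * K * (Mb * Mv) := by ring

theorem isTest_list_sum {ι : Type*} (L : List ι) (F : ι → E3 → ℝ) (hF : ∀ p ∈ L, IsTest (F p)) :
    IsTest (L.map F).sum := by
  induction L with
  | nil => exact isTest_zero
  | cons a L ih =>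
    simp only [List.map_cons, List.sum_cons]
    exact (hF a (by simp)).add (ih fun p hp => hF p (by simp [hp]))

theorem norm_toL2_list_sum_le {ι : Type*} (L : List ι) (F : ι → E3 → ℝ) {c : ℝ}
    (hF : ∀ p ∈ L, ∃ h : IsTest (F p), ‖h.toL2‖ ≤ c) (hs : IsTest (L.map F).sum) :
    ‖hs.toL2‖ ≤ L.length * c := by
  induction L with
  | nil =>
    have : hs.toL2 = 0 := by
      refine Lp.ext (hs.coeFn_toL2.trans (EventuallyEq.trans (.of_forall fun x => ?_)
        (Lp.coeFn_zero ℝ 2 (volume : Measure E3)).symm))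
      simp
    rw [this, norm_zero]
    simp
  | cons a L ih =>
    have hL : ∀ p ∈ L, ∃ h : IsTest (F p), ‖h.toL2‖ ≤ c := fun p hp => hF p (by simp [hp])
    have hsL : IsTest (L.map F).sum := isTest_list_sum L F fun p hp => (hL p hp).1
    obtain ⟨ha, hac⟩ := hF a (by simp)
    have e : hs.toL2 = ha.toL2 + hsL.toL2 := by
      rw [← IsTest.toL2_add]
      exact IsTest.toL2_congr _ _ (by simp)
    rw [e]
    refine (norm_add_le _ _).trans ?_
    have := ih hL hsL
    push_cast [List.length_cons]
    linarith

/-- The part of the `H^N` norm that involves derivatives up to order `N - 1` only. -/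
def lowNorm {N : ℕ} (v : SobolevH N) : ℝ := ∑ α : MultiIndex (N - 1), ‖wderiv N α.val v‖

theorem continuous_lowNorm (N : ℕ) : Continuous (lowNorm : SobolevH N → ℝ) :=
  continuous_finsetSum _ fun α _ => (wderiv N α.val).continuous.norm

theorem lowNorm_nonneg {N : ℕ} (v : SobolevH N) : 0 ≤ lowNorm v :=
  Finset.sum_nonneg fun _ _ => norm_nonneg _

theorem lowNorm_le_norm {N : ℕ} (v : SobolevH N) :
    lowNorm v ≤ Fintype.card (MultiIndex (N - 1)) * ‖v‖ := by
  calc lowNorm v ≤ ∑ _α : MultiIndex (N - 1), ‖v‖ :=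
        Finset.sum_le_sum fun α _ => norm_wderiv_le _ v
    _ = _ := by simp

/-- The low order norm of a gradient is controlled by the full norm of the function. -/
theorem IsGradient.lowNorm_le {N : ℕ} (hN : 1 ≤ N) {u : SobolevH N} {V : VecH N}
    (h : IsGradient u V) (j : Fin 3) :
    lowNorm (V j) ≤ Fintype.card (MultiIndex (N - 1)) * ‖u‖ := by
  calc lowNorm (V j) ≤ ∑ _α : MultiIndex (N - 1), ‖u‖ := by
        refine Finset.sum_le_sum fun α _ => ?_
        have := α.sum_val_le
        rw [h.wderiv_eq j (by omega) (by omega)]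
        exact norm_wderiv_le _ u
    _ = _ := by simp

theorem IsTest.boundedBy_norm {φ : E3 → ℝ} (h : IsTest φ) (k : ℕ) :
    h.BoundedBy k ‖h.toH k‖ := fun α hα => by
  rw [← h.wderiv_toH hα]
  exact norm_wderiv_le α _

theorem IsTest.boundedBy_lowNorm {φ : E3 → ℝ} (h : IsTest φ) (N : ℕ) :
    h.BoundedBy (N - 1) (lowNorm (h.toH N)) := fun α hα => by
  rw [← h.wderiv_toH (k := N) (by omega)]
  have h1 := Finset.single_le_sum (s := Finset.univ)
    (f := fun β : MultiIndex (N - 1) => ‖wderiv N β.val (h.toH N)‖)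
    (fun _ _ => norm_nonneg _) (Finset.mem_univ (MultiIndex.of α hα))
  rwa [MultiIndex.val_of] at h1

theorem exists_multiDeriv_mul_bound {N : ℕ} (hN : 3 ≤ N) (α : Fin 3 → ℕ) (hα : ∑ i, α i ≤ N) :
    ∃ C : ℝ, 0 ≤ C ∧ ∀ {b v : E3 → ℝ} (hb : IsTest b) (hv : IsTest v),
      ‖((hb.mul_smooth hv.smooth).multiDeriv α).toL2 -
        (hb.mul_smooth (hv.multiDeriv α).smooth).toL2‖ ≤
          C * (‖hb.toH N‖ * lowNorm (hv.toH N)) := by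
  obtain ⟨C, hC, hterm⟩ := exists_leibniz_term_bound
  obtain ⟨L, hL, hleib⟩ := exists_leibniz α
  refine ⟨L.length * C, by positivity, fun {b v} hb hv => ?_⟩
  have hMb := hb.boundedBy_norm N
  have hMv := hv.boundedBy_lowNorm N
  generalize ‖hb.toH N‖ = Mb at hMb ⊢
  generalize lowNorm (hv.toH N) = Mv at hMv ⊢
  have ht : ∀ p ∈ L, ∃ h : IsTest (multiDeriv p.1 b * multiDeriv p.2 v),
      ‖h.toL2‖ ≤ C * (Mb * Mv) := by
    intro p hp
    have h2 := (hL p hp).2.trans hα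
    exact ⟨(hb.multiDeriv p.1).mul_smooth (hv.multiDeriv p.2).smooth,
      hterm hN hMb hMv (hL p hp).1 h2⟩
  have hs := isTest_list_sum L _ fun p hp => (ht p hp).1
  have e : ((hb.mul_smooth hv.smooth).multiDeriv α).toL2 =
      (hb.mul_smooth (hv.multiDeriv α).smooth).toL2 + hs.toL2 := by
    rw [← IsTest.toL2_add]
    exact IsTest.toL2_congr _ _ (hleib b v hb.smooth hv.smooth)
  rw [e, add_sub_cancel_left, mul_assoc]
  exact norm_toL2_list_sum_le L _ ht hs

/-- The commutator estimate `‖D^α(bv) - b D^α v‖ ≤ C ‖b‖_{H^N} ‖v‖_{H^{N-1}}` on test functions. -/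
theorem exists_commutator_bound {N : ℕ} (hN : 3 ≤ N) :
    ∃ C : ℝ, 0 < C ∧ ∀ (α : Fin 3 → ℕ), ∑ i, α i ≤ N →
      ∀ {b v : E3 → ℝ} (hb : IsTest b) (hv : IsTest v),
      ‖((hb.mul_smooth hv.smooth).multiDeriv α).toL2 -
        (hb.mul_smooth (hv.multiDeriv α).smooth).toL2‖ ≤
          C * (‖hb.toH N‖ * lowNorm (hv.toH N)) := by
  choose! c hc0 hc using fun α hα => exists_multiDeriv_mul_bound hN α hα
  refine ⟨∑ α : MultiIndex N, c α.val + 1, ?_, fun α hα b v hb hv => ?_⟩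
  · have : 0 ≤ ∑ α : MultiIndex N, c α.val :=
      Finset.sum_nonneg fun α _ => hc0 _ α.sum_val_le
    linarith
  · refine (hc α hα hb hv).trans ?_
    have h1 := Finset.single_le_sum (s := Finset.univ) (f := fun β : MultiIndex N => c β.val)
      (fun β _ => hc0 _ β.sum_val_le) (Finset.mem_univ (MultiIndex.of α hα))
    rw [MultiIndex.val_of] at h1
    have h2 := lowNorm_nonneg (hv.toH N)
    gcongr
    linarith

/-- `H²(ℝ³) ⊆ L^∞`. -/
theorem exists_fn_bound : ∃ C : ℝ, 0 < C ∧ ∀ {N : ℕ}, 2 ≤ N → ∀ B : SobolevH N,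
    ∀ᵐ x, |fn B x| ≤ C * ‖B‖ := by
  obtain ⟨C, hC, hsup⟩ := exists_boundedBy_sup
  refine ⟨C, hC, fun {N} hN B => ?_⟩
  choose ψ hψ hψB using fun k : ℕ => exists_toH_approx B (Nat.one_div_pos_of_nat (α := ℝ) (n := k))
  have hlim : Tendsto (fun k => (hψ k).toH N) atTop (𝓝 B) := by
    rw [tendsto_iff_norm_sub_tendsto_zero]
    exact squeeze_zero (fun _ => norm_nonneg _) hψB tendsto_one_div_add_atTop_nhds_zero_nat
  have h0 : Tendsto (fun k => wderiv N 0 ((hψ k).toH N)) atTop (𝓝 (wderiv N 0 B)) :=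
    ((wderiv N 0).continuous.tendsto B).comp hlim
  -- convergence almost everywhere along a subsequence
  obtain ⟨ns, hns, hae⟩ := (tendstoInMeasure_of_tendsto_Lp h0).exists_seq_tendsto_ae
  have hall : ∀ᵐ x, ∀ k, wderiv N 0 ((hψ k).toH N) x = ψ k x := by
    refine ae_all_iff.2 fun k => ?_
    rw [← fn_eq]
    exact (hψ k).fn_toH N
  filter_upwards [hae, hall] with x hx1 hx2
  have hb : Tendsto (fun k => C * ‖(hψ (ns k)).toH N‖) atTop (𝓝 (C * ‖B‖)) :=
    (hlim.norm.comp hns.tendsto_atTop).const_mul C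
  rw [fn_eq]
  refine le_of_tendsto_of_tendsto hx1.abs hb (.of_forall fun k => ?_)
  simp only [hx2]
  exact hsup ((hψ (ns k)).boundedBy_norm N) (β := 0) (by simpa using hN) x

/-- The constant of the embedding `H²(ℝ³) ⊆ L^∞`. -/
def supConst : ℝ := exists_fn_bound.choose

theorem supConst_pos : 0 < supConst := exists_fn_bound.choose_spec.1

theorem ae_abs_fn_le {N : ℕ} (hN : 2 ≤ N) (B : SobolevH N) : ∀ᵐ x, |fn B x| ≤ supConst * ‖B‖ :=
  exists_fn_bound.choose_spec.2 hN B

theorem memLp_fn_mul {N : ℕ} (hN : 2 ≤ N) (B : SobolevH N) (w : L2) :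
    MemLp (fun x => fn B x * w x) 2 volume := by
  refine (Lp.memLp w).of_le_mul (c := supConst * ‖B‖) ?_ ?_
  · rw [fn_eq]
    exact (Lp.memLp _).1.mul (Lp.memLp w).1
  · filter_upwards [ae_abs_fn_le hN B] with x hx
    rw [norm_mul]
    exact mul_le_mul_of_nonneg_right hx (norm_nonneg _)

/-- Multiplication `H^N × L² → L²`, `N ≥ 2`. -/
def mulL {N : ℕ} (hN : 2 ≤ N) : SobolevH N →L[ℝ] L2 →L[ℝ] L2 :=
  LinearMap.mkContinuous₂
    (LinearMap.mk₂ ℝ (fun B w => (memLp_fn_mul hN B w).toLp)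
      (fun B B' w => by
        rw [← MemLp.toLp_add]
        refine MemLp.toLp_congr _ _ ?_
        rw [fn_eq, fn_eq, fn_eq, map_add]
        filter_upwards [Lp.coeFn_add (wderiv N 0 B) (wderiv N 0 B')] with x hx
        rw [hx, Pi.add_apply, Pi.add_apply, add_mul])
      (fun c B w => by
        rw [← MemLp.toLp_const_smul]
        refine MemLp.toLp_congr _ _ ?_
        rw [fn_eq, fn_eq, map_smul]
        filter_upwards [Lp.coeFn_smul c (wderiv N 0 B)] with x hx
        rw [hx, Pi.smul_apply, Pi.smul_apply, smul_eq_mul, smul_eq_mul, mul_assoc])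
      (fun B w w' => by
        rw [← MemLp.toLp_add]
        refine MemLp.toLp_congr _ _ ?_
        filter_upwards [Lp.coeFn_add w w'] with x hx
        rw [hx, Pi.add_apply, Pi.add_apply, mul_add])
      (fun c B w => by
        rw [← MemLp.toLp_const_smul]
        refine MemLp.toLp_congr _ _ ?_
        filter_upwards [Lp.coeFn_smul c w] with x hx
        rw [hx, Pi.smul_apply, Pi.smul_apply, smul_eq_mul, smul_eq_mul]
        ring))
    supConst (fun B w => by
      refine Lp.norm_le_mul_norm_of_ae_le_mul ?_
      filter_upwards [(memLp_fn_mul hN B w).coeFn_toLp, ae_abs_fn_le hN B] with x h1 h2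
      rw [LinearMap.mk₂_apply, h1, norm_mul]
      exact mul_le_mul_of_nonneg_right h2 (norm_nonneg _))

theorem coeFn_mulL {N : ℕ} (hN : 2 ≤ N) (B : SobolevH N) (w : L2) :
    mulL hN B w =ᵐ[volume] fun x => fn B x * w x :=
  (memLp_fn_mul hN B w).coeFn_toLp

theorem norm_mulL_le {N : ℕ} (hN : 2 ≤ N) (B : SobolevH N) (w : L2) :
    ‖mulL hN B w‖ ≤ supConst * ‖B‖ * ‖w‖ := by
  refine Lp.norm_le_mul_norm_of_ae_le_mul ?_
  filter_upwards [coeFn_mulL hN B w, ae_abs_fn_le hN B] with x h1 h2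
  rw [h1, norm_mul]
  exact mul_le_mul_of_nonneg_right h2 (norm_nonneg _)

theorem mulL_toH {N : ℕ} (hN : 2 ≤ N) {b w : E3 → ℝ} (hb : IsTest b) (hw : IsTest w) :
    mulL hN (hb.toH N) hw.toL2 = (hb.mul_smooth hw.smooth).toL2 := by
  refine Lp.ext ((coeFn_mulL hN _ _).trans (EventuallyEq.trans ?_
    (IsTest.coeFn_toL2 _).symm))
  filter_upwards [hb.fn_toH N, hw.coeFn_toL2] with x h1 h2
  rw [h1, h2, Pi.mul_apply]

/-- `p` is the product of `B` and `v`, and the commutators of its derivatives with the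
multiplication by `B` involve only derivatives of `v` up to order `N - 1`, with constant `C`. -/
structure IsSobolevProduct {N : ℕ} (hN : 2 ≤ N) (C : ℝ) (B v p : SobolevH N) : Prop where
  fn_eq : wderiv N 0 p = mulL hN B (wderiv N 0 v)
  commutator : ∀ α : Fin 3 → ℕ, ∑ i, α i ≤ N →
    ‖wderiv N α p - mulL hN B (wderiv N α v)‖ ≤ C * (‖B‖ * lowNorm v)

theorem IsSobolevProduct.norm_le {N : ℕ} {hN : 2 ≤ N} {C : ℝ} (hC : 0 ≤ C) {B v p : SobolevH N}
    (h : IsSobolevProduct hN C B v p) :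
    ‖p‖ ≤ Fintype.card (MultiIndex N) *
      (supConst + C * Fintype.card (MultiIndex (N - 1))) * (‖B‖ * ‖v‖) := by
  rw [mul_assoc]
  refine norm_sobolev_le p (by have := supConst_pos; positivity) fun α hα => ?_
  have h1 := h.commutator α hα
  have h2 := norm_mulL_le hN B (wderiv N α v)
  have h3 := norm_wderiv_le α v
  have h4 := lowNorm_le_norm v
  have h5 : ‖wderiv N α p‖ ≤ ‖wderiv N α p - mulL hN B (wderiv N α v)‖ +
      ‖mulL hN B (wderiv N α v)‖ := by
    simpa using norm_add_le (wderiv N α p - mulL hN B (wderiv N α v)) (mulL hN B (wderiv N α v))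
  have hs := supConst_pos
  calc ‖wderiv N α p‖ ≤ C * (‖B‖ * lowNorm v) + supConst * ‖B‖ * ‖wderiv N α v‖ := by linarith
    _ ≤ C * (‖B‖ * (Fintype.card (MultiIndex (N - 1)) * ‖v‖)) + supConst * ‖B‖ * ‖v‖ := by gcongr
    _ = _ := by ring

/-- The product of two test functions satisfies the commutator estimate. -/
theorem exists_product_toH {N : ℕ} (hN : 3 ≤ N) : ∃ C : ℝ, 0 < C ∧
    ∀ {b v : E3 → ℝ} (hb : IsTest b) (hv : IsTest v), IsSobolevProduct (by omega : 2 ≤ N) C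
      (hb.toH N) (hv.toH N) ((hb.mul_smooth hv.smooth).toH N) := by
  obtain ⟨C, hC, h⟩ := exists_commutator_bound hN
  refine ⟨C, hC, fun {b v} hb hv => ⟨?_, fun α hα => ?_⟩⟩
  · rw [IsTest.wderiv_toH _ (by simp), IsTest.wderiv_toH _ (by simp), mulL_toH]
    rfl
  · rw [IsTest.wderiv_toH _ hα, IsTest.wderiv_toH _ hα, mulL_toH]
    exact h α hα hb hv

/-! ### The algebra `H^N` -/

/-- `u` is (the class of) a test function. -/
def IsTestClass {k : ℕ} (u : SobolevH k) : Prop := ∃ ψ, ∃ h : IsTest ψ, u = h.toH k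

theorem IsTestClass.sub {k : ℕ} {u v : SobolevH k} (hu : IsTestClass u) (hv : IsTestClass v) :
    IsTestClass (u - v) := by
  obtain ⟨ψ, h, rfl⟩ := hu
  obtain ⟨ψ', h', rfl⟩ := hv
  refine ⟨_, h.add (h'.smul (-1)), sobolev_ext ?_⟩
  rw [map_sub, IsTest.wderiv_toH _ (by simp), IsTest.wderiv_toH _ (by simp),
    IsTest.wderiv_toH _ (by simp), sub_eq_add_neg, ← neg_one_smul ℝ]
  rfl

theorem exists_testClass_seq {k : ℕ} (u : SobolevH k) :
    ∃ b : ℕ → SobolevH k, (∀ n, IsTestClass (b n)) ∧ Tendsto b atTop (𝓝 u) := by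
  obtain ⟨b, hb, hlim⟩ := mem_closure_iff_seq_limit.1 ((dense_toH k) u)
  exact ⟨b, hb, hlim⟩

/-- Products of convergent sequences form a Cauchy sequence under a bilinear bound. The bound is
assumed for the given sequences only, since the product is not yet defined on the whole space. -/
theorem cauchySeq_of_bilinear_bound {X Y Z : Type*} [NormedAddCommGroup X] [NormedAddCommGroup Y]
    [NormedAddCommGroup Z] {b : ℕ → X} {w : ℕ → Y} {p : ℕ → Z} {B : X} {v : Y} {K : ℝ}
    (hb : Tendsto b atTop (𝓝 B)) (hw : Tendsto w atTop (𝓝 v))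
    (h : ∀ n m, ‖p n - p m‖ ≤ K * (‖b n - b m‖ * ‖w n‖) + K * (‖b m‖ * ‖w n - w m‖)) :
    CauchySeq p := by
  rw [cauchySeq_iff_tendsto_dist_atTop_0]
  have hb2 := cauchySeq_iff_tendsto_dist_atTop_0.1 hb.cauchySeq
  have hw2 := cauchySeq_iff_tendsto_dist_atTop_0.1 hw.cauchySeq
  have hwn : Tendsto (fun n : ℕ × ℕ => ‖w n.1‖) atTop (𝓝 ‖v‖) := by
    rw [← prod_atTop_atTop_eq]
    exact hw.norm.comp tendsto_fst
  have hbn : Tendsto (fun n : ℕ × ℕ => ‖b n.2‖) atTop (𝓝 ‖B‖) := by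
    rw [← prod_atTop_atTop_eq]
    exact hb.norm.comp tendsto_snd
  refine squeeze_zero (fun _ => dist_nonneg) (fun n => ?_)
    (g := fun n : ℕ × ℕ => K * (dist (b n.1) (b n.2) * ‖w n.1‖) +
      K * (‖b n.2‖ * dist (w n.1) (w n.2))) ?_
  · simp only [dist_eq_norm]
    exact h n.1 n.2
  · simpa using ((hb2.mul hwn).const_mul K).add ((hbn.mul hw2).const_mul K)

theorem tendsto_bilinear {X Y Z : Type*} [NormedAddCommGroup X] [NormedSpace ℝ X]
    [NormedAddCommGroup Y] [NormedSpace ℝ Y] [NormedAddCommGroup Z] [NormedSpace ℝ Z]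
    (f : X →L[ℝ] Y →L[ℝ] Z) {b : ℕ → X} {w : ℕ → Y} {B : X} {v : Y}
    (hb : Tendsto b atTop (𝓝 B)) (hw : Tendsto w atTop (𝓝 v)) :
    Tendsto (fun n => f (b n) (w n)) atTop (𝓝 (f B v)) :=
  (f.continuous₂.tendsto (B, v)).comp (hb.prodMk_nhds hw)

/-- Limits of products are products, with the same commutator estimate. -/
theorem IsSobolevProduct.of_tendsto {N : ℕ} {hN : 2 ≤ N} {C : ℝ} {b w p : ℕ → SobolevH N}
    {B v q : SobolevH N} (hp : ∀ n, IsSobolevProduct hN C (b n) (w n) (p n))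
    (hb : Tendsto b atTop (𝓝 B)) (hw : Tendsto w atTop (𝓝 v)) (hq : Tendsto p atTop (𝓝 q)) :
    IsSobolevProduct hN C B v q := by
  have hmul : ∀ α : Fin 3 → ℕ, Tendsto (fun n => mulL hN (b n) (wderiv N α (w n))) atTop
      (𝓝 (mulL hN B (wderiv N α v))) := fun α =>
    tendsto_bilinear (mulL hN) hb (((wderiv N α).continuous.tendsto v).comp hw)
  refine ⟨?_, fun α hα => ?_⟩
  · refine tendsto_nhds_unique (((wderiv N 0).continuous.tendsto q).comp hq) ?_
    refine (hmul 0).congr fun n => ?_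
    exact ((hp n).fn_eq).symm
  · refine le_of_tendsto_of_tendsto
      ((((wderiv N α).continuous.tendsto q).comp hq).sub (hmul α)).norm
      ((hb.norm.mul (((continuous_lowNorm N).tendsto v).comp hw)).const_mul C)
      (.of_forall fun n => ?_)
    exact (hp n).commutator α hα

/-- `H^N(ℝ³)`, `N ≥ 3`, is an algebra; the commutator estimate passes from test functions to the
limit. -/
theorem exists_isSobolevProduct {N : ℕ} (hN : 3 ≤ N) : ∃ C : ℝ, 0 < C ∧
    ∀ B v : SobolevH N, ∃ p, IsSobolevProduct (by omega : 2 ≤ N) C B v p := by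
  obtain ⟨C, hC, hprod⟩ := exists_product_toH hN
  have hN2 : 2 ≤ N := by omega
  refine ⟨C, hC, fun B v => ?_⟩
  have htest : ∀ {b w : SobolevH N}, IsTestClass b → IsTestClass w →
      ∃ p, IsSobolevProduct hN2 C b w p := by
    rintro _ _ ⟨ψ, h, rfl⟩ ⟨ψ', h', rfl⟩
    exact ⟨_, hprod h h'⟩
  obtain ⟨b, hb, hbB⟩ := exists_testClass_seq B
  obtain ⟨w, hw, hwv⟩ := exists_testClass_seq v
  choose p hp using fun n => htest (hb n) (hw n)
  -- `p n - p m = (b n - b m) w n + b m (w n - w m)`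
  have hdist : ∀ n m, ‖p n - p m‖ ≤ (Fintype.card (MultiIndex N) *
      (supConst + C * Fintype.card (MultiIndex (N - 1)))) * (‖b n - b m‖ * ‖w n‖) +
      (Fintype.card (MultiIndex N) *
      (supConst + C * Fintype.card (MultiIndex (N - 1)))) * (‖b m‖ * ‖w n - w m‖) := by
    intro n m
    obtain ⟨q, hq⟩ := htest ((hb n).sub (hb m)) (hw n)
    obtain ⟨q', hq'⟩ := htest (hb m) ((hw n).sub (hw m))
    have e : p n - p m = q + q' := by
      refine sobolev_ext ?_
      rw [map_sub, map_add, (hp n).fn_eq, (hp m).fn_eq, hq.fn_eq, hq'.fn_eq, map_sub, map_sub,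
        map_sub, sub_apply]
      abel
    rw [e]
    exact (norm_add_le _ _).trans (add_le_add (hq.norm_le hC.le) (hq'.norm_le hC.le))
  obtain ⟨q, hq⟩ := cauchySeq_tendsto_of_complete (cauchySeq_of_bilinear_bound hbB hwv hdist)
  exact ⟨q, IsSobolevProduct.of_tendsto hp hbB hwv hq⟩

/-- The constant of the commutator estimate in `H^N`. -/
def commConst {N : ℕ} (hN : 3 ≤ N) : ℝ := (exists_isSobolevProduct hN).choose

theorem commConst_pos {N : ℕ} (hN : 3 ≤ N) : 0 < commConst hN :=
  (exists_isSobolevProduct hN).choose_spec.1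

/-- The product in `H^N`, `N ≥ 3`, as a function. -/
def sobolevMul {N : ℕ} (hN : 3 ≤ N) (B v : SobolevH N) : SobolevH N :=
  ((exists_isSobolevProduct hN).choose_spec.2 B v).choose

theorem isSobolevProduct_sobolevMul {N : ℕ} (hN : 3 ≤ N) (B v : SobolevH N) :
    IsSobolevProduct (by omega : 2 ≤ N) (commConst hN) B v (sobolevMul hN B v) :=
  ((exists_isSobolevProduct hN).choose_spec.2 B v).choose_spec

/-- The product in `H^N`, `N ≥ 3`, as a bounded bilinear map. -/
def mulH {N : ℕ} (hN : 3 ≤ N) : SobolevH N →L[ℝ] SobolevH N →L[ℝ] SobolevH N :=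
  LinearMap.mkContinuous₂
    (LinearMap.mk₂ ℝ (sobolevMul hN)
      (fun B B' v => sobolev_ext (by
        rw [map_add, (isSobolevProduct_sobolevMul hN _ _).fn_eq,
          (isSobolevProduct_sobolevMul hN _ _).fn_eq, (isSobolevProduct_sobolevMul hN _ _).fn_eq,
          map_add, add_apply]))
      (fun c B v => sobolev_ext (by
        rw [map_smul, (isSobolevProduct_sobolevMul hN _ _).fn_eq,
          (isSobolevProduct_sobolevMul hN _ _).fn_eq, map_smul, smul_apply]))
      (fun B v v' => sobolev_ext (by
        rw [map_add, (isSobolevProduct_sobolevMul hN _ _).fn_eq,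
          (isSobolevProduct_sobolevMul hN _ _).fn_eq, (isSobolevProduct_sobolevMul hN _ _).fn_eq,
          map_add, map_add]))
      (fun c B v => sobolev_ext (by
        rw [map_smul, (isSobolevProduct_sobolevMul hN _ _).fn_eq,
          (isSobolevProduct_sobolevMul hN _ _).fn_eq, map_smul, map_smul])))
    (Fintype.card (MultiIndex N) *
      (supConst + commConst hN * Fintype.card (MultiIndex (N - 1))))
    (fun B v => by
      rw [mul_assoc _ ‖B‖]
      exact (isSobolevProduct_sobolevMul hN B v).norm_le (commConst_pos hN).le)

theorem isSobolevProduct_mulH {N : ℕ} (hN : 3 ≤ N) (B v : SobolevH N) :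
    IsSobolevProduct (by omega : 2 ≤ N) (commConst hN) B v (mulH hN B v) :=
  isSobolevProduct_sobolevMul hN B v

theorem fn_mulH {N : ℕ} (hN : 3 ≤ N) (B v : SobolevH N) :
    fn (mulH hN B v) =ᵐ[volume] fun x => fn B x * fn v x := by
  rw [fn_eq, fn_eq v, (isSobolevProduct_mulH hN B v).fn_eq]
  exact coeFn_mulL _ _ _

/-- Multiplication by the coefficient `A = c + B` is coercive up to a lower order term: all
derivatives may fall on `v`, and the commutators only see `‖v‖_{H^{N-1}}`. -/
theorem inner_coefficient_mul_ge {N : ℕ} (hN : 3 ≤ N) {c M₀ : ℝ} {B : SobolevH N}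
    (hA : ∀ᵐ x, M₀ ≤ c + fn B x) (v : SobolevH N) :
    M₀ * ‖v‖ ^ 2 - Fintype.card (MultiIndex N) * commConst hN * (‖B‖ * lowNorm v * ‖v‖) ≤
      inner ℝ (c • v + mulH hN B v) v := by
  have hN2 : 2 ≤ N := by omega
  have hp := isSobolevProduct_mulH hN B v
  have key : ∀ α : MultiIndex N, M₀ * ‖wderiv N α.val v‖ ^ 2 -
      commConst hN * (‖B‖ * lowNorm v * ‖v‖) ≤
      inner ℝ (wderiv N α.val (c • v + mulH hN B v)) (wderiv N α.val v) := by
    intro α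
    set w := wderiv N α.val v with hw
    -- the principal part, with all derivatives on `v`, is bounded below pointwise
    have h1 : M₀ * ‖w‖ ^ 2 ≤ inner ℝ (c • w + mulL hN2 B w) w := by
      rw [← real_inner_self_eq_norm_sq, ← real_inner_smul_left, L2.inner_def, L2.inner_def]
      refine integral_mono_ae (L2.integrable_inner _ _) (L2.integrable_inner _ _) ?_
      filter_upwards [hA, Lp.coeFn_add (c • w) (mulL hN2 B w), Lp.coeFn_smul c w,
        Lp.coeFn_smul M₀ w, coeFn_mulL hN2 B w] with x h0 h1 h2 h3 h4
      rw [h1, h3, Pi.add_apply, h2, h4]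
      simp only [Pi.smul_apply, smul_eq_mul, RCLike.inner_apply, conj_trivial]
      nlinarith [mul_nonneg (sub_nonneg.2 h0) (sq_nonneg (w x))]
    have h2 : wderiv N α.val (c • v + mulH hN B v) =
        (c • w + mulL hN2 B w) + (wderiv N α.val (mulH hN B v) - mulL hN2 B w) := by
      rw [map_add, map_smul]
      abel
    rw [h2, inner_add_left]
    have h3 := abs_real_inner_le_norm (wderiv N α.val (mulH hN B v) - mulL hN2 B w) w
    have h4 := hp.commutator α.val α.sum_val_le
    have h5 : ‖w‖ ≤ ‖v‖ := norm_wderiv_le _ v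
    have h6 := neg_le_of_abs_le h3
    have hC := commConst_pos hN
    have hl := lowNorm_nonneg v
    have h7 : ‖wderiv N α.val (mulH hN B v) - mulL hN2 B w‖ * ‖w‖ ≤
        commConst hN * (‖B‖ * lowNorm v) * ‖v‖ := by gcongr
    nlinarith
  rw [inner_sobolev, norm_sq_sobolev, Finset.mul_sum]
  have h := Finset.sum_le_sum fun α (_ : α ∈ Finset.univ) => key α
  rw [Finset.sum_sub_distrib] at h
  simp only [Finset.sum_const, Finset.card_univ, nsmul_eq_mul] at h
  linarith

/-! ### The scale `H^{k+1} ⊆ H^k` -/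

theorem exists_eq_add_single {α : Fin 3 → ℕ} (h : α ≠ 0) :
    ∃ (β : Fin 3 → ℕ) (j : Fin 3), α = β + Pi.single j 1 := by
  induction α using multiIndex_induction with
  | zero => exact (h rfl).elim
  | add_single α i _ => exact ⟨α, i, rfl⟩

theorem sobolevMk_bound {k : ℕ} {g : (Fin 3 → ℕ) → L2} {c : ℝ}
    (h : ∀ α, ∑ i, α i ≤ k → IsWeakDeriv α (g 0) (g α)) (hc : 0 ≤ c)
    (hg : ∀ α, ∑ i, α i ≤ k → ‖g α‖ ≤ c) :
    ‖sobolevMk k g h‖ ≤ Fintype.card (MultiIndex k) * c := by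
  refine norm_sobolev_le _ hc fun α hα => ?_
  rw [wderiv_sobolevMk _ hα]
  exact hg _ hα

/-- A linear map into `H^k` given by its family of weak derivatives. -/
def sobolevMap {X : Type*} [NormedAddCommGroup X] [NormedSpace ℝ X] (k : ℕ)
    (g : (Fin 3 → ℕ) → X →L[ℝ] L2)
    (h : ∀ x α, ∑ i, α i ≤ k → IsWeakDeriv α (g 0 x) (g α x))
    (hg : ∀ x α, ‖g α x‖ ≤ ‖x‖) : X →L[ℝ] SobolevH k :=
  LinearMap.mkContinuous
    { toFun := fun x => sobolevMk k (fun α => g α x) (h x)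
      map_add' := fun x y => sobolev_ext (by
        rw [map_add, wderiv_sobolevMk _ (by simp), wderiv_sobolevMk _ (by simp),
          wderiv_sobolevMk _ (by simp), map_add])
      map_smul' := fun c x => sobolev_ext (by
        rw [map_smul, wderiv_sobolevMk _ (by simp), wderiv_sobolevMk _ (by simp), map_smul,
          RingHom.id_apply]) }
    (Fintype.card (MultiIndex k))
    (fun x => sobolevMk_bound (h x) (norm_nonneg x) fun α _ => hg x α)

theorem wderiv_sobolevMap {X : Type*} [NormedAddCommGroup X] [NormedSpace ℝ X] {k : ℕ}
    {g : (Fin 3 → ℕ) → X →L[ℝ] L2}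
    (h : ∀ x α, ∑ i, α i ≤ k → IsWeakDeriv α (g 0 x) (g α x))
    (hg : ∀ x α, ‖g α x‖ ≤ ‖x‖) {α : Fin 3 → ℕ} (hα : ∑ i, α i ≤ k) (x : X) :
    wderiv k α (sobolevMap k g h hg x) = g α x :=
  wderiv_sobolevMk (g := fun α => g α x) (h x) hα

/-- The inclusion of `H^{k+1}` in `H^k`. -/
def inclH (k : ℕ) : SobolevH (k + 1) →L[ℝ] SobolevH k :=
  sobolevMap k (fun α => wderiv (k + 1) α)
    (fun u _ hα => isWeakDeriv_wderiv (hα.trans (Nat.le_succ k)) u)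
    (fun u α => norm_wderiv_le α u)

theorem wderiv_inclH {k : ℕ} {α : Fin 3 → ℕ} (hα : ∑ i, α i ≤ k) (u : SobolevH (k + 1)) :
    wderiv k α (inclH k u) = wderiv (k + 1) α u :=
  wderiv_sobolevMap _ _ hα u

/-- If `D^α ∂ⱼ f` and `∂ⱼ f` are in `L²`, then the former is the derivative `D^α` of the latter. -/
theorem isWeakDeriv_of_add_single {α : Fin 3 → ℕ} {j : Fin 3} {f g w : L2}
    (h : IsWeakDeriv (Pi.single j 1) f g) (h' : IsWeakDeriv (α + Pi.single j 1) f w) :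
    IsWeakDeriv α g w := by
  intro φ hφ
  have h1 := h _ (hφ.multiDeriv α)
  rw [multiDeriv_single (hφ.multiDeriv α).smooth, ← multiDeriv_add_single hφ.smooth, h' φ hφ,
    sum_add_single, pow_succ] at h1
  simp only [Finset.sum_pi_single', Finset.mem_univ, if_true, pow_one] at h1
  linarith

/-- The partial derivative `∂ⱼ : H^{k+1} → H^k`. -/
def derivH (k : ℕ) (j : Fin 3) : SobolevH (k + 1) →L[ℝ] SobolevH k :=
  sobolevMap k (fun α => wderiv (k + 1) (α + Pi.single j 1))
    (fun u α hα => by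
      rw [zero_add]
      exact isWeakDeriv_of_add_single (isWeakDeriv_wderiv (by simp) u)
        (isWeakDeriv_wderiv (by rw [sum_add_single]; omega) u))
    (fun u α => norm_wderiv_le _ u)

theorem wderiv_derivH {k : ℕ} {α : Fin 3 → ℕ} (hα : ∑ i, α i ≤ k) (j : Fin 3)
    (u : SobolevH (k + 1)) :
    wderiv k α (derivH k j u) = wderiv (k + 1) (α + Pi.single j 1) u :=
  wderiv_sobolevMap _ _ hα u

theorem inclH_injective (k : ℕ) : Function.Injective (inclH k) := by
  intro u v h
  refine sobolev_ext ?_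
  rw [← wderiv_inclH (by simp), ← wderiv_inclH (by simp), h]

theorem IsTest.inclH_toH {φ : E3 → ℝ} (h : IsTest φ) (k : ℕ) :
    inclH k (h.toH (k + 1)) = h.toH k := by
  refine sobolev_ext ?_
  rw [wderiv_inclH (by simp), h.wderiv_toH (by simp), h.wderiv_toH (by simp)]

theorem IsTest.derivH_toH {φ : E3 → ℝ} (h : IsTest φ) (k : ℕ) (j : Fin 3) :
    derivH k j (h.toH (k + 1)) = (h.partialDeriv j).toH k := by
  refine sobolev_ext ?_
  rw [wderiv_derivH (by simp), h.wderiv_toH (by simp), (h.partialDeriv j).wderiv_toH (by simp)]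
  refine IsTest.toL2_congr _ _ ?_
  rw [zero_add, multiDeriv_single h.smooth, multiDeriv_zero]

theorem norm_wderiv_zero_le {k : ℕ} (u : SobolevH (k + 1)) :
    ‖wderiv (k + 1) 0 u‖ ≤ ‖inclH k u‖ := by
  have h : wderiv k 0 (inclH k u) = wderiv (k + 1) 0 u := wderiv_inclH (by simp) u
  rw [← h]
  exact norm_wderiv_le _ _

theorem norm_wderiv_add_single_le {k : ℕ} {α : Fin 3 → ℕ} (hα : ∑ i, α i ≤ k) (j : Fin 3)
    (u : SobolevH (k + 1)) : ‖wderiv (k + 1) (α + Pi.single j 1) u‖ ≤ ∑ j, ‖derivH k j u‖ := by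
  rw [← wderiv_derivH hα]
  have h := Finset.single_le_sum (f := fun j => ‖derivH k j u‖) (fun _ _ => norm_nonneg _)
    (Finset.mem_univ j)
  have h1 := norm_wderiv_le α (derivH k j u)
  exact h1.trans h

/-- The norm of `H^{k+1}` is controlled by the norms of the function and its gradient in `H^k`. -/
theorem norm_le_inclH_add_derivH {k : ℕ} (u : SobolevH (k + 1)) :
    ‖u‖ ≤ Fintype.card (MultiIndex (k + 1)) * (‖inclH k u‖ + ∑ j, ‖derivH k j u‖) := by
  refine norm_sobolev_le _
    (add_nonneg (norm_nonneg _) (Finset.sum_nonneg fun _ _ => norm_nonneg _)) fun α hα => ?_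
  by_cases h0 : α = 0
  · have h1 : ‖wderiv (k + 1) 0 u‖ ≤ ‖inclH k u‖ := norm_wderiv_zero_le u
    rw [h0]
    have : 0 ≤ ∑ j, ‖derivH k j u‖ := Finset.sum_nonneg fun _ _ => norm_nonneg _
    linarith
  · obtain ⟨β, j, hβ⟩ := exists_eq_add_single h0
    rw [hβ, sum_add_single] at hα
    rw [hβ]
    have h1 := norm_wderiv_add_single_le (α := β) (by omega) j u
    have h2 := norm_nonneg (inclH k u)
    linarith

/-- A function in `H^k` with gradient in `H^k` is in `H^{k+1}`. -/
theorem IsGradient.exists_lift {k : ℕ} {u : SobolevH k} {V : VecH k} (h : IsGradient u V) :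
    ∃ w : SobolevH (k + 1), inclH k w = u ∧ ∀ j, derivH k j w = V j := by
  have key : ∀ α : Fin 3 → ℕ, ∃ g : L2, ∑ i, α i ≤ k + 1 → IsWeakDeriv α (wderiv k 0 u) g := by
    intro α
    by_cases h0 : α = 0
    · exact ⟨wderiv k 0 u, fun _ => h0 ▸ isWeakDeriv_zero _⟩
    · obtain ⟨β, j, rfl⟩ := exists_eq_add_single h0
      refine ⟨wderiv k β (V j), fun hα => ?_⟩
      rw [sum_add_single] at hα
      exact h.isWeakDeriv j (by omega)
  choose g hg using key
  have h0 : g 0 = wderiv k 0 u := (hg 0 (by simp)).unique (isWeakDeriv_zero _)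
  have hg' : ∀ α, ∑ i, α i ≤ k + 1 → IsWeakDeriv α (g 0) (g α) := by
    rw [h0]
    exact hg
  refine ⟨sobolevMk (k + 1) g hg', sobolev_ext ?_, fun j => sobolev_ext ?_⟩
  · rw [wderiv_inclH (by simp), wderiv_sobolevMk _ (by simp), h0]
  · rw [wderiv_derivH (by simp), wderiv_sobolevMk _ (by simp), zero_add]
    refine (hg _ (by simp)).unique ?_
    simpa using h.isWeakDeriv (α := 0) j (by simp)

/-- The pair of a function and its gradient, as an embedding of `H^{k+1}`. It transfers strong
measurability in time from `u` and `∇u` to the lift of `u` to `H^{k+1}`. -/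
def gradEmbedding (k : ℕ) : SobolevH (k + 1) →L[ℝ] SobolevH k × (Fin 3 → SobolevH k) :=
  (inclH k).prod (ContinuousLinearMap.pi fun j => derivH k j)

theorem isEmbedding_gradEmbedding (k : ℕ) : IsEmbedding (gradEmbedding k) := by
  have h : AntilipschitzWith (Fintype.card (MultiIndex (k + 1)) * 4 : ℕ) (gradEmbedding k) := by
    refine ContinuousLinearMap.antilipschitz_of_bound _ fun u => ?_
    refine (norm_le_inclH_add_derivH u).trans ?_
    push_cast
    rw [mul_assoc]
    have h1 : ‖inclH k u‖ ≤ ‖gradEmbedding k u‖ := norm_fst_le (gradEmbedding k u)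
    have h2 : ∀ j, ‖derivH k j u‖ ≤ ‖gradEmbedding k u‖ := fun j =>
      (norm_le_pi_norm (gradEmbedding k u).2 j).trans (norm_snd_le (gradEmbedding k u))
    have h3 : ∑ j, ‖derivH k j u‖ ≤ 3 * ‖gradEmbedding k u‖ := by
      refine (Finset.sum_le_sum fun j _ => h2 j).trans ?_
      simp
    gcongr
    linarith
  exact (h.isUniformEmbedding (gradEmbedding k).uniformContinuous).isEmbedding

/-! ### Source terms as functionals on `H^{N+1}` -/

/-- The inner product composed with two bounded operators. -/
theorem exists_bilinear_inner {X Y Z : Type*} [NormedAddCommGroup X] [NormedSpace ℝ X]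
    [NormedAddCommGroup Y] [NormedSpace ℝ Y] [NormedAddCommGroup Z] [InnerProductSpace ℝ Z]
    (f : X →L[ℝ] Z) (g : Y →L[ℝ] Z) :
    ∃ F : X →L[ℝ] Y →L[ℝ] ℝ, (∀ x y, F x y = inner ℝ (f x) (g y)) ∧
      ∀ x y, |F x y| ≤ ‖f x‖ * ‖g y‖ := by
  refine ⟨(innerSL ℝ).bilinearComp f g, fun x y => rfl, fun x y => ?_⟩
  exact abs_real_inner_le_norm _ _

/-- The contribution of one multi-index `α` to the inner product of `S ∈ H^{N-1}` with
`w ∈ H^{N+1}` in `H^N`. For `α = β + eⱼ` it is `-⟪D^β S, D^{α + eⱼ} w⟫`: the derivative that `S`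
cannot take is moved onto `w`, whose gradient is in `H^N`. -/
theorem exists_sourceTerm {N : ℕ} (hN : 1 ≤ N) (α : MultiIndex N) :
    ∃ F : SobolevH (N - 1) →L[ℝ] SobolevH (N + 1) →L[ℝ] ℝ,
      (∀ S φ, ∀ h : IsTest φ, F S (h.toH (N + 1)) =
        (-1) ^ (∑ i, α.val i) * pair (fn S) (multiDeriv (α.val + α.val) φ)) ∧
      ∀ S w, |F S w| ≤ ‖S‖ * (‖inclH N w‖ + ∑ j, ‖derivH N j w‖) := by
  by_cases h0 : α.val = 0
  · obtain ⟨F, hF, hb⟩ := exists_bilinear_inner (wderiv (N - 1) 0) (wderiv (N + 1) 0)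
    refine ⟨F, fun S φ h => ?_, fun S w => (hb S w).trans ?_⟩
    · have h1 : wderiv (N + 1) 0 (h.toH (N + 1)) = (h.multiDeriv 0).toL2 := h.wderiv_toH (by simp)
      rw [hF, h1, real_inner_comm, ← pair_eq_inner, h0, fn_eq]
      simp [multiDeriv_zero]
    · have h1 : ‖wderiv (N + 1) 0 w‖ ≤ ‖inclH N w‖ := norm_wderiv_zero_le w
      have h2 : 0 ≤ ∑ j, ‖derivH N j w‖ := Finset.sum_nonneg fun _ _ => norm_nonneg _
      exact mul_le_mul (norm_wderiv_le 0 S) (by linarith) (norm_nonneg _) (norm_nonneg _)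
  · obtain ⟨β, j, hβ⟩ := exists_eq_add_single h0
    have hs := α.sum_val_le
    rw [hβ, sum_add_single] at hs
    obtain ⟨F, hF, hb⟩ := exists_bilinear_inner (wderiv (N - 1) β)
      (wderiv (N + 1) (α.val + Pi.single j 1))
    refine ⟨-F, fun S φ h => ?_, fun S w => ?_⟩
    · have h1 := isWeakDeriv_wderiv (k := N - 1) (α := β) (by omega) S _
        (h.multiDeriv (α.val + Pi.single j 1))
      rw [multiDeriv_multiDeriv h.smooth] at h1
      have h2 : β + (α.val + Pi.single j 1) = α.val + α.val := by
        conv_rhs => rw [hβ]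
        conv_lhs => rw [hβ]
        abel
      have h3 : ∑ i, (α.val + Pi.single j 1 : Fin 3 → ℕ) i ≤ N + 1 := by
        rw [sum_add_single]
        have := α.sum_val_le
        omega
      have h4 : wderiv (N + 1) (α.val + Pi.single j 1) (h.toH (N + 1)) =
        (h.multiDeriv (α.val + Pi.single j 1)).toL2 := h.wderiv_toH h3
      have h5 : ((-1 : ℝ)) ^ (∑ i, α.val i) = -(-1) ^ (∑ i, β i) := by
        rw [hβ, sum_add_single, pow_succ]
        ring
      rw [h2] at h1
      rw [neg_apply, neg_apply, hF, h4, real_inner_comm, ← pair_eq_inner, fn_eq, h1, h5,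
        neg_mul, ← mul_assoc, ← mul_pow]
      simp
    · rw [neg_apply, neg_apply, abs_neg]
      refine (hb S w).trans ?_
      have h1 := norm_wderiv_add_single_le α.sum_val_le j w
      have h3 := norm_nonneg (inclH N w)
      refine mul_le_mul (norm_wderiv_le β S) ?_ (norm_nonneg _) (norm_nonneg _)
      linarith

/-- Summation over `α` of the functionals of `exists_sourceTerm`. -/
theorem exists_sourceFunctional {N : ℕ} (hN : 1 ≤ N) :
    ∃ F : SobolevH (N - 1) →L[ℝ] SobolevH (N + 1) →L[ℝ] ℝ,
      (∀ S φ, ∀ h : IsTest φ, F S (h.toH (N + 1)) = pair (fn S) (sobolevOp N φ)) ∧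
      ∀ S w, |F S w| ≤
        Fintype.card (MultiIndex N) * (‖S‖ * (‖inclH N w‖ + ∑ j, ‖derivH N j w‖)) := by
  choose F hF hb using exists_sourceTerm (N := N) hN
  refine ⟨∑ α, F α, fun S φ h => ?_, fun S w => ?_⟩
  · rw [sobolevOp, fn_eq, pair_finset_sum_right _ _ _ (fun α _ => (h.multiDeriv _).smul _),
      ← fn_eq, sum_apply, sum_apply]
    exact Finset.sum_congr rfl fun α _ => by rw [hF, pair_smul_right]
  · rw [sum_apply, sum_apply]
    refine (Finset.abs_sum_le_sum_abs _ _).trans ?_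
    refine (Finset.sum_le_sum fun α _ => hb α S w).trans ?_
    simp

/-- A source `S ∈ H^{N-1}` acts on `H^{N+1}` by the inner product of `H^N`: one derivative of `S` is
moved onto the argument. -/
def sourceFunctional {N : ℕ} (hN : 1 ≤ N) : SobolevH (N - 1) →L[ℝ] SobolevH (N + 1) →L[ℝ] ℝ :=
  (exists_sourceFunctional hN).choose

theorem sourceFunctional_toH {N : ℕ} (hN : 1 ≤ N) (S : SobolevH (N - 1)) {φ : E3 → ℝ}
    (h : IsTest φ) : sourceFunctional hN S (h.toH (N + 1)) = pair (fn S) (sobolevOp N φ) :=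
  (exists_sourceFunctional hN).choose_spec.1 S φ h

theorem abs_sourceFunctional_le {N : ℕ} (hN : 1 ≤ N) (S : SobolevH (N - 1))
    (w : SobolevH (N + 1)) : |sourceFunctional hN S w| ≤
      Fintype.card (MultiIndex N) * (‖S‖ * (‖inclH N w‖ + ∑ j, ‖derivH N j w‖)) :=
  (exists_sourceFunctional hN).choose_spec.2 S w

/-! ### Monotonicity from local increments, and Gronwall's inequality -/

/-- A function whose increments over short intervals are bounded by an arbitrarily small multiple
of those of a fixed integral does not exceed its initial value. It replaces differentiation in
arguments where the kernel `k` is merely integrable. -/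
theorem le_of_increment_le {Ψ k : ℝ → ℝ} {t : ℝ} (ht : 0 ≤ t)
    (hk : IntervalIntegrable k volume 0 t)
    (h : ∀ ε > 0, ∃ η > 0, ∀ s r, 0 ≤ s → s ≤ r → r ≤ t → r - s < η →
      Ψ r - Ψ s ≤ ε * ∫ τ in s..r, k τ) : Ψ t ≤ Ψ 0 := by
  have key : ∀ ε > 0, Ψ t - Ψ 0 ≤ ε * ∫ τ in 0..t, k τ := by
    intro ε hε
    obtain ⟨η, hη, hinc⟩ := h ε hε
    obtain ⟨n, hn⟩ := exists_nat_gt (t / η)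
    have hn0 : (0 : ℝ) < n := lt_of_le_of_lt (div_nonneg ht hη.le) hn
    have hstep : t / n < η := by
      rw [div_lt_iff₀ hη] at hn
      rw [div_lt_iff₀ hn0]
      linarith
    have hmem : ∀ i : ℕ, i ≤ n → i * (t / n) ≤ t := by
      intro i hi
      calc i * (t / n) ≤ n * (t / n) := by gcongr
        _ = t := by field_simp
    have hint : ∀ i : ℕ, i < n →
        IntervalIntegrable k volume (i * (t / n)) ((i + 1 : ℕ) * (t / n)) := by
      intro i hi
      have h1 := hmem i hi.le
      have h2 := hmem (i + 1) hi
      refine hk.mono_set ?_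
      rw [uIcc_of_le ht]
      refine uIcc_subset_Icc ⟨by positivity, h1⟩ ⟨by positivity, h2⟩
    have h1 := Finset.sum_range_sub (fun i : ℕ => Ψ (i * (t / n))) n
    have h2 := intervalIntegral.sum_integral_adjacent_intervals (a := fun i : ℕ => i * (t / n)) hint
    have h3 : (n : ℝ) * (t / n) = t := by field_simp
    simp only [h3, Nat.cast_zero, zero_mul] at h1 h2
    rw [← h1, ← h2, Finset.mul_sum]
    refine Finset.sum_le_sum fun i hi => ?_
    have hi' := Finset.mem_range.1 hi
    refine hinc _ _ (by positivity) ?_ (hmem _ hi') ?_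
    · gcongr
      simp
    · push_cast
      linarith
  by_contra! hlt
  set c := ∫ τ in 0..t, k τ
  -- a positive increment `Ψ t - Ψ 0` contradicts the bound for this `ε`, which makes the right hand
  -- side at most half of it
  have h1 := key ((Ψ t - Ψ 0) / (2 * (|c| + 1)))
    (by have := abs_nonneg c; apply div_pos <;> linarith)
  have h2 : (Ψ t - Ψ 0) / (2 * (|c| + 1)) * c ≤ (Ψ t - Ψ 0) / 2 := by
    have h3 := le_abs_self c
    have h4 := abs_nonneg c
    rw [div_mul_eq_mul_div, div_le_div_iff₀ (by linarith) (by norm_num)]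
    nlinarith
  linarith

/-- Gronwall's inequality with an integrable kernel. The function
`(a + ∫₀ᵗ K y) exp (-∫₀ᵗ K)` does not increase; as the integrals are differentiable only almost
everywhere, this is read off from their increments. -/
theorem gronwall_integral {y K : ℝ → ℝ} {a T : ℝ}
    (hy : ContinuousOn y (Icc 0 T)) (hy0 : ∀ t ∈ Icc 0 T, 0 ≤ y t)
    (hK : IntegrableOn K (Icc 0 T)) (hK0 : ∀ t, 0 ≤ K t)
    (h : ∀ t ∈ Icc 0 T, y t ≤ a + ∫ τ in 0..t, K τ * y τ) {t : ℝ} (ht : t ∈ Icc 0 T) :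
    y t ≤ a * Real.exp (∫ τ in 0..t, K τ) := by
  have hT : 0 ≤ T := ht.1.trans ht.2
  have hKy : IntegrableOn (fun τ => K τ * y τ) (Icc 0 T) :=
    hK.mul_continuousOn hy isCompact_Icc
  have hii : ∀ {g : ℝ → ℝ}, IntegrableOn g (Icc 0 T) → ∀ {s r : ℝ}, 0 ≤ s → s ≤ r → r ≤ T →
      IntervalIntegrable g volume s r := by
    intro g hg s r h0 h1 h2
    refine (hg.mono_set ?_).intervalIntegrable
    rw [uIcc_of_le h1]
    exact Icc_subset_Icc h0 h2
  set z : ℝ → ℝ := fun t => a + ∫ τ in 0..t, K τ * y τ with hz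
  set Φ : ℝ → ℝ := fun t => ∫ τ in 0..t, K τ with hΦ
  have hzd : ∀ {s r : ℝ}, 0 ≤ s → s ≤ r → r ≤ T → z r - z s = ∫ τ in s..r, K τ * y τ := by
    intro s r h0 h1 h2
    have := intervalIntegral.integral_interval_sub_left (hii hKy le_rfl (h0.trans h1) h2)
      (hii hKy le_rfl h0 (h1.trans h2))
    simp only [hz]
    linarith
  have hΦd : ∀ {s r : ℝ}, 0 ≤ s → s ≤ r → r ≤ T → Φ r - Φ s = ∫ τ in s..r, K τ := by
    intro s r h0 h1 h2
    exact intervalIntegral.integral_interval_sub_left (hii hK le_rfl (h0.trans h1) h2)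
      (hii hK le_rfl h0 (h1.trans h2))
  have hzmono : ∀ {s r : ℝ}, 0 ≤ s → s ≤ r → r ≤ T → z s ≤ z r := by
    intro s r h0 h1 h2
    rw [← sub_nonneg, hzd h0 h1 h2]
    exact intervalIntegral.integral_nonneg h1 fun τ hτ =>
      mul_nonneg (hK0 τ) (hy0 τ ⟨h0.trans hτ.1, hτ.2.trans h2⟩)
  have hzcont : ContinuousOn z (Icc 0 T) := by
    refine continuousOn_const.add ?_
    have := intervalIntegral.continuousOn_primitive_interval (μ := volume) (a := 0) (b := T)
      (f := fun τ => K τ * y τ) (by rwa [uIcc_of_le hT])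
    rwa [uIcc_of_le hT] at this
  have huc := isCompact_Icc.uniformContinuousOn_of_continuous hzcont
  have key := le_of_increment_le (Ψ := fun t => z t * Real.exp (-Φ t)) (k := K) ht.1
    (hii hK le_rfl ht.1 ht.2) (by
      intro ε hε
      obtain ⟨η, hη, hu⟩ := Metric.uniformContinuousOn_iff.1 huc ε hε
      refine ⟨η, hη, fun s r h0 h1 h2 h3 => ?_⟩
      have hr := h2.trans ht.2
      have e1 := hzd h0 h1 hr
      have e2 := hΦd h0 h1 hr
      have e3 := hzmono h0 h1 hr
      have hd : z r - z s < ε := by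
        have := hu r ⟨h0.trans h1, hr⟩ s ⟨h0, h1.trans hr⟩ (by
          rw [Real.dist_eq, abs_of_nonneg (sub_nonneg.2 h1)]
          exact h3)
        rw [Real.dist_eq] at this
        exact (le_abs_self _).trans_lt this
      have hΔ : 0 ≤ Φ r - Φ s := by
        rw [e2]
        exact intervalIntegral.integral_nonneg h1 fun τ _ => hK0 τ
      have hΦr : 0 ≤ Φ r := intervalIntegral.integral_nonneg (h0.trans h1) fun τ _ => hK0 τ
      -- `K y ≤ K z`, and `z` is largest at the right end point
      have hle : z r - z s ≤ z r * (Φ r - Φ s) := by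
        rw [e1, e2, ← intervalIntegral.integral_const_mul]
        refine intervalIntegral.integral_mono_on h1 (hii hKy h0 h1 hr)
          ((hii hK h0 h1 hr).const_mul _) fun τ hτ => ?_
        rw [mul_comm]
        have h4 := h τ ⟨h0.trans hτ.1, hτ.2.trans hr⟩
        have h5 := hzmono (h0.trans hτ.1) hτ.2 hr
        exact mul_le_mul_of_nonneg_right (h4.trans h5) (hK0 τ)
      have hz0 : 0 ≤ z s := (hy0 s ⟨h0, h1.trans hr⟩).trans (h s ⟨h0, h1.trans hr⟩)
      have hexp := Real.add_one_le_exp (Φ r - Φ s)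
      have hsplit : Real.exp (-Φ s) = Real.exp (Φ r - Φ s) * Real.exp (-Φ r) := by
        rw [← Real.exp_add]
        ring_nf
      have hE : Real.exp (-Φ r) ≤ 1 := Real.exp_le_one_iff.2 (by linarith)
      have hE0 := Real.exp_pos (-Φ r)
      rw [← e2]
      simp only [hsplit]
      -- `exp x ≥ 1 + x` leaves `(z r - z s) (Φ r - Φ s)`, where the first factor is small by uniform
      -- continuity
      calc z r * Real.exp (-Φ r) - z s * (Real.exp (Φ r - Φ s) * Real.exp (-Φ r))
          = (z r - z s * Real.exp (Φ r - Φ s)) * Real.exp (-Φ r) := by ring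
        _ ≤ (ε * (Φ r - Φ s)) * Real.exp (-Φ r) := by
            refine mul_le_mul_of_nonneg_right ?_ hE0.le
            nlinarith
        _ ≤ (ε * (Φ r - Φ s)) * 1 := by
            refine mul_le_mul_of_nonneg_left hE (by positivity)
        _ = _ := mul_one _)
  have h0 : Φ 0 = 0 := by simp [hΦ]
  have hz0 : z 0 = a := by simp [hz]
  simp only [h0, hz0, neg_zero, Real.exp_zero, mul_one] at key
  refine (h t ht).trans ?_
  change z t ≤ a * Real.exp (Φ t)
  rw [Real.exp_neg, ← div_eq_mul_inv, div_le_iff₀ (Real.exp_pos _)] at key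
  exact key

/-! ### The energy identity in a pair of Hilbert spaces -/

/-- A uniformly bounded sequence of operators that tends to zero on a dense set tends to zero
everywhere. -/
theorem tendsto_zero_of_dense {X Y : Type*} [NormedAddCommGroup X] [NormedSpace ℝ X]
    [NormedAddCommGroup Y] [NormedSpace ℝ Y] {A : ℕ → X →L[ℝ] Y} {C : ℝ}
    (hA : ∀ n x, ‖A n x‖ ≤ C * ‖x‖) {D : Set X} (hD : Dense D)
    (h : ∀ x ∈ D, Tendsto (fun n => A n x) atTop (𝓝 0)) (x : X) :
    Tendsto (fun n => A n x) atTop (𝓝 0) := by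
  refine Metric.tendsto_atTop.2 fun ε hε => ?_
  have hC : 0 < |C| + 1 := by positivity
  obtain ⟨y, hy, hxy⟩ := Metric.mem_closure_iff.1 (hD x) (ε / 2 / (|C| + 1)) (by positivity)
  obtain ⟨n₀, hn⟩ := Metric.tendsto_atTop.1 (h y hy) (ε / 2) (by positivity)
  refine ⟨n₀, fun n hnn => ?_⟩
  have h1 := hn n hnn
  rw [dist_zero_right] at h1 ⊢
  have h2 := hA n (x - y)
  rw [dist_eq_norm, lt_div_iff₀ hC] at hxy
  have h3 : A n x = A n (x - y) + A n y := by rw [map_sub, sub_add_cancel]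
  have h4 : ‖A n x‖ ≤ ‖A n (x - y)‖ + ‖A n y‖ := by
    rw [h3]
    exact norm_add_le _ _
  have h5 : C * ‖x - y‖ ≤ ‖x - y‖ * (|C| + 1) := by
    have := le_abs_self C
    nlinarith [norm_nonneg (x - y)]
  linarith

/-- The resolvent `(ε + ι*ι)⁻¹`, from the Lax-Milgram theorem. -/
theorem exists_resolvent {V H : Type*} [NormedAddCommGroup V] [InnerProductSpace ℝ V]
    [CompleteSpace V] [NormedAddCommGroup H] [InnerProductSpace ℝ H]
    (ι : V →L[ℝ] H) {ε : ℝ} (hε : 0 < ε) :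
    ∃ R : V →L[ℝ] V, ∀ v w, ε * inner ℝ (R v) w + inner ℝ (ι (R v)) (ι w) = inner ℝ v w := by
  let B : V →L[ℝ] V →L[ℝ] ℝ := ε • innerSL ℝ + (innerSL ℝ).bilinearComp ι ι
  have hB : IsCoercive B := by
    refine ⟨ε, hε, fun v => ?_⟩
    have h1 : B v v = ε * inner ℝ v v + inner ℝ (ι v) (ι v) := rfl
    rw [h1, real_inner_self_eq_norm_sq, real_inner_self_eq_norm_sq]
    nlinarith [sq_nonneg ‖ι v‖]
  refine ⟨hB.continuousLinearEquivOfBilin.symm, fun v w => ?_⟩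
  have h2 := hB.continuousLinearEquivOfBilin_apply (hB.continuousLinearEquivOfBilin.symm v) w
  rw [ContinuousLinearEquiv.apply_symm_apply] at h2
  rw [h2]
  rfl

section Regularization

variable {V H : Type*} [NormedAddCommGroup V] [InnerProductSpace ℝ V] [CompleteSpace V]
  [NormedAddCommGroup H] [InnerProductSpace ℝ H] [CompleteSpace H]

/-- Operators `Jₙ : H → V` which approximate the inverse of a dense embedding `ι : V → H` and for
which `ι Jₙ` is symmetric. They are `(ε + ι*ι)⁻¹ ι*` for `ε = 1 / (n + 1)`. -/
theorem exists_regularization (ι : V →L[ℝ] H) (hinj : Function.Injective ι)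
    (hdense : DenseRange ι) :
    ∃ J : ℕ → H →L[ℝ] V, (∀ n x y, inner ℝ (ι (J n x)) y = inner ℝ x (ι (J n y))) ∧
      (∀ x, Tendsto (fun n => ι (J n x)) atTop (𝓝 x)) ∧
      (∀ v, Tendsto (fun n => J n (ι v)) atTop (𝓝 v)) ∧
      ∀ n v, ‖J n (ι v)‖ ≤ 2 * ‖v‖ := by
  set e : ℕ → ℝ := fun n => 1 / ((n : ℝ) + 1) with he
  have he0 : ∀ n, 0 < e n := fun n => by positivity
  have helim : Tendsto e atTop (𝓝 0) := tendsto_one_div_add_atTop_nhds_zero_nat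
  choose R hR using fun n => exists_resolvent ι (he0 n)
  set ι' := ContinuousLinearMap.adjoint ι with hι'
  have hadj : ∀ x v, inner ℝ (ι' x) v = inner ℝ x (ι v) := fun x v =>
    ContinuousLinearMap.adjoint_inner_left ι v x
  have hRι : ∀ n v, R n (ι' (ι v)) = v - e n • R n v := by
    intro n v
    refine ext_inner_right ℝ fun w => ?_
    -- by the symmetry of `R n`, this is the equation for `R n w` tested with `v`
    have hsymm : ∀ a b, inner ℝ (R n a) b = inner ℝ a (R n b) := by
      intro a b
      rw [real_inner_comm, ← hR n b (R n a), ← hR n a (R n b), real_inner_comm (R n a),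
        real_inner_comm (ι (R n a))]
    rw [hsymm, hadj, inner_sub_left, real_inner_smul_left, hsymm]
    have := hR n w v
    rw [real_inner_comm v (R n w), real_inner_comm (ι v), real_inner_comm v w] at this
    linarith
  have hRb : ∀ n v, ‖e n • R n v‖ ≤ 1 * ‖v‖ := by
    intro n v
    rw [one_mul, norm_smul, Real.norm_of_nonneg (he0 n).le]
    by_cases h0 : ‖R n v‖ = 0
    · rw [h0, mul_zero]
      exact norm_nonneg v
    · have h1 := hR n v (R n v)
      rw [real_inner_self_eq_norm_sq, real_inner_self_eq_norm_sq] at h1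
      have h2 := real_inner_le_norm v (R n v)
      have h3 : 0 < ‖R n v‖ := lt_of_le_of_ne (norm_nonneg _) (Ne.symm h0)
      nlinarith [sq_nonneg ‖ι (R n v)‖]
  -- the range of `ι*ι` is dense because its kernel is trivial
  have hSdense : Dense (range fun v => ι' (ι v)) := by
    have h1 : (LinearMap.range (ι' ∘L ι).toLinearMap).topologicalClosure = ⊤ := by
      rw [Submodule.topologicalClosure_eq_top_iff, Submodule.eq_bot_iff]
      intro v hv
      rw [Submodule.mem_orthogonal] at hv
      have h2 := hv (ι' (ι v)) ⟨v, rfl⟩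
      rw [hadj, inner_self_eq_zero (𝕜 := ℝ)] at h2
      exact hinj (h2.trans (map_zero ι).symm)
    have h2 := Submodule.dense_iff_topologicalClosure_eq_top.2 h1
    exact h2
  -- `ε (ε + ι*ι)⁻¹` is bounded by `1`, and by `2 ε ‖v‖` on `ι*ι v`
  have hRlim : ∀ v, Tendsto (fun n => (e n • R n) v) atTop (𝓝 0) := by
    refine tendsto_zero_of_dense hRb hSdense ?_
    rintro _ ⟨v, rfl⟩
    refine squeeze_zero_norm (a := fun n => e n * (2 * ‖v‖)) (fun n => ?_) ?_
    · rw [smul_apply, hRι, norm_smul, Real.norm_of_nonneg (he0 n).le]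
      refine mul_le_mul_of_nonneg_left ?_ (he0 n).le
      have := norm_sub_le v (e n • R n v)
      have := hRb n v
      linarith
    · simpa using helim.mul_const (2 * ‖v‖)
  have hJι : ∀ v, Tendsto (fun n => R n (ι' (ι v))) atTop (𝓝 v) := by
    intro v
    simp_rw [hRι]
    simpa using (tendsto_const_nhds (x := v)).sub (hRlim v)
  have hKb : ∀ n x, ‖ι (R n (ι' x))‖ ≤ ‖x‖ := by
    intro n x
    have h1 := hR n (ι' x) (R n (ι' x))
    rw [hadj, real_inner_self_eq_norm_sq, real_inner_self_eq_norm_sq] at h1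
    have h2 := real_inner_le_norm x (ι (R n (ι' x)))
    by_contra! hlt
    have h3 := norm_nonneg x
    nlinarith [mul_nonneg (he0 n).le (sq_nonneg ‖R n (ι' x)‖)]
  refine ⟨fun n => R n ∘L ι', fun n x y => ?_, fun x => ?_, hJι, fun n v => ?_⟩
  · change inner ℝ (ι (R n (ι' x))) y = inner ℝ x (ι (R n (ι' y)))
    have h1 := hR n (ι' x) (R n (ι' y))
    have h2 := hR n (ι' y) (R n (ι' x))
    rw [hadj] at h1 h2
    rw [← h1, real_inner_comm y, ← h2, real_inner_comm (R n (ι' x)),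
      real_inner_comm (ι (R n (ι' x)))]
  · have h1 : Tendsto (fun n => (ι ∘L R n ∘L ι' - ContinuousLinearMap.id ℝ H) x) atTop (𝓝 0) := by
      refine tendsto_zero_of_dense (C := 2) (fun n x => ?_) hdense ?_ x
      · change ‖ι (R n (ι' x)) - x‖ ≤ _
        have := norm_sub_le (ι (R n (ι' x))) x
        have := hKb n x
        linarith
      · rintro _ ⟨v, rfl⟩
        have h2 := ((ι.continuous.tendsto v).comp (hJι v)).sub_const (ι v)
        rw [sub_self] at h2
        exact h2
    have h2 := h1.add_const x
    rw [zero_add] at h2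
    refine h2.congr fun n => ?_
    change ι (R n (ι' x)) - x + x = ι (R n (ι' x))
    rw [sub_add_cancel]
  · change ‖R n (ι' (ι v))‖ ≤ _
    rw [hRι]
    have := norm_sub_le v (e n • R n v)
    have := hRb n v
    linarith

end Regularization

/-! ### Integrals over the time interval -/

/-- The end points of the time interval do not matter. -/
theorem timeMeasure_eq (T : ℝ) : timeMeasure T = volume.restrict (Ioc 0 T) :=
  Measure.restrict_congr_set Ioo_ae_eq_Ioc

instance (T : ℝ) : IsFiniteMeasure (timeMeasure T) := by
  unfold timeMeasure
  infer_instance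

theorem intervalIntegrable_of_timeMeasure {E : Type*} [NormedAddCommGroup E] {T : ℝ} {g : ℝ → E}
    (hg : Integrable g (timeMeasure T)) {s r : ℝ} (hs : 0 ≤ s) (hsr : s ≤ r) (hr : r ≤ T) :
    IntervalIntegrable g volume s r := by
  rw [timeMeasure_eq] at hg
  rw [intervalIntegrable_iff_integrableOn_Ioc_of_le hsr]
  exact IntegrableOn.mono_set hg (Ioc_subset_Ioc hs hr)

theorem ae_Ioc_of_timeMeasure {T : ℝ} {p : ℝ → Prop} (h : ∀ᵐ τ ∂timeMeasure T, p τ) {s r : ℝ}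
    (hs : 0 ≤ s) (hr : r ≤ T) : ∀ᵐ τ, τ ∈ Ioc s r → p τ := by
  rw [timeMeasure_eq, ae_restrict_iff' measurableSet_Ioc] at h
  filter_upwards [h] with τ hτ hm
  exact hτ ⟨hs.trans_lt hm.1, hm.2.trans hr⟩

theorem integral_congr_timeMeasure {E : Type*} [NormedAddCommGroup E] [NormedSpace ℝ E] {T : ℝ}
    {f g : ℝ → E} (h : ∀ᵐ τ ∂timeMeasure T, f τ = g τ) {s r : ℝ} (hs : 0 ≤ s) (hsr : s ≤ r)
    (hr : r ≤ T) : ∫ τ in s..r, f τ = ∫ τ in s..r, g τ := by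
  refine intervalIntegral.integral_congr_ae ?_
  rw [uIoc_of_le hsr]
  exact ae_Ioc_of_timeMeasure h hs hr

theorem integral_mono_timeMeasure {T : ℝ} {f g : ℝ → ℝ} (hf : Integrable f (timeMeasure T))
    (hg : Integrable g (timeMeasure T)) (h : ∀ᵐ τ ∂timeMeasure T, f τ ≤ g τ) {s r : ℝ}
    (hs : 0 ≤ s) (hsr : s ≤ r) (hr : r ≤ T) : ∫ τ in s..r, f τ ≤ ∫ τ in s..r, g τ := by
  refine intervalIntegral.integral_mono_ae_restrict hsr
    (intervalIntegrable_of_timeMeasure hf hs hsr hr)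
    (intervalIntegrable_of_timeMeasure hg hs hsr hr) ?_
  have h1 := ae_Ioc_of_timeMeasure h hs hr
  have h2 : ∀ᵐ τ, τ ∈ Icc s r → f τ ≤ g τ := by
    have h3 : ∀ᵐ τ : ℝ, τ ≠ s := by simp [ae_iff]
    filter_upwards [h1, h3] with τ h4 h5 h6
    exact h4 ⟨lt_of_le_of_ne h6.1 (Ne.symm h5), h6.2⟩
  exact (ae_restrict_iff' measurableSet_Icc).2 h2

theorem memLp_top_of_continuousOn {E : Type*} [NormedAddCommGroup E] {T : ℝ} {u : ℝ → E}
    (hu : ContinuousOn u (Icc 0 T)) : MemLp u ⊤ (timeMeasure T) := by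
  obtain ⟨C, hC⟩ := isCompact_Icc.exists_bound_of_continuousOn hu
  refine MemLp.of_bound ?_ C ?_
  · exact (hu.mono Ioo_subset_Icc_self).aestronglyMeasurable measurableSet_Ioo
  · refine (ae_restrict_iff' measurableSet_Ioo).2 (.of_forall fun t ht => ?_)
    exact hC t (Ioo_subset_Icc_self ht)

theorem integrable_clm_apply {X Y : Type*} [NormedAddCommGroup X] [NormedSpace ℝ X]
    [NormedAddCommGroup Y] [NormedSpace ℝ Y] {μ : Measure ℝ}
    {f : ℝ → X →L[ℝ] Y} {v : ℝ → X} {p q : ENNReal} [ENNReal.HolderTriple p q 1]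
    (hf : MemLp f p μ) (hv : MemLp v q μ) : Integrable (fun t => f t (v t)) μ :=
  memLp_one_iff_integrable.1 ((ContinuousLinearMap.id ℝ (X →L[ℝ] Y)).memLp_of_bilin 1 hf hv)

section EnergyIdentity

variable {V H : Type*} [NormedAddCommGroup V] [InnerProductSpace ℝ V]
  [NormedAddCommGroup H] [InnerProductSpace ℝ H]

/-- The energy identity for the regularized pairing `⟪u, ι J u⟫`. Its increments are
`⟪u r - u s, ι J (u r + u s)⟫`, because `ι J` is symmetric; the equation applies to them with the
test element `J (u r + u s) ∈ V`, which is close to `2 J (u τ)` for `τ` between `s` and `r`. -/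
theorem regularized_energy_identity {ι : V →L[ℝ] H} {J : H →L[ℝ] V} {T : ℝ} {u : ℝ → H}
    {f : ℝ → V →L[ℝ] ℝ} (hJ : ∀ x y, inner ℝ (ι (J x)) y = inner ℝ x (ι (J y)))
    (hu : ContinuousOn u (Icc 0 T)) (hf : MemLp f 2 (timeMeasure T))
    (heq : ∀ w, ∀ t ∈ Icc 0 T, inner ℝ (u t - u 0) (ι w) = ∫ τ in 0..t, f τ w)
    {t : ℝ} (ht : t ∈ Icc 0 T) :
    inner ℝ (u t) (ι (J (u t))) =
      inner ℝ (u 0) (ι (J (u 0))) + 2 * ∫ τ in 0..t, f τ (J (u τ)) := by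
  have hf1 : Integrable f (timeMeasure T) := hf.integrable (by norm_num)
  have hfw : ∀ w, Integrable (fun τ => f τ w) (timeMeasure T) := fun w =>
    hf1.apply_continuousLinearMap w
  have hJu : MemLp (fun τ => J (u τ)) ⊤ (timeMeasure T) :=
    memLp_top_of_continuousOn (J.continuous.comp_continuousOn hu)
  have hfJ : Integrable (fun τ => f τ (J (u τ))) (timeMeasure T) :=
    integrable_clm_apply (memLp_one_iff_integrable.2 hf1) hJu
  have hinc : ∀ w, ∀ s r, 0 ≤ s → s ≤ r → r ≤ T →
      inner ℝ (u r - u s) (ι w) = ∫ τ in s..r, f τ w := by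
    intro w s r h0 h1 h2
    have e1 := heq w r ⟨h0.trans h1, h2⟩
    have e2 := heq w s ⟨h0, h1.trans h2⟩
    rw [← intervalIntegral.integral_interval_sub_left
      (intervalIntegrable_of_timeMeasure (hfw w) le_rfl (h0.trans h1) h2)
      (intervalIntegrable_of_timeMeasure (hfw w) le_rfl h0 (h1.trans h2)), ← e1, ← e2,
      ← inner_sub_left, sub_sub_sub_cancel_right]
  set Ψ : ℝ → ℝ := fun t => inner ℝ (u t) (ι (J (u t))) - 2 * ∫ τ in 0..t, f τ (J (u τ)) with hΨ
  have huc := isCompact_Icc.uniformContinuousOn_of_continuous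
    (J.continuous.comp_continuousOn hu)
  have hloc : ∀ ε > 0, ∃ η > 0, ∀ s r, 0 ≤ s → s ≤ r → r ≤ t → r - s < η →
      |Ψ r - Ψ s| ≤ ε * ∫ τ in s..r, ‖f τ‖ := by
    intro ε hε
    obtain ⟨η, hη, hu'⟩ := Metric.uniformContinuousOn_iff.1 huc (ε / 2) (by positivity)
    refine ⟨η, hη, fun s r h0 h1 h2 h3 => ?_⟩
    have hr := h2.trans ht.2
    have e1 : inner ℝ (u r) (ι (J (u r))) - inner ℝ (u s) (ι (J (u s))) =
        ∫ τ in s..r, f τ (J (u r + u s)) := by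
      rw [← hinc _ s r h0 h1 hr, map_add, map_add, inner_add_right, inner_sub_left,
        inner_sub_left, ← hJ (u r) (u s), real_inner_comm (u s)]
      ring
    have i1 := intervalIntegrable_of_timeMeasure (hfw (J (u r + u s))) h0 h1 hr
    have i2 := (intervalIntegrable_of_timeMeasure hfJ h0 h1 hr)
    have e2 : Ψ r - Ψ s = ∫ τ in s..r, (f τ (J (u r + u s)) - 2 * f τ (J (u τ))) := by
      rw [intervalIntegral.integral_sub i1 (i2.const_mul 2), ← e1,
        intervalIntegral.integral_const_mul,
        ← intervalIntegral.integral_interval_sub_left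
          (intervalIntegrable_of_timeMeasure hfJ le_rfl (h0.trans h1) hr)
          (intervalIntegrable_of_timeMeasure hfJ le_rfl h0 (h1.trans hr))]
      simp only [hΨ]
      ring
    rw [e2, ← intervalIntegral.integral_const_mul, ← Real.norm_eq_abs]
    refine intervalIntegral.norm_integral_le_of_norm_le h1 (.of_forall fun τ hτ => ?_)
      ((intervalIntegrable_of_timeMeasure hf1.norm h0 h1 hr).const_mul ε)
    have hτ' : τ ∈ Icc 0 T := ⟨h0.trans hτ.1.le, hτ.2.trans hr⟩
    have hr' : r ∈ Icc 0 T := ⟨h0.trans h1, hr⟩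
    have hs' : s ∈ Icc 0 T := ⟨h0, h1.trans hr⟩
    have e3 : f τ (J (u r + u s)) - 2 * f τ (J (u τ)) =
        f τ ((J (u r) - J (u τ)) + (J (u s) - J (u τ))) := by
      simp only [map_add, map_sub]
      ring
    have d1 : ‖J (u r) - J (u τ)‖ ≤ ε / 2 := by
      rw [← dist_eq_norm]
      refine (hu' r hr' τ hτ' ?_).le
      rw [Real.dist_eq, abs_of_nonneg (sub_nonneg.2 hτ.2)]
      linarith [hτ.1]
    have d2 : ‖J (u s) - J (u τ)‖ ≤ ε / 2 := by
      rw [← dist_eq_norm, dist_comm]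
      refine (hu' τ hτ' s hs' ?_).le
      rw [Real.dist_eq, abs_of_nonneg (sub_nonneg.2 hτ.1.le)]
      linarith [hτ.2]
    rw [e3, mul_comm ε]
    refine ((f τ).le_opNorm _).trans (mul_le_mul_of_nonneg_left ?_ (norm_nonneg _))
    refine (norm_add_le _ _).trans ?_
    linarith
  have hk := intervalIntegrable_of_timeMeasure hf1.norm le_rfl ht.1 ht.2
  have k1 := le_of_increment_le ht.1 hk fun ε hε => by
    obtain ⟨η, hη, h⟩ := hloc ε hε
    exact ⟨η, hη, fun s r h0 h1 h2 h3 => (le_abs_self _).trans (h s r h0 h1 h2 h3)⟩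
  have k2 := le_of_increment_le (Ψ := fun t => -Ψ t) ht.1 hk fun ε hε => by
    obtain ⟨η, hη, h⟩ := hloc ε hε
    refine ⟨η, hη, fun s r h0 h1 h2 h3 => (le_trans ?_ (neg_le_abs _)).trans (h s r h0 h1 h2 h3)⟩
    linarith
  have k3 : Ψ t = Ψ 0 := le_antisymm k1 (neg_le_neg_iff.1 k2)
  have k0 : Ψ 0 = inner ℝ (u 0) (ι (J (u 0))) := by simp [hΨ]
  rw [k0] at k3
  simp only [hΨ] at k3
  linarith

/-- The energy identity of Lions and Magenes: if `u ∈ C([0,T]; H) ∩ L²(0,T; V)` and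
`u' = f ∈ L²(0,T; V*)`, then `‖u‖²` is absolutely continuous with derivative `2 f(u)`. -/
theorem energy_identity [CompleteSpace V] [CompleteSpace H] {ι : V →L[ℝ] H}
    (hinj : Function.Injective ι) (hdense : DenseRange ι)
    {T : ℝ} {u : ℝ → H} {v : ℝ → V} {f : ℝ → V →L[ℝ] ℝ} (hu : ContinuousOn u (Icc 0 T))
    (hv : MemLp v 2 (timeMeasure T)) (huv : ∀ᵐ τ ∂timeMeasure T, ι (v τ) = u τ)
    (hf : MemLp f 2 (timeMeasure T))
    (heq : ∀ w, ∀ t ∈ Icc 0 T, inner ℝ (u t - u 0) (ι w) = ∫ τ in 0..t, f τ w)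
    {t : ℝ} (ht : t ∈ Icc 0 T) :
    ‖u t‖ ^ 2 = ‖u 0‖ ^ 2 + 2 * ∫ τ in 0..t, f τ (v τ) := by
  obtain ⟨J, hsymm, hlim, hJv, hJb⟩ := exists_regularization ι hinj hdense
  have hreg := fun n => regularized_energy_identity (hsymm n) hu hf heq ht
  have hJu : ∀ n, ∀ᵐ τ ∂timeMeasure T, J n (u τ) = J n (ι (v τ)) := fun n => by
    filter_upwards [huv] with τ hτ
    rw [hτ]
  have hn : ∀ x, Tendsto (fun n => inner ℝ x (ι (J n x))) atTop (𝓝 (‖x‖ ^ 2)) := by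
    intro x
    rw [← real_inner_self_eq_norm_sq]
    exact tendsto_const_nhds.inner (hlim x)
  have hfv : Integrable (fun τ => ‖f τ‖ * ‖v τ‖) (timeMeasure T) :=
    hf.norm.integrable_mul hv.norm
  have hint : Tendsto (fun n => ∫ τ in 0..t, f τ (J n (u τ))) atTop
      (𝓝 (∫ τ in 0..t, f τ (v τ))) := by
    refine intervalIntegral.tendsto_integral_filter_of_dominated_convergence
      (fun τ => 2 * (‖f τ‖ * ‖v τ‖)) (.of_forall fun n => ?_) (.of_forall fun n => ?_) ?_ ?_
    · rw [uIoc_of_le ht.1]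
      have h1 : Integrable (fun τ => f τ (J n (u τ))) (timeMeasure T) :=
        integrable_clm_apply (memLp_one_iff_integrable.2 (hf.integrable (by norm_num)))
          (memLp_top_of_continuousOn ((J n).continuous.comp_continuousOn hu))
      have h2 := (intervalIntegrable_of_timeMeasure h1 le_rfl ht.1 ht.2).1
      exact h2.aestronglyMeasurable
    · rw [uIoc_of_le ht.1]
      filter_upwards [ae_Ioc_of_timeMeasure (hJu n) le_rfl ht.2] with τ hτ hm
      rw [hτ hm]
      calc ‖f τ (J n (ι (v τ)))‖ ≤ ‖f τ‖ * ‖J n (ι (v τ))‖ := (f τ).le_opNorm _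
        _ ≤ ‖f τ‖ * (2 * ‖v τ‖) := mul_le_mul_of_nonneg_left (hJb n _) (norm_nonneg _)
        _ = _ := by ring
    · exact (intervalIntegrable_of_timeMeasure hfv le_rfl ht.1 ht.2).const_mul 2
    · rw [uIoc_of_le ht.1]
      filter_upwards [ae_Ioc_of_timeMeasure huv le_rfl ht.2] with τ hτ hm
      rw [← hτ hm]
      exact ((f τ).continuous.tendsto _).comp (hJv (v τ))
  -- pass to the limit in the regularized identities
  refine tendsto_nhds_unique (hn (u t)) ?_
  simp_rw [hreg]
  exact (hn (u 0)).add (hint.const_mul 2)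

end EnergyIdentity

/-! ### The energy identity for scalar equations in `H^N` -/

theorem memLp_clm_comp {α X Y : Type*} [MeasurableSpace α] {μ : Measure α}
    [NormedAddCommGroup X] [NormedSpace ℝ X] [NormedAddCommGroup Y] [NormedSpace ℝ Y]
    {p : ENNReal} {f : α → X} (L : X →L[ℝ] Y) (hf : MemLp f p μ) :
    MemLp (fun t => L (f t)) p μ := L.comp_memLp' hf

theorem memLp_coord {α X : Type*} [MeasurableSpace α] {μ : Measure α} [NormedAddCommGroup X]
    {p : ENNReal} {f : α → PiLp 2 (fun _ : Fin 3 => X)} (hf : MemLp f p μ) (j : Fin 3) :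
    MemLp (fun t => f t j) p μ :=
  hf.mono ((PiLp.continuous_apply 2 _ j).comp_aestronglyMeasurable hf.1)
    (.of_forall fun t => PiLp.norm_apply_le (f t) j)

theorem denseRange_inclH (N : ℕ) : DenseRange (inclH N) :=
  (dense_toH N).mono (by
    rintro _ ⟨φ, h, rfl⟩
    exact ⟨h.toH (N + 1), h.inclH_toH N⟩)

/-- A function in `L²(0,T; H^N)` with gradient in `L²(0,T; H^N)` is in `L²(0,T; H^{N+1})`. -/
theorem exists_memLp_lift {N : ℕ} {T : ℝ} {u : ℝ → SobolevH N} {Du : ℝ → VecH N}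
    (hu : MemLp u 2 (timeMeasure T)) (hDu : MemLp Du 2 (timeMeasure T))
    (hgrad : ∀ᵐ t ∂timeMeasure T, IsGradient (u t) (Du t)) :
    ∃ v : ℝ → SobolevH (N + 1), MemLp v 2 (timeMeasure T) ∧
      (∀ᵐ t ∂timeMeasure T, inclH N (v t) = u t) ∧
      ∀ᵐ t ∂timeMeasure T, ∀ j, derivH N j (v t) = Du t j := by
  have hex : ∀ t, ∃ w : SobolevH (N + 1), IsGradient (u t) (Du t) →
      inclH N w = u t ∧ ∀ j, derivH N j w = Du t j := by
    intro t
    by_cases h : IsGradient (u t) (Du t)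
    · obtain ⟨w, hw⟩ := h.exists_lift
      exact ⟨w, fun _ => hw⟩
    · exact ⟨0, fun h' => (h h').elim⟩
  choose v hv using hex
  have h1 : ∀ᵐ t ∂timeMeasure T, inclH N (v t) = u t := hgrad.mono fun t h => (hv t h).1
  have h2 : ∀ᵐ t ∂timeMeasure T, ∀ j, derivH N j (v t) = Du t j :=
    hgrad.mono fun t h => (hv t h).2
  have hDj : ∀ j, MemLp (fun t => Du t j) 2 (timeMeasure T) := fun j => memLp_coord hDu j
  have hm : AEStronglyMeasurable v (timeMeasure T) := by
    rw [← (isEmbedding_gradEmbedding N).aestronglyMeasurable_comp_iff]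
    have h3 : AEStronglyMeasurable (fun t => (u t, fun j => Du t j)) (timeMeasure T) :=
      hu.1.prodMk ((PiLp.continuous_ofLp 2 _).comp_aestronglyMeasurable hDu.1)
    refine h3.congr ?_
    filter_upwards [h1, h2] with t e1 e2
    exact (Prod.ext e1 (funext e2)).symm
  refine ⟨v, ?_, h1, h2⟩
  have hb : MemLp (fun t => Fintype.card (MultiIndex (N + 1)) * (‖u t‖ + ∑ j, ‖Du t j‖)) 2
      (timeMeasure T) :=
    (hu.norm.add (memLp_finsetSum _ fun j _ => (hDj j).norm)).const_mul _
  refine hb.mono' hm ?_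
  filter_upwards [h1, h2] with t e1 e2
  have := norm_le_inclH_add_derivH (v t)
  simpa only [e1, e2] using this

/-- The energy identity for `u' = D* q + ι* r + S`, tested on a dense set. Both sides of the
equation are continuous in the test element, so it holds for all of `V`, and
`f = D* q + ι* r + S` is in `L²(0,T; V*)`. -/
theorem energy_identity_of_dense {V H X : Type*} [NormedAddCommGroup V] [InnerProductSpace ℝ V]
    [CompleteSpace V] [NormedAddCommGroup H] [InnerProductSpace ℝ H] [CompleteSpace H]
    [NormedAddCommGroup X] [NormedSpace ℝ X] {ι : V →L[ℝ] H} {D : Fin 3 → V →L[ℝ] H}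
    {src : X →L[ℝ] V →L[ℝ] ℝ} (hinj : Function.Injective ι) (hdense : DenseRange ι)
    {𝒟 : Set V} (h𝒟 : Dense 𝒟) {T : ℝ} {u : ℝ → H} {v : ℝ → V} {q : Fin 3 → ℝ → H} {r : ℝ → H}
    {S : ℝ → X} (hu : ContinuousOn u (Icc 0 T)) (hv : MemLp v 2 (timeMeasure T))
    (huv : ∀ᵐ τ ∂timeMeasure T, ι (v τ) = u τ) (hq : ∀ j, MemLp (q j) 2 (timeMeasure T))
    (hr : MemLp r 2 (timeMeasure T)) (hS : MemLp S 2 (timeMeasure T))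
    (heq : ∀ w ∈ 𝒟, ∀ t ∈ Icc 0 T, inner ℝ (u t - u 0) (ι w) = ∫ τ in 0..t,
      (∑ j, inner ℝ (q j τ) (D j w) + inner ℝ (r τ) (ι w) + src (S τ) w)) :
    Integrable (fun τ => src (S τ) (v τ)) (timeMeasure T) ∧
      Integrable (fun τ => ∑ j, inner ℝ (q j τ) (D j (v τ)) + inner ℝ (r τ) (ι (v τ)) +
        src (S τ) (v τ)) (timeMeasure T) ∧
      ∀ t ∈ Icc 0 T, ‖u t‖ ^ 2 = ‖u 0‖ ^ 2 + 2 * ∫ τ in 0..t,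
        (∑ j, inner ℝ (q j τ) (D j (v τ)) + inner ℝ (r τ) (ι (v τ)) + src (S τ) (v τ)) := by
  choose Bq hBq _ using fun j => exists_bilinear_inner (ContinuousLinearMap.id ℝ H) (D j)
  obtain ⟨Br, hBr, _⟩ := exists_bilinear_inner (ContinuousLinearMap.id ℝ H) ι
  set f : ℝ → V →L[ℝ] ℝ := fun τ => ∑ j, Bq j (q j τ) + Br (r τ) + src (S τ) with hfdef
  have hsrc : MemLp (fun τ => src (S τ)) 2 (timeMeasure T) := memLp_clm_comp src hS
  have hf : MemLp f 2 (timeMeasure T) :=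
    ((memLp_finsetSum _ fun j _ => memLp_clm_comp (Bq j) (hq j)).add
      (memLp_clm_comp Br hr)).add hsrc
  have hfapp : ∀ τ w, f τ w = ∑ j, inner ℝ (q j τ) (D j w) + inner ℝ (r τ) (ι w) +
      src (S τ) w := by
    intro τ w
    simp only [hfdef, add_apply, sum_apply, hBq, hBr, ContinuousLinearMap.id_apply]
  have hf1 : Integrable f (timeMeasure T) := hf.integrable (by norm_num)
  have hweak : ∀ w, ∀ t ∈ Icc 0 T, inner ℝ (u t - u 0) (ι w) = ∫ τ in 0..t, f τ w := by
    intro w t ht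
    have hfi := intervalIntegrable_of_timeMeasure hf1 le_rfl ht.1 ht.2
    have hint : ∀ w, ∫ τ in 0..t, f τ w = (∫ τ in 0..t, f τ) w := fun w =>
      (ContinuousLinearMap.intervalIntegral_apply hfi w).symm
    rw [hint]
    have hc1 : Continuous fun w => inner ℝ (u t - u 0) (ι w) :=
      continuous_const.inner ι.continuous
    refine congrFun (hc1.ext_on h𝒟 (ContinuousLinearMap.continuous _) fun w hw => ?_) w
    change inner ℝ (u t - u 0) (ι w) = (∫ τ in 0..t, f τ) w
    rw [← hint, heq w hw t ht]
    simp only [hfapp]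
  refine ⟨integrable_clm_apply hsrc hv, ?_, fun t ht => ?_⟩
  · simp only [← hfapp]
    exact integrable_clm_apply hf hv
  · simp only [← hfapp]
    exact energy_identity hinj hdense hu hv huv hf hweak ht

/-- The energy identity in `H^N` for `u' = -∑ⱼ ∂ⱼ qⱼ + r + S`, where `S ∈ H^{N-1}` and `F` is the
power of `S`. -/
theorem sobolev_energy_identity {N : ℕ} (hN : 1 ≤ N) {T : ℝ} {u : ℝ → SobolevH N}
    {Du : ℝ → VecH N} {q : Fin 3 → ℝ → SobolevH N} {r : ℝ → SobolevH N}
    {S : ℝ → SobolevH (N - 1)}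
    (hu : ContinuousOn u (Icc 0 T)) (hDu : MemLp Du 2 (timeMeasure T))
    (hgrad : ∀ᵐ t ∂timeMeasure T, IsGradient (u t) (Du t))
    (hq : ∀ j, MemLp (q j) 2 (timeMeasure T)) (hr : MemLp r 2 (timeMeasure T))
    (hS : MemLp S 2 (timeMeasure T))
    (heq : ∀ φ : E3 → ℝ, IsTest φ → ∀ t ∈ Icc 0 T,
      pair (fn (u t)) φ - pair (fn (u 0)) φ = ∫ τ in 0..t,
        (∑ j, pair (fn (q j τ)) (partialDeriv j φ) + pair (fn (r τ)) φ + pair (fn (S τ)) φ)) :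
    ∃ F : ℝ → ℝ, Integrable F (timeMeasure T) ∧
      (∀ᵐ τ ∂timeMeasure T, |F τ| ≤
        Fintype.card (MultiIndex N) * (‖S τ‖ * (‖u τ‖ + ∑ j, ‖Du τ j‖))) ∧
      Integrable (fun τ => ∑ j, inner ℝ (q j τ) (Du τ j) + inner ℝ (r τ) (u τ) + F τ)
        (timeMeasure T) ∧
      ∀ t ∈ Icc 0 T, ‖u t‖ ^ 2 = ‖u 0‖ ^ 2 + 2 * ∫ τ in 0..t,
        (∑ j, inner ℝ (q j τ) (Du τ j) + inner ℝ (r τ) (u τ) + F τ) := by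
  have hu2 : MemLp u 2 (timeMeasure T) := (memLp_top_of_continuousOn hu).mono_exponent le_top
  obtain ⟨v, hv, hvu, hvD⟩ := exists_memLp_lift hu2 hDu hgrad
  have hweak : ∀ w ∈ {u : SobolevH (N + 1) | ∃ ψ, ∃ h : IsTest ψ, u = h.toH (N + 1)},
      ∀ t ∈ Icc 0 T, inner ℝ (u t - u 0) (inclH N w) = ∫ τ in 0..t,
      (∑ j, inner ℝ (q j τ) (derivH N j w) + inner ℝ (r τ) (inclH N w) +
        sourceFunctional hN (S τ) w) := by
    rintro _ ⟨φ, h, rfl⟩ t ht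
    -- testing in `H^N` with `φ` is testing with `sobolevOp N φ` in the sense of distributions
    rw [h.inclH_toH, inner_sub_left, inner_toH, inner_toH, heq _ (h.sobolevOp N) t ht]
    refine intervalIntegral.integral_congr fun τ _ => ?_
    simp only [h.derivH_toH, inner_toH, sourceFunctional_toH, partialDeriv_sobolevOp h]
  obtain ⟨hF, hI, hE⟩ := energy_identity_of_dense (inclH_injective N) (denseRange_inclH N)
    (dense_toH (N + 1)) hu hv hvu hq hr hS hweak
  have hfv : ∀ᵐ τ ∂timeMeasure T, ∑ j, inner ℝ (q j τ) (derivH N j (v τ)) +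
      inner ℝ (r τ) (inclH N (v τ)) + sourceFunctional hN (S τ) (v τ) =
      ∑ j, inner ℝ (q j τ) (Du τ j) +
      inner ℝ (r τ) (u τ) + sourceFunctional hN (S τ) (v τ) := by
    filter_upwards [hvu, hvD] with τ e1 e2
    simp only [e1, e2]
  refine ⟨fun τ => sourceFunctional hN (S τ) (v τ), hF, ?_, hI.congr hfv, fun t ht => ?_⟩
  · filter_upwards [hvu, hvD] with τ e1 e2
    have := abs_sourceFunctional_le hN (S τ) (v τ)
    simpa only [e1, e2] using this
  · rw [hE t ht, integral_congr_timeMeasure hfv le_rfl ht.1 ht.2]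

/-- The energy identity in `H^N` for `u' = r`. -/
theorem sobolev_energy_identity_ode {N : ℕ} {T : ℝ} {u r : ℝ → SobolevH N}
    (hu : ContinuousOn u (Icc 0 T)) (hr : MemLp r 2 (timeMeasure T))
    (heq : ∀ φ : E3 → ℝ, IsTest φ → ∀ t ∈ Icc 0 T,
      pair (fn (u t)) φ - pair (fn (u 0)) φ = ∫ τ in 0..t, pair (fn (r τ)) φ)
    {t : ℝ} (ht : t ∈ Icc 0 T) :
    ‖u t‖ ^ 2 = ‖u 0‖ ^ 2 + 2 * ∫ τ in 0..t, inner ℝ (r τ) (u τ) := by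
  have hu2 : MemLp u 2 (timeMeasure T) := (memLp_top_of_continuousOn hu).mono_exponent le_top
  have hf : MemLp (fun τ => innerSL ℝ (r τ)) 2 (timeMeasure T) :=
    memLp_clm_comp (innerSL ℝ) hr
  have hr1 : Integrable r (timeMeasure T) := hr.integrable (by norm_num)
  refine energy_identity (ι := ContinuousLinearMap.id ℝ (SobolevH N)) Function.injective_id
    Function.surjective_id.denseRange hu hu2 (.of_forall fun _ => rfl) hf ?_ ht
  intro w t ht
  have hri := intervalIntegrable_of_timeMeasure hr1 le_rfl ht.1 ht.2
  have hint : ∀ w, ∫ τ in 0..t, inner ℝ (r τ) w = inner ℝ (∫ τ in 0..t, r τ) w := by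
    intro w
    have := ((innerSL ℝ).flip w).intervalIntegral_comp_comm hri
    exact this
  change inner ℝ (u t - u 0) w = ∫ τ in 0..t, inner ℝ (r τ) w
  rw [hint]
  refine congrFun ((continuous_const.inner continuous_id).ext_on (dense_toH N)
    (continuous_const.inner continuous_id) ?_) w
  rintro _ ⟨φ, h, rfl⟩
  change inner ℝ (u t - u 0) (h.toH N) = inner ℝ (∫ τ in 0..t, r τ) (h.toH N)
  rw [← hint, inner_sub_left, inner_toH, inner_toH, heq _ (h.sobolevOp N) t ht]
  exact intervalIntegral.integral_congr fun τ _ => (inner_toH _ h).symm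

/-! ### The momentum flux -/

/-- The pairing with a test function, as a functional on `H^k`. -/
def pairFn (k : ℕ) {φ : E3 → ℝ} (h : IsTest φ) : SobolevH k →L[ℝ] ℝ :=
  (innerSL ℝ h.toL2).comp (wderiv k 0)

theorem pairFn_apply {k : ℕ} {φ : E3 → ℝ} (h : IsTest φ) (u : SobolevH k) :
    pairFn k h u = pair (fn u) φ := by
  rw [fn_eq, pair_eq_inner _ h]
  rfl

/-- The underlying function of a finite sum. -/
theorem fn_sum {k : ℕ} (v : Fin 3 → SobolevH k) :
    fn (∑ j, v j) =ᵐ[volume] fun x => ∑ j, fn (v j) x := by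
  simp only [fn_eq, Fin.sum_univ_three, map_add]
  filter_upwards [Lp.coeFn_add (wderiv k 0 (v 0) + wderiv k 0 (v 1)) (wderiv k 0 (v 2)),
    Lp.coeFn_add (wderiv k 0 (v 0)) (wderiv k 0 (v 1))] with x h1 h2
  rw [h1, Pi.add_apply, h2, Pi.add_apply]

/-- The product `(c + B) v`, for a coefficient that differs from the constant `c` by `B ∈ H^N`. -/
def coefMul {N : ℕ} (hN : 3 ≤ N) (c : ℝ) (B v : SobolevH N) : SobolevH N := c • v + mulH hN B v

theorem pair_coefMul {N : ℕ} (hN : 3 ≤ N) {c : ℝ} {B v : SobolevH N} {A f : E3 → ℝ}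
    (hA : ∀ᵐ x, A x = c + fn B x) (hf : fn v =ᵐ[volume] f) (φ : E3 → ℝ) :
    pair (fun x => A x * f x) φ = pair (fn (coefMul hN c B v)) φ := by
  refine pair_congr ?_ φ
  have h0 : fn (coefMul hN c B v) =ᵐ[volume] fun x => c * fn v x + fn (mulH hN B v) x := by
    simp only [fn_eq, coefMul, map_add, map_smul]
    filter_upwards [Lp.coeFn_add (c • wderiv N 0 v) (wderiv N 0 (mulH hN B v)),
      Lp.coeFn_smul c (wderiv N 0 v)] with x h1 h2
    rw [h1, Pi.add_apply, h2, Pi.smul_apply, smul_eq_mul]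
  filter_upwards [h0, fn_mulH hN B v, hA, hf] with x h1 h2 h3 h4
  rw [h1, h2, h3, ← h4]
  ring

theorem memLp_bilinear_top {α X Y Z : Type*} [MeasurableSpace α] {μ : Measure α}
    [NormedAddCommGroup X] [NormedSpace ℝ X] [NormedAddCommGroup Y] [NormedSpace ℝ Y]
    [NormedAddCommGroup Z] [NormedSpace ℝ Z] (L : X →L[ℝ] Y →L[ℝ] Z) {f : α → X} {v : α → Y}
    (hf : MemLp f ⊤ μ) (hv : MemLp v 2 μ) : MemLp (fun t => L (f t) (v t)) 2 μ :=
  L.memLp_of_bilin 2 hf hv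

theorem memLp_coefMul {N : ℕ} (hN : 3 ≤ N) (c : ℝ) {T : ℝ} {B v : ℝ → SobolevH N}
    (hB : MemLp B ⊤ (timeMeasure T)) (hv : MemLp v 2 (timeMeasure T)) :
    MemLp (fun τ => coefMul hN c (B τ) (v τ)) 2 (timeMeasure T) :=
  (hv.const_smul c).add (memLp_bilinear_top (mulH hN) hB hv)

/-- The divergence of a field in `H^N`, from the matrix `M` of its first derivatives. -/
def divH {N : ℕ} (M : MatH N) : SobolevH N := ∑ j, M j j

theorem memLp_divH {N : ℕ} {T : ℝ} {M : ℝ → MatH N} (hM : MemLp M 2 (timeMeasure T)) :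
    MemLp (fun τ => divH (M τ)) 2 (timeMeasure T) :=
  memLp_finsetSum _ fun j _ => memLp_coord (memLp_coord hM j) j

theorem sum_pair_eq_neg_pair_divH {N : ℕ} {m : VecH N} {M : MatH N}
    (h : ∀ i, IsGradient (m i) (M i)) {φ : E3 → ℝ} (hφ : IsTest φ) :
    ∑ j, pair (fn (m j)) (partialDeriv j φ) = -pair (fn (divH M)) φ := by
  simp only [fun j => h j j φ hφ, ← pairFn_apply hφ, divH, map_sum, Finset.sum_neg_distrib]

/-- The flux `q` with which the momentum equation reads `∂ₜ mᵢ = -∑ⱼ ∂ⱼ qᵢⱼ + S₁ᵢ`. Here `M` is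
the matrix of first derivatives of `m`, the viscosity coefficient is `c + B`, and `α, β` are the
coefficients of `∇n` and `∇ζ`. -/
def flux {N : ℕ} (hN : 3 ≤ N) (μb lb α β c : ℝ) (B : SobolevH N) (M : MatH N) (n ζ : SobolevH N)
    (i j : Fin 3) : SobolevH N :=
  -μb • coefMul hN c B (M i j) +
    if i = j then -(lb + μb) • coefMul hN c B (divH M) + α • n + β • ζ else 0

/-- The momentum flux in the sense of distributions. -/
theorem sum_pair_flux {N : ℕ} (hN : 3 ≤ N) (μb lb α β : ℝ) {c : ℝ} {B : SobolevH N} (M : MatH N)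
    (n ζ : SobolevH N) {A : E3 → ℝ} (hA : ∀ᵐ x, A x = c + fn B x) (i : Fin 3) {φ : E3 → ℝ}
    (h : IsTest φ) :
    ∑ j, pair (fn (flux hN μb lb α β c B M n ζ i j)) (partialDeriv j φ) =
      -μb * (∑ j, pair (fun x => A x * fn (M i j) x) (partialDeriv j φ))
        - (lb + μb) * pair (fun x => A x * (∑ j, fn (M j j) x)) (partialDeriv i φ)
        + α * pair (fn n) (partialDeriv i φ) + β * pair (fn ζ) (partialDeriv i φ) := by
  have h1 : ∀ j, pair (fn (flux hN μb lb α β c B M n ζ i j)) (partialDeriv j φ) =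
      -μb * pair (fun x => A x * fn (M i j) x) (partialDeriv j φ) + if i = j then
        -(lb + μb) * pair (fun x => A x * (∑ j, fn (M j j) x)) (partialDeriv j φ)
          + α * pair (fn n) (partialDeriv j φ) + β * pair (fn ζ) (partialDeriv j φ) else 0 := by
    intro j
    rw [pair_coefMul hN hA (Filter.EventuallyEq.refl _ _),
      pair_coefMul hN hA (fn_sum fun j => M j j), ← pairFn_apply (h.partialDeriv j),
      ← pairFn_apply (h.partialDeriv j), ← pairFn_apply (h.partialDeriv j),
      ← pairFn_apply (h.partialDeriv j), ← pairFn_apply (h.partialDeriv j), flux, map_add, map_smul,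
      smul_eq_mul]
    congr 1
    split_ifs
    · simp only [map_add, map_smul, smul_eq_mul, divH]
    · exact map_zero _
  rw [Finset.sum_congr rfl fun j _ => h1 j, Finset.sum_add_distrib, ← Finset.mul_sum,
    Finset.sum_ite_eq]
  simp only [Finset.mem_univ, if_true]
  ring

theorem memLp_flux {N : ℕ} (hN : 3 ≤ N) (μb lb α β c : ℝ) {T : ℝ} {B : ℝ → SobolevH N}
    {M : ℝ → MatH N} {n ζ : ℝ → SobolevH N}
    (hB : MemLp B ⊤ (timeMeasure T)) (hM : MemLp M 2 (timeMeasure T))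
    (hn : MemLp n 2 (timeMeasure T)) (hζ : MemLp ζ 2 (timeMeasure T)) (i j : Fin 3) :
    MemLp (fun τ => flux hN μb lb α β c (B τ) (M τ) (n τ) (ζ τ) i j) 2 (timeMeasure T) := by
  have h1 := (memLp_coefMul hN c hB (memLp_coord (memLp_coord hM i) j)).const_smul (-μb)
  by_cases hij : i = j
  · simp only [flux, if_pos hij]
    exact h1.add ((((memLp_coefMul hN c hB (memLp_divH hM)).const_smul (-(lb + μb))).add
      (hn.const_smul α)).add (hζ.const_smul β))
  · simp only [flux, if_neg hij, add_zero]
    exact h1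

theorem inner_combination_left {H : Type*} [NormedAddCommGroup H] [InnerProductSpace ℝ H]
    (P : Prop) [Decidable P] (a b α β : ℝ) (x y n ζ w : H) :
    inner ℝ (a • x + if P then b • y + α • n + β • ζ else 0) w =
      a * inner ℝ x w + if P then b * inner ℝ y w + α * inner ℝ n w + β * inner ℝ ζ w else 0 := by
  rw [inner_add_left, real_inner_smul_left]
  congr 1
  split_ifs
  · rw [inner_add_left, inner_add_left, real_inner_smul_left, real_inner_smul_left,
      real_inner_smul_left]
  · exact inner_zero_left _

/-- The momentum flux tested with the gradient: viscous terms and the work of the pressure. -/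
theorem sum_inner_flux {N : ℕ} (hN : 3 ≤ N) (μb lb α β c : ℝ) (B : SobolevH N) (M : MatH N)
    (n ζ : SobolevH N) :
    ∑ i, ∑ j, inner ℝ (flux hN μb lb α β c B M n ζ i j) (M i j) =
      -μb * (∑ i, ∑ j, inner ℝ (coefMul hN c B (M i j)) (M i j))
        - (lb + μb) * inner ℝ (coefMul hN c B (divH M)) (divH M)
        + α * inner ℝ n (divH M) + β * inner ℝ ζ (divH M) := by
  have h1 : ∀ i j, inner ℝ (flux hN μb lb α β c B M n ζ i j) (M i j) =
      -μb * inner ℝ (coefMul hN c B (M i j)) (M i j) + if i = j then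
        -(lb + μb) * inner ℝ (coefMul hN c B (divH M)) (M i j)
          + α * inner ℝ n (M i j) + β * inner ℝ ζ (M i j) else 0 := by
    intro i j
    exact inner_combination_left (i = j) _ _ _ _ _ _ _ _ _
  have h2 : ∀ w : SobolevH N, inner ℝ w (divH M) = ∑ j, inner ℝ w (M j j) := fun w =>
    inner_sum _ _ _
  simp only [h1, Finset.sum_add_distrib, Finset.sum_ite_eq, Finset.mem_univ, if_true,
    ← Finset.mul_sum, h2]
  ring

/-! ### The energy identities of the four equations -/

namespace GasModel

variable (g : GasModel)

theorem Pρ_pos : 0 < g.Pρ := g.P_ρ_pos _ _ g.ρbar_pos g.θbar_pos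

theorem eθ_pos : 0 < g.eθ := g.e_θ_pos _ _ g.ρbar_pos g.θbar_pos

theorem μbar_pos : 0 < g.μbar := div_pos g.μ_pos g.ρbar_pos

/-- The only consequence of `3 lam + 2 μ ≥ 0` that enters: the second viscous term is dissipative. -/
theorem lambar_add_μbar_nonneg : 0 ≤ g.lambar + g.μbar := by
  have h1 := g.lam_bound
  have h2 := g.μ_pos
  rw [lambar, μbar, ← add_div]
  exact div_nonneg (by linarith) g.ρbar_pos.le

/-- The heat capacity `ρbar e_θ`. -/
def heatCap : ℝ := g.ρbar * g.eθ

theorem heatCap_pos : 0 < g.heatCap := mul_pos g.ρbar_pos g.eθ_pos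

/-- The emission coefficient `4 σt θbar³`. -/
def emission : ℝ := 4 * g.σt * g.θbar ^ 3

theorem emission_pos : 0 < g.emission :=
  mul_pos (mul_pos (by norm_num) g.σt_pos) (pow_pos g.θbar_pos 3)

end GasModel

section System

variable {g : GasModel} {δ : ℝ} {N : ℕ} {T : ℝ} {A : ℝ → E3 → ℝ} {Ainf : ℝ} {B : ℝ → SobolevH N}
  {S₁ : ℝ → VecH (N - 1)} {S₂ S₃ : ℝ → SobolevH (N - 1)}
  {n₀ : SobolevH N} {m₀ : VecH N} {ζ₀ G₀ : SobolevH N}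
  {n : ℝ → SobolevH N} {m : ℝ → VecH N} {ζ G : ℝ → SobolevH N}
  {Dn : ℝ → VecH (N - 1)} {Dm : ℝ → MatH N} {Dζ DG : ℝ → VecH N}

/-- The net exchange `4 σt θbar³ ζ - σa G` between matter and radiation. -/
def exchange (g : GasModel) (ζ G : SobolevH N) : SobolevH N := g.emission • ζ - g.σa • G

theorem memLp_two_of_continuousOn {E : Type*} [NormedAddCommGroup E] {T : ℝ} {u : ℝ → E}
    (hu : ContinuousOn u (Icc 0 T)) : MemLp u 2 (timeMeasure T) :=
  (memLp_top_of_continuousOn hu).mono_exponent le_top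

theorem memLp_smulH {k : ℕ} {u : ℝ → SobolevH k} (c : ℝ) (hu : MemLp u 2 (timeMeasure T)) :
    MemLp (fun τ => c • u τ) 2 (timeMeasure T) := hu.const_smul c

theorem memLp_negH {k : ℕ} {u : ℝ → SobolevH k} (hu : MemLp u 2 (timeMeasure T)) :
    MemLp (fun τ => -u τ) 2 (timeMeasure T) := hu.neg

theorem memLp_subH {k : ℕ} {u v : ℝ → SobolevH k} (hu : MemLp u 2 (timeMeasure T))
    (hv : MemLp v 2 (timeMeasure T)) :
    MemLp (fun τ => u τ - v τ) 2 (timeMeasure T) := hu.sub hv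

theorem pair_fn_zero {k : ℕ} {φ : E3 → ℝ} (h : IsTest φ) : pair (fn (0 : SobolevH k)) φ = 0 := by
  rw [← pairFn_apply h, map_zero]

theorem pair_fn_smul {k : ℕ} (c : ℝ) (u : SobolevH k) {φ : E3 → ℝ} (h : IsTest φ) :
    pair (fn (c • u)) φ = c * pair (fn u) φ := by
  rw [← pairFn_apply h, ← pairFn_apply h, map_smul, smul_eq_mul]

theorem pair_fn_neg {k : ℕ} (u : SobolevH k) {φ : E3 → ℝ} (h : IsTest φ) :
    pair (fn (-u)) φ = -pair (fn u) φ := by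
  rw [← pairFn_apply h, ← pairFn_apply h, map_neg]

theorem pair_fn_sub {k : ℕ} (u v : SobolevH k) {φ : E3 → ℝ} (h : IsTest φ) :
    pair (fn (u - v)) φ = pair (fn u) φ - pair (fn v) φ := by
  rw [← pairFn_apply h, ← pairFn_apply h, ← pairFn_apply h, map_sub]

theorem norm_smulH {k : ℕ} {c : ℝ} (hc : 0 ≤ c) (u : SobolevH k) : ‖c • u‖ = c * ‖u‖ := by
  rw [norm_smul, Real.norm_of_nonneg hc]

theorem pair_exchange (ζ G : SobolevH N) {φ : E3 → ℝ} (h : IsTest φ) :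
    pair (fn (exchange g ζ G)) φ =
      4 * g.σt * g.θbar ^ 3 * pair (fn ζ) φ - g.σa * pair (fn G) φ := by
  rw [exchange, pair_fn_sub _ _ h, pair_fn_smul _ _ h, pair_fn_smul _ _ h, GasModel.emission]

theorem memLp_exchange (hreg : InEnergyClass N T n m ζ G Dn Dm Dζ DG) :
    MemLp (fun τ => exchange g (ζ τ) (G τ)) 2 (timeMeasure T) :=
  memLp_subH (memLp_smulH _ (memLp_two_of_continuousOn hreg.ζ_cont))
    (memLp_smulH _ (memLp_two_of_continuousOn hreg.G_cont))

/-- The mass equation has no dissipation and is an ordinary differential equation in `H^N`. -/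
theorem mass_energy_identity (hreg : InEnergyClass N T n m ζ G Dn Dm Dζ DG)
    (hsol : IsSolution g δ T A S₁ S₂ S₃ n₀ m₀ ζ₀ G₀ n m ζ G Dm Dζ DG) {t : ℝ} (ht : t ∈ Icc 0 T) :
    ‖n t‖ ^ 2 = ‖n 0‖ ^ 2 + 2 * ∫ τ in 0..t, inner ℝ (-divH (Dm τ)) (n τ) := by
  refine sobolev_energy_identity_ode hreg.n_cont (r := fun τ => -divH (Dm τ))
    (memLp_negH (memLp_divH hreg.Dm_memLp)) (fun φ h t ht => ?_) ht
  rw [hsol.mass φ h t ht]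
  refine integral_congr_timeMeasure ?_ le_rfl ht.1 ht.2
  filter_upwards [hreg.Dm_grad] with τ hτ
  rw [sum_pair_eq_neg_pair_divH hτ h, pair_fn_neg _ h]

/-- The energy identity for the components of the momentum; `F` is the power of the source. -/
theorem momentum_energy_identity (hN : 3 ≤ N)
    (hA : ∀ᵐ t ∂timeMeasure T, ∀ᵐ x : E3, A t x = Ainf + fn (B t) x)
    (hB : MemLp B ⊤ (timeMeasure T)) (hS₁ : MemLp S₁ 2 (timeMeasure T))
    (hreg : InEnergyClass N T n m ζ G Dn Dm Dζ DG)
    (hsol : IsSolution g δ T A S₁ S₂ S₃ n₀ m₀ ζ₀ G₀ n m ζ G Dm Dζ DG) (i : Fin 3) :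
    ∃ F : ℝ → ℝ, Integrable F (timeMeasure T) ∧
      (∀ᵐ τ ∂timeMeasure T, |F τ| ≤
        Fintype.card (MultiIndex N) * (‖S₁ τ i‖ * (‖m τ i‖ + ∑ j, ‖Dm τ i j‖))) ∧
      Integrable (fun τ => ∑ j, inner ℝ (flux hN g.μbar g.lambar (g.ρbar * g.Pρ / δ ^ 2)
        (g.Pθ / δ ^ 2) Ainf (B τ) (Dm τ) (n τ) (ζ τ) i j) (Dm τ i j) + F τ) (timeMeasure T) ∧
      ∀ t ∈ Icc 0 T, ‖m t i‖ ^ 2 = ‖m 0 i‖ ^ 2 + 2 * ∫ τ in 0..t,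
        (∑ j, inner ℝ (flux hN g.μbar g.lambar (g.ρbar * g.Pρ / δ ^ 2)
        (g.Pθ / δ ^ 2) Ainf (B τ) (Dm τ) (n τ) (ζ τ) i j) (Dm τ i j) + F τ) := by
  have hcont : ContinuousOn (fun t => m t i) (Icc 0 T) :=
    (PiLp.continuous_apply 2 _ i).comp_continuousOn hreg.m_cont
  obtain ⟨F, h1, h2, h3, h4⟩ := sobolev_energy_identity (by omega : 1 ≤ N) (u := fun t => m t i)
    (Du := fun t => Dm t i) (q := fun j τ => flux hN g.μbar g.lambar (g.ρbar * g.Pρ / δ ^ 2)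
        (g.Pθ / δ ^ 2) Ainf (B τ) (Dm τ) (n τ) (ζ τ) i j) (r := fun _ => 0)
    (S := fun τ => S₁ τ i) hcont (memLp_coord hreg.Dm_memLp i)
    (hreg.Dm_grad.mono fun τ h => h i)
    (fun j => memLp_flux hN _ _ _ _ _ hB hreg.Dm_memLp (memLp_two_of_continuousOn hreg.n_cont)
      (memLp_two_of_continuousOn hreg.ζ_cont) i j)
    (memLp_const 0) (memLp_coord hS₁ i) (fun φ h t ht => by
      rw [hsol.momentum i φ h t ht]
      refine integral_congr_timeMeasure ?_ le_rfl ht.1 ht.2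
      filter_upwards [hA] with τ hτ
      rw [sum_pair_flux hN _ _ _ _ _ _ _ hτ i h, pair_fn_zero h, add_zero])
  simp only [inner_zero_left, add_zero] at h3 h4
  exact ⟨F, h1, h2, h3, h4⟩

/-- The energy identity for the temperature; `F` is the power of the source. -/
theorem temperature_energy_identity (hN : 1 ≤ N) (hS₂ : MemLp S₂ 2 (timeMeasure T))
    (hreg : InEnergyClass N T n m ζ G Dn Dm Dζ DG)
    (hsol : IsSolution g δ T A S₁ S₂ S₃ n₀ m₀ ζ₀ G₀ n m ζ G Dm Dζ DG) :
    ∃ F : ℝ → ℝ, Integrable F (timeMeasure T) ∧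
      (∀ᵐ τ ∂timeMeasure T, |F τ| ≤
        Fintype.card (MultiIndex N) * (‖S₂ τ‖ * (‖ζ τ‖ + ∑ j, ‖Dζ τ j‖))) ∧
      Integrable (fun τ => ∑ j, inner ℝ (-(g.κ / g.heatCap) • Dζ τ j) (Dζ τ j) +
        inner ℝ (-(g.θbar * g.Pθ / g.heatCap) • divH (Dm τ) -
          g.heatCap⁻¹ • exchange g (ζ τ) (G τ)) (ζ τ) + F τ) (timeMeasure T) ∧
      ∀ t ∈ Icc 0 T, ‖ζ t‖ ^ 2 = ‖ζ 0‖ ^ 2 + 2 * ∫ τ in 0..t,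
        (∑ j, inner ℝ (-(g.κ / g.heatCap) • Dζ τ j) (Dζ τ j) +
        inner ℝ (-(g.θbar * g.Pθ / g.heatCap) • divH (Dm τ) -
          g.heatCap⁻¹ • exchange g (ζ τ) (G τ)) (ζ τ) + F τ) := by
  set q : Fin 3 → ℝ → SobolevH N := fun j τ => -(g.κ / g.heatCap) • Dζ τ j with hq
  set r : ℝ → SobolevH N := fun τ => -(g.θbar * g.Pθ / g.heatCap) • divH (Dm τ) -
          g.heatCap⁻¹ • exchange g (ζ τ) (G τ) with hr
  have hqm : ∀ j, MemLp (q j) 2 (timeMeasure T) := fun j =>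
    memLp_smulH _ (memLp_coord hreg.Dζ_memLp j)
  have hrm : MemLp r 2 (timeMeasure T) :=
    memLp_subH (memLp_smulH _ (memLp_divH hreg.Dm_memLp)) (memLp_smulH _ (memLp_exchange hreg))
  have hweak : ∀ φ : E3 → ℝ, IsTest φ → ∀ t ∈ Icc 0 T,
      pair (fn (ζ t)) φ - pair (fn (ζ 0)) φ = ∫ τ in 0..t,
        (∑ j, pair (fn (q j τ)) (partialDeriv j φ) + pair (fn (r τ)) φ + pair (fn (S₂ τ)) φ) := by
    intro φ h t ht
    rw [hsol.temperature φ h t ht]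
    refine integral_congr_timeMeasure ?_ le_rfl ht.1 ht.2
    filter_upwards [hreg.Dm_grad] with τ hτ
    have h1 : ∀ j, pair (fn (q j τ)) (partialDeriv j φ) =
        -(g.κ / g.heatCap) * pair (fn (Dζ τ j)) (partialDeriv j φ) := fun j =>
      pair_fn_smul _ _ (h.partialDeriv j)
    have h2 : pair (fn (r τ)) φ = -(g.θbar * g.Pθ / g.heatCap) * pair (fn (divH (Dm τ))) φ -
        g.heatCap⁻¹ * (4 * g.σt * g.θbar ^ 3 * pair (fn (ζ τ)) φ - g.σa * pair (fn (G τ)) φ) := by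
      rw [← pair_exchange _ _ h, hr, pair_fn_sub _ _ h, pair_fn_smul _ _ h, pair_fn_smul _ _ h]
    rw [sum_pair_eq_neg_pair_divH hτ h, h2, Finset.sum_congr rfl fun j _ => h1 j,
      ← Finset.mul_sum]
    simp only [GasModel.heatCap]
    ring
  exact sobolev_energy_identity hN hreg.ζ_cont hreg.Dζ_memLp hreg.Dζ_grad hqm hrm hS₂ hweak

/-- The energy identity for the radiation, divided by `δ`; `F` is the power of `δ⁻¹ S₃`. -/
theorem radiation_energy_identity (hN : 1 ≤ N) (hδ : 0 < δ) (hS₃ : MemLp S₃ 2 (timeMeasure T))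
    (hreg : InEnergyClass N T n m ζ G Dn Dm Dζ DG)
    (hsol : IsSolution g δ T A S₁ S₂ S₃ n₀ m₀ ζ₀ G₀ n m ζ G Dm Dζ DG) :
    ∃ F : ℝ → ℝ, Integrable F (timeMeasure T) ∧
      (∀ᵐ τ ∂timeMeasure T, |F τ| ≤
        Fintype.card (MultiIndex N) * (δ⁻¹ * ‖S₃ τ‖ * (‖G τ‖ + ∑ j, ‖DG τ j‖))) ∧
      Integrable (fun τ => ∑ j, inner ℝ (-(g.ν / δ) • DG τ j) (DG τ j) +
        inner ℝ (δ⁻¹ • exchange g (ζ τ) (G τ)) (G τ) + F τ) (timeMeasure T) ∧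
      ∀ t ∈ Icc 0 T, ‖G t‖ ^ 2 = ‖G 0‖ ^ 2 + 2 * ∫ τ in 0..t,
        (∑ j, inner ℝ (-(g.ν / δ) • DG τ j) (DG τ j) +
        inner ℝ (δ⁻¹ • exchange g (ζ τ) (G τ)) (G τ) + F τ) := by
  set q : Fin 3 → ℝ → SobolevH N := fun j τ => -(g.ν / δ) • DG τ j with hq
  set r : ℝ → SobolevH N := fun τ => δ⁻¹ • exchange g (ζ τ) (G τ) with hr
  have hqm : ∀ j, MemLp (q j) 2 (timeMeasure T) := fun j =>
    memLp_smulH _ (memLp_coord hreg.DG_memLp j)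
  have hrm : MemLp r 2 (timeMeasure T) := memLp_smulH _ (memLp_exchange hreg)
  have hSm : MemLp (fun τ => δ⁻¹ • S₃ τ) 2 (timeMeasure T) := memLp_smulH _ hS₃
  have hweak : ∀ φ : E3 → ℝ, IsTest φ → ∀ t ∈ Icc 0 T,
      pair (fn (G t)) φ - pair (fn (G 0)) φ = ∫ τ in 0..t,
        (∑ j, pair (fn (q j τ)) (partialDeriv j φ) + pair (fn (r τ)) φ +
          pair (fn (δ⁻¹ • S₃ τ)) φ) := by
    intro φ h t ht
    have h0 := hsol.radiation φ h t ht
    rw [← eq_inv_mul_iff_mul_eq₀ hδ.ne', ← intervalIntegral.integral_const_mul] at h0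
    rw [h0]
    refine intervalIntegral.integral_congr fun τ _ => ?_
    have h1 : ∀ j, pair (fn (q j τ)) (partialDeriv j φ) =
        -(g.ν / δ) * pair (fn (DG τ j)) (partialDeriv j φ) := fun j =>
      pair_fn_smul _ _ (h.partialDeriv j)
    have h2 : pair (fn (r τ)) φ =
        δ⁻¹ * (4 * g.σt * g.θbar ^ 3 * pair (fn (ζ τ)) φ - g.σa * pair (fn (G τ)) φ) := by
      rw [← pair_exchange _ _ h, hr, pair_fn_smul _ _ h]
    simp only [h2, pair_fn_smul _ _ h]
    rw [Finset.sum_congr rfl fun j _ => h1 j, ← Finset.mul_sum]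
    ring
  obtain ⟨F, h1, h2, h3⟩ :=
    sobolev_energy_identity hN hreg.G_cont hreg.DG_memLp hreg.DG_grad hqm hrm hSm hweak
  refine ⟨F, h1, h2.mono fun τ hτ => ?_, h3⟩
  rwa [norm_smulH (inv_pos.2 hδ).le] at hτ

end System

/-! ### The energy balance -/

/-- With the weights of the energy, the pressure terms cancel and the exchange terms combine to a
square. Here `d` is `div m`, `Z = ∇ζ`, `Y = ∇G`, the exchange term is `em • ζ - b • G`, `c` is the
heat capacity and `α = ρbar P_ρ / δ²`. The weight `c / (θ δ²)` of the temperature makes the work of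
`P_θ` cancel, and `b / (em θ δ)` turns the exchange terms of the two equations into multiples of
`⟪em • ζ - b • G, em • ζ⟫` and `-⟪em • ζ - b • G, b • G⟫` with the same factor. -/
theorem balance_algebra {H : Type*} [NormedAddCommGroup H] [InnerProductSpace ℝ H]
    (d n ζ G : H) (Z Y : Fin 3 → H) {c em b θ δ κ ν Pθ α : ℝ} (hc : 0 < c) (hem : 0 < em)
    (hθ : 0 < θ) (hδ : 0 < δ) :
    α * inner ℝ n d + Pθ / δ ^ 2 * inner ℝ ζ d + α * inner ℝ (-d) n +
      c / (θ * δ ^ 2) * (∑ j, inner ℝ (-(κ / c) • Z j) (Z j) +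
        inner ℝ (-(θ * Pθ / c) • d - c⁻¹ • (em • ζ - b • G)) ζ) +
      b / (em * θ * δ) * (∑ j, inner ℝ (-(ν / δ) • Y j) (Y j) +
        inner ℝ (δ⁻¹ • (em • ζ - b • G)) G) =
    -(κ / θ * (δ ^ 2)⁻¹ * ∑ j, ‖Z j‖ ^ 2) - b * ν / (em * θ) * (δ ^ 2)⁻¹ * ∑ j, ‖Y j‖ ^ 2 -
      1 / (em * θ) * (δ ^ 2)⁻¹ * ‖em • ζ - b • G‖ ^ 2 := by
  have hz : ∀ j, inner ℝ (-(κ / c) • Z j) (Z j) = -(κ / c) * ‖Z j‖ ^ 2 := fun j => by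
    rw [real_inner_smul_left, real_inner_self_eq_norm_sq]
  have hy : ∀ j, inner ℝ (-(ν / δ) • Y j) (Y j) = -(ν / δ) * ‖Y j‖ ^ 2 := fun j => by
    rw [real_inner_smul_left, real_inner_self_eq_norm_sq]
  have hR : ‖em • ζ - b • G‖ ^ 2 =
      em * inner ℝ (em • ζ - b • G) ζ - b * inner ℝ (em • ζ - b • G) G := by
    rw [← real_inner_self_eq_norm_sq, inner_sub_right, real_inner_smul_right,
      real_inner_smul_right]
  simp only [hz, hy, ← Finset.mul_sum]
  rw [hR, inner_neg_left, inner_sub_left (-(θ * Pθ / c) • d), real_inner_smul_left d,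
    real_inner_smul_left (em • ζ - b • G) ζ, real_inner_smul_left (em • ζ - b • G) G,
    real_inner_comm n d, real_inner_comm ζ d]
  field_simp
  ring

section System

variable {g : GasModel} {δ : ℝ} {N : ℕ} {T : ℝ} {A : ℝ → E3 → ℝ} {Ainf : ℝ} {B : ℝ → SobolevH N}
  {S₁ : ℝ → VecH (N - 1)} {S₂ S₃ : ℝ → SobolevH (N - 1)}
  {n₀ : SobolevH N} {m₀ : VecH N} {ζ₀ G₀ : SobolevH N}
  {n : ℝ → SobolevH N} {m : ℝ → VecH N} {ζ G : ℝ → SobolevH N}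
  {Dn : ℝ → VecH (N - 1)} {Dm : ℝ → MatH N} {Dζ DG : ℝ → VecH N}

/-- The energy, with the weights that make the pressure and exchange terms cancel. -/
def energy (g : GasModel) (δ : ℝ) (n : SobolevH N) (m : VecH N) (ζ G : SobolevH N) : ℝ :=
  ‖m‖ ^ 2 + g.ρbar * g.Pρ / δ ^ 2 * ‖n‖ ^ 2 + g.heatCap / (g.θbar * δ ^ 2) * ‖ζ‖ ^ 2 +
    g.σa / (g.emission * g.θbar * δ) * ‖G‖ ^ 2

/-- Half the time derivative of the energy; `F₁, F₂, F₃` are the powers of the sources. -/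
def energyRate (g : GasModel) (δ : ℝ) (hN : 3 ≤ N) (c : ℝ) (B : SobolevH N) (M : MatH N)
    (ζ G : SobolevH N) (Dζ DG : VecH N) (F₁ : Fin 3 → ℝ) (F₂ F₃ : ℝ) : ℝ :=
  -g.μbar * (∑ i, ∑ j, inner ℝ (coefMul hN c B (M i j)) (M i j))
    - (g.lambar + g.μbar) * inner ℝ (coefMul hN c B (divH M)) (divH M) + ∑ i, F₁ i
    + (-(g.κ / g.θbar * (δ ^ 2)⁻¹ * ∑ j, ‖Dζ j‖ ^ 2)
      - g.σa * g.ν / (g.emission * g.θbar) * (δ ^ 2)⁻¹ * ∑ j, ‖DG j‖ ^ 2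
      - 1 / (g.emission * g.θbar) * (δ ^ 2)⁻¹ * ‖exchange g ζ G‖ ^ 2)
    + g.heatCap / (g.θbar * δ ^ 2) * F₂ + g.σa / (g.emission * g.θbar * δ) * F₃

theorem integrable_inner_of_memLp {H : Type*} [NormedAddCommGroup H] [InnerProductSpace ℝ H]
    {u v : ℝ → H} (hu : MemLp u 2 (timeMeasure T)) (hv : MemLp v 2 (timeMeasure T)) :
    Integrable (fun τ => inner ℝ (u τ) (v τ)) (timeMeasure T) :=
  integrable_clm_apply (memLp_clm_comp (innerSL ℝ) hu) hv

/-- The energy rate is the weighted sum of the right hand sides of the energy identities; the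
pressure terms have cancelled. -/
theorem energyRate_eq (hδ : 0 < δ) (hN : 3 ≤ N) (c : ℝ) (B : SobolevH N) (M : MatH N)
    (n ζ G : SobolevH N) (Dζ DG : VecH N) (F₁ : Fin 3 → ℝ) (F₂ F₃ : ℝ) :
    energyRate g δ hN c B M ζ G Dζ DG F₁ F₂ F₃ =
      (∑ i, (∑ j, inner ℝ (flux hN g.μbar g.lambar (g.ρbar * g.Pρ / δ ^ 2)
        (g.Pθ / δ ^ 2) c B M n ζ i j) (M i j) + F₁ i)) +
      g.ρbar * g.Pρ / δ ^ 2 * inner ℝ (-divH M) n +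
      g.heatCap / (g.θbar * δ ^ 2) * (∑ j, inner ℝ (-(g.κ / g.heatCap) • Dζ j) (Dζ j) +
        inner ℝ (-(g.θbar * g.Pθ / g.heatCap) • divH M - g.heatCap⁻¹ • exchange g ζ G) ζ + F₂) +
      g.σa / (g.emission * g.θbar * δ) * (∑ j, inner ℝ (-(g.ν / δ) • DG j) (DG j) +
        inner ℝ (δ⁻¹ • exchange g ζ G) G + F₃) := by
  have h := balance_algebra (divH M) n ζ G (fun j => Dζ j) (fun j => DG j) (b := g.σa) (κ := g.κ)
    (ν := g.ν) (Pθ := g.Pθ) (α := g.ρbar * g.Pρ / δ ^ 2) g.heatCap_pos g.emission_pos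
    g.θbar_pos hδ
  rw [Finset.sum_add_distrib, sum_inner_flux]
  unfold energyRate
  change _ = -(g.κ / g.θbar * (δ ^ 2)⁻¹ * ∑ j, ‖Dζ j‖ ^ 2)
      - g.σa * g.ν / (g.emission * g.θbar) * (δ ^ 2)⁻¹ * ∑ j, ‖DG j‖ ^ 2
      - 1 / (g.emission * g.θbar) * (δ ^ 2)⁻¹ * ‖exchange g ζ G‖ ^ 2 at h
  rw [← h]
  unfold exchange
  ring

theorem integral_combination {I : Fin 3 → ℝ → ℝ} {J K L : ℝ → ℝ}
    (hI : ∀ i, Integrable (I i) (timeMeasure T)) (hJ : Integrable J (timeMeasure T))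
    (hK : Integrable K (timeMeasure T)) (hL : Integrable L (timeMeasure T)) (a b c : ℝ) :
    Integrable (fun τ => ∑ i, I i τ + a * J τ + b * K τ + c * L τ) (timeMeasure T) ∧
      ∀ t ∈ Icc 0 T, ∫ τ in 0..t, (∑ i, I i τ + a * J τ + b * K τ + c * L τ) =
        ∑ i, (∫ τ in 0..t, I i τ) + a * (∫ τ in 0..t, J τ) + b * (∫ τ in 0..t, K τ) +
          c * ∫ τ in 0..t, L τ := by
  have hI' := integrable_finsetSum Finset.univ fun i _ => hI i
  have h1 : Integrable (fun τ => ∑ i, I i τ + a * J τ) (timeMeasure T) := hI'.add (hJ.const_mul a)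
  have h2 : Integrable (fun τ => ∑ i, I i τ + a * J τ + b * K τ) (timeMeasure T) :=
    h1.add (hK.const_mul b)
  refine ⟨h2.add (hL.const_mul c), fun t ht => ?_⟩
  have hi : ∀ {f : ℝ → ℝ}, Integrable f (timeMeasure T) → IntervalIntegrable f volume 0 t :=
    fun hf => intervalIntegrable_of_timeMeasure hf le_rfl ht.1 ht.2
  rw [intervalIntegral.integral_add (hi h2) (hi (hL.const_mul c)),
    intervalIntegral.integral_add (hi h1) (hi (hK.const_mul b)),
    intervalIntegral.integral_add (hi hI') (hi (hJ.const_mul a)),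
    intervalIntegral.integral_finsetSum fun i _ => hi (hI i),
    intervalIntegral.integral_const_mul, intervalIntegral.integral_const_mul,
    intervalIntegral.integral_const_mul]

/-- The energy balance: the energy is the integral of twice its rate. The powers of the sources
are functions `F₁, F₂, F₃` of time, bounded by the norms of the sources in `H^{N-1}`. -/
theorem exists_energy_balance (hN : 3 ≤ N) (hδ : 0 < δ)
    (hA : ∀ᵐ t ∂timeMeasure T, ∀ᵐ x : E3, A t x = Ainf + fn (B t) x)
    (hB : MemLp B ⊤ (timeMeasure T)) (hS₁ : MemLp S₁ 2 (timeMeasure T))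
    (hS₂ : MemLp S₂ 2 (timeMeasure T)) (hS₃ : MemLp S₃ 2 (timeMeasure T))
    (hreg : InEnergyClass N T n m ζ G Dn Dm Dζ DG)
    (hsol : IsSolution g δ T A S₁ S₂ S₃ n₀ m₀ ζ₀ G₀ n m ζ G Dm Dζ DG) :
    ∃ (F₁ : Fin 3 → ℝ → ℝ) (F₂ F₃ : ℝ → ℝ),
      (∀ i, ∀ᵐ τ ∂timeMeasure T, |F₁ i τ| ≤
        Fintype.card (MultiIndex N) * (‖S₁ τ i‖ * (‖m τ i‖ + ∑ j, ‖Dm τ i j‖))) ∧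
      (∀ᵐ τ ∂timeMeasure T, |F₂ τ| ≤
        Fintype.card (MultiIndex N) * (‖S₂ τ‖ * (‖ζ τ‖ + ∑ j, ‖Dζ τ j‖))) ∧
      (∀ᵐ τ ∂timeMeasure T, |F₃ τ| ≤
        Fintype.card (MultiIndex N) * (δ⁻¹ * ‖S₃ τ‖ * (‖G τ‖ + ∑ j, ‖DG τ j‖))) ∧
      Integrable (fun τ => energyRate g δ hN Ainf (B τ) (Dm τ) (ζ τ) (G τ) (Dζ τ) (DG τ)
        (fun i => F₁ i τ) (F₂ τ) (F₃ τ)) (timeMeasure T) ∧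
      ∀ t ∈ Icc 0 T, energy g δ (n t) (m t) (ζ t) (G t) =
        energy g δ (n 0) (m 0) (ζ 0) (G 0) + 2 * ∫ τ in 0..t,
          energyRate g δ hN Ainf (B τ) (Dm τ) (ζ τ) (G τ) (Dζ τ) (DG τ)
            (fun i => F₁ i τ) (F₂ τ) (F₃ τ) := by
  choose F₁ _ hF₁ hI₁ hE₁ using momentum_energy_identity hN hA hB hS₁ hreg hsol
  obtain ⟨F₂, _, hF₂, hI₂, hE₂⟩ := temperature_energy_identity (by omega) hS₂ hreg hsol
  obtain ⟨F₃, _, hF₃, hI₃, hE₃⟩ := radiation_energy_identity (by omega) hδ hS₃ hreg hsol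
  have hI₀ : Integrable (fun τ => inner ℝ (-divH (Dm τ)) (n τ)) (timeMeasure T) :=
    integrable_inner_of_memLp (memLp_negH (memLp_divH hreg.Dm_memLp))
      (memLp_two_of_continuousOn hreg.n_cont)
  have hpoint : (fun τ => energyRate g δ hN Ainf (B τ) (Dm τ) (ζ τ) (G τ) (Dζ τ) (DG τ)
      (fun i => F₁ i τ) (F₂ τ) (F₃ τ)) = _ :=
    funext fun τ => energyRate_eq hδ hN Ainf (B τ) (Dm τ) (n τ) (ζ τ) (G τ) (Dζ τ) (DG τ)
      (fun i => F₁ i τ) (F₂ τ) (F₃ τ)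
  obtain ⟨hint, hcomb⟩ := integral_combination hI₁ hI₀ hI₂ hI₃ (g.ρbar * g.Pρ / δ ^ 2)
    (g.heatCap / (g.θbar * δ ^ 2)) (g.σa / (g.emission * g.θbar * δ))
  refine ⟨F₁, F₂, F₃, hF₁, hF₂, hF₃, ?_, fun t ht => ?_⟩
  · rw [hpoint]
    exact hint
  · have e : ∫ τ in 0..t, energyRate g δ hN Ainf (B τ) (Dm τ) (ζ τ) (G τ) (Dζ τ) (DG τ)
      (fun i => F₁ i τ) (F₂ τ) (F₃ τ) = _ :=
      (congrArg (fun f : ℝ → ℝ => ∫ τ in 0..t, f τ) hpoint).trans (hcomb t ht)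
    rw [e]
    simp only [energy, PiLp.norm_sq_eq_of_L2, hE₁ _ t ht, hE₂ t ht, hE₃ t ht,
      mass_energy_identity hreg hsol ht, Finset.sum_add_distrib, ← Finset.mul_sum]
    ring

end System

/-! ### Coercivity and Young's inequality -/

/-- The triangle inequality for `lowNorm`. -/
theorem lowNorm_sum_le {N : ℕ} (v : Fin 3 → SobolevH N) :
    lowNorm (∑ j, v j) ≤ ∑ j, lowNorm (v j) := by
  unfold lowNorm
  rw [Finset.sum_comm]
  refine Finset.sum_le_sum fun α _ => ?_
  rw [map_sum]
  exact norm_sum_le _ _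

/-- The real-variable part of the energy estimate: `b` stands for `‖B‖`, the letters `m, X, z, Z,
y, Y, R` for the norms of `m, ∇m, ζ, ∇ζ, G, ∇G` and of the exchange term (the last five divided by
`δ`), and `s₁, s₂, s₃` for those of the sources. -/
theorem young_energy {k C : ℝ} (hk : 0 < k) (hC : 0 ≤ C) {b m X s₁ z Z s₂ y Y R s₃ : ℝ}
    (hs₃ : 0 ≤ s₃) (hy : y ≤ C * (z + R)) :
    -(k * X ^ 2) + C * (b * m * X) + C * (s₁ * (m + X)) +
      (-(k * Z ^ 2) - k * Y ^ 2 - k * R ^ 2 + C * (s₂ * (z + Z)) + C * (s₃ * (y + Y))) ≤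
    -(k / 2 * (X ^ 2 + (Z ^ 2 + Y ^ 2 + R ^ 2))) +
      2 * (C ^ 2 / k + C + C ^ 4 / k + C ^ 2) *
        ((1 + b ^ 2) * (m ^ 2 + z ^ 2) + (s₁ ^ 2 + s₂ ^ 2 + s₃ ^ 2)) := by
  have young : ∀ c p q : ℝ, c * (p * q) ≤ k / 4 * q ^ 2 + c ^ 2 / k * p ^ 2 := by
    intro c p q
    have h : k / 4 * q ^ 2 + c ^ 2 / k * p ^ 2 - c * (p * q) = (k * q / 2 - c * p) ^ 2 / k := by
      field_simp
      ring
    have := div_nonneg (sq_nonneg (k * q / 2 - c * p)) hk.le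
    linarith
  have h1 := young C (b * m) X
  have h2 := young C s₁ X
  have h3 := young C s₂ Z
  have h4 := young C s₃ Y
  have h5 := young (C ^ 2) s₃ R
  have h6 : C * (s₁ * m) ≤ C * (s₁ ^ 2 + m ^ 2) := by
    refine mul_le_mul_of_nonneg_left ?_ hC
    nlinarith [sq_nonneg (s₁ - m), sq_nonneg (s₁ + m)]
  have h7 : C * (s₂ * z) ≤ C * (s₂ ^ 2 + z ^ 2) := by
    refine mul_le_mul_of_nonneg_left ?_ hC
    nlinarith [sq_nonneg (s₂ - z), sq_nonneg (s₂ + z)]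
  have h8 : C ^ 2 * (s₃ * z) ≤ C ^ 2 * (s₃ ^ 2 + z ^ 2) := by
    refine mul_le_mul_of_nonneg_left ?_ (sq_nonneg C)
    nlinarith [sq_nonneg (s₃ - z), sq_nonneg (s₃ + z)]
  have h9 : C * (s₃ * y) ≤ C * (s₃ * (C * (z + R))) := by gcongr
  have hA : 0 ≤ C ^ 2 / k := by positivity
  have hB : (C ^ 2) ^ 2 / k = C ^ 4 / k := by ring
  have hD : 0 ≤ C ^ 4 / k := by positivity
  have hE := sq_nonneg C
  set P := C ^ 2 / k
  set Q := C ^ 4 / k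
  rw [hB] at h5
  have hbm : (b * m) ^ 2 = b ^ 2 * m ^ 2 := by ring
  rw [hbm] at h1
  have e1 := mul_nonneg hA (sq_nonneg m)
  have e : ∀ p q : ℝ, 0 ≤ p → 0 ≤ q ^ 2 → 0 ≤ p * q ^ 2 := fun p q h h' => mul_nonneg h h'
  have pos : ∀ p, 0 ≤ p → 0 ≤ p * m ^ 2 ∧ 0 ≤ p * z ^ 2 ∧ 0 ≤ p * s₁ ^ 2 ∧ 0 ≤ p * s₂ ^ 2 ∧
      0 ≤ p * s₃ ^ 2 ∧ 0 ≤ p * (b ^ 2 * m ^ 2) ∧ 0 ≤ p * (b ^ 2 * z ^ 2) := by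
    intro p hp
    refine ⟨?_, ?_, ?_, ?_, ?_, ?_, ?_⟩ <;> positivity
  obtain ⟨a1, a2, a3, a4, a5, a6, a7⟩ := pos P hA
  obtain ⟨b1, b2, b3, b4, b5, b6, b7⟩ := pos C hC
  obtain ⟨c1, c2, c3, c4, c5, c6, c7⟩ := pos Q hD
  obtain ⟨d1, d2, d3, d4, d5, d6, d7⟩ := pos (C ^ 2) hE
  have hX := mul_nonneg hk.le (sq_nonneg X)
  have hZ := mul_nonneg hk.le (sq_nonneg Z)
  have hY := mul_nonneg hk.le (sq_nonneg Y)
  have hR := mul_nonneg hk.le (sq_nonneg R)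
  linarith

section System

variable {g : GasModel} {N : ℕ}

theorem norm_coord_le {X : Type*} [NormedAddCommGroup X] (v : PiLp 2 (fun _ : Fin 3 => X))
    (j : Fin 3) : ‖v j‖ ≤ ‖v‖ := PiLp.norm_apply_le v j

theorem sum_norm_coord_le {X : Type*} [NormedAddCommGroup X] (v : PiLp 2 (fun _ : Fin 3 => X)) :
    ∑ j, ‖v j‖ ≤ 3 * ‖v‖ := by
  refine (Finset.sum_le_sum fun j _ => norm_coord_le v j).trans ?_
  simp

theorem norm_divH_le (M : MatH N) : ‖divH M‖ ≤ 3 * ‖M‖ := by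
  refine (norm_sum_le _ _).trans ((Finset.sum_le_sum fun j _ =>
    (norm_coord_le (M j) j).trans (norm_coord_le M j)).trans ?_)
  simp

/-- The constant in the lower order term of the coercivity estimate. -/
def coercConst (hN : 3 ≤ N) : ℝ :=
  9 * (Fintype.card (MultiIndex N) * commConst hN * Fintype.card (MultiIndex (N - 1)))

theorem coercConst_nonneg (hN : 3 ≤ N) : 0 ≤ coercConst hN := by
  have := (commConst_pos hN).le
  unfold coercConst
  positivity

/-- The viscous terms are coercive up to `‖B‖ ‖m‖ ‖∇m‖`: the commutators see `∇m` only up to order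
`N - 1`, that is, `m` up to order `N`. -/
theorem viscous_ge (hN : 3 ≤ N) {c M₀ : ℝ} {B : SobolevH N} (hM₀ : 0 ≤ M₀)
    (hA : ∀ᵐ x, M₀ ≤ c + fn B x) {m : VecH N} {M : MatH N} (hM : ∀ i, IsGradient (m i) (M i)) :
    M₀ * ‖M‖ ^ 2 - coercConst hN * (‖B‖ * ‖m‖ * ‖M‖) ≤
        ∑ i, ∑ j, inner ℝ (coefMul hN c B (M i j)) (M i j) ∧
      -(coercConst hN * (‖B‖ * ‖m‖ * ‖M‖)) ≤ inner ℝ (coefMul hN c B (divH M)) (divH M) := by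
  set a : ℝ := (Fintype.card (MultiIndex N) : ℝ) * commConst hN with ha
  set L : ℝ := (Fintype.card (MultiIndex (N - 1)) : ℝ) with hL
  have ha0 : 0 ≤ a := mul_nonneg (Nat.cast_nonneg _) (commConst_pos hN).le
  have hL0 : 0 ≤ L := Nat.cast_nonneg _
  have hconst : coercConst hN = 9 * (a * L) := rfl
  have hcoer : ∀ v, M₀ * ‖v‖ ^ 2 - a * (‖B‖ * lowNorm v * ‖v‖) ≤
      inner ℝ (coefMul hN c B v) v := fun v => inner_coefficient_mul_ge hN hA v
  have hlow : ∀ i j, lowNorm (M i j) ≤ L * ‖m‖ := fun i j =>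
    ((hM i).lowNorm_le (by omega) j).trans
      (mul_le_mul_of_nonneg_left (norm_coord_le m i) hL0)
  have hMij : ∀ i j, ‖M i j‖ ≤ ‖M‖ := fun i j => (norm_coord_le (M i) j).trans (norm_coord_le M i)
  refine ⟨?_, ?_⟩
  · have h1 : ∀ i j, M₀ * ‖M i j‖ ^ 2 - a * (‖B‖ * (L * ‖m‖) * ‖M‖) ≤
        inner ℝ (coefMul hN c B (M i j)) (M i j) := by
      intro i j
      have h2 := hcoer (M i j)
      have h3 : a * (‖B‖ * lowNorm (M i j) * ‖M i j‖) ≤ a * (‖B‖ * (L * ‖m‖) * ‖M‖) := by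
        have := hlow i j
        have := hMij i j
        have := lowNorm_nonneg (M i j)
        gcongr
      linarith
    have h2 := Finset.sum_le_sum fun i (_ : i ∈ Finset.univ) =>
      Finset.sum_le_sum fun j (_ : j ∈ Finset.univ) => h1 i j
    refine le_trans (le_of_eq ?_) h2
    have h3 : ‖M‖ ^ 2 = ∑ i, ∑ j, ‖M i j‖ ^ 2 := by
      rw [PiLp.norm_sq_eq_of_L2]
      exact Finset.sum_congr rfl fun i _ => PiLp.norm_sq_eq_of_L2 _ _
    rw [h3, hconst]
    simp only [Finset.sum_sub_distrib, ← Finset.mul_sum, Finset.sum_const, Finset.card_univ,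
      Fintype.card_fin, nsmul_eq_mul]
    ring
  · have h2 := hcoer (divH M)
    have h3 : lowNorm (divH M) ≤ 3 * (L * ‖m‖) := by
      refine (lowNorm_sum_le _).trans ((Finset.sum_le_sum fun j _ => hlow j j).trans ?_)
      simp
    have h4 := norm_divH_le M
    have h5 : a * (‖B‖ * lowNorm (divH M) * ‖divH M‖) ≤
        a * (‖B‖ * (3 * (L * ‖m‖)) * (3 * ‖M‖)) := by
      have := lowNorm_nonneg (divH M)
      gcongr
    have h6 : 0 ≤ M₀ * ‖divH M‖ ^ 2 := by positivity
    rw [hconst]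
    linarith

/-- `G` is controlled by `ζ` and the exchange term, without negative powers of `δ`. -/
theorem norm_radiation_le (ζ G : SobolevH N) :
    ‖G‖ ≤ g.σa⁻¹ * (g.emission * ‖ζ‖ + ‖exchange g ζ G‖) := by
  have hb := g.σa_pos
  have h1 : g.σa • G = g.emission • ζ - exchange g ζ G := by
    unfold exchange
    abel
  have h2 := norm_sub_le (g.emission • ζ) (exchange g ζ G)
  rw [← h1, norm_smulH hb.le, norm_smulH g.emission_pos.le] at h2
  rwa [← div_eq_inv_mul, le_div_iff₀ hb, mul_comm]

end System

/-! ### The energy rate -/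

section System

variable {g : GasModel} {N : ℕ}

/-- The powers of the three components of the momentum source together. -/
theorem sum_source_le {S m : Fin 3 → ℝ} {X : Fin 3 → Fin 3 → ℝ} {F : Fin 3 → ℝ}
    {a s μ x : ℝ} (ha : 0 ≤ a) (hs : 0 ≤ s) (hμ : 0 ≤ μ)
    (hS0 : ∀ i, 0 ≤ S i) (hS : ∀ i, S i ≤ s) (hm : ∀ i, m i ≤ μ) (hX : ∀ i j, X i j ≤ x)
    (hx : 0 ≤ x)
    (hF : ∀ i, |F i| ≤ a * (S i * (m i + ∑ j, X i j))) : ∑ i, F i ≤ 9 * a * (s * (μ + x)) := by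
  have h1 : ∀ i, F i ≤ a * (s * (μ + 3 * x)) := by
    intro i
    refine (le_abs_self _).trans ((hF i).trans (mul_le_mul_of_nonneg_left ?_ ha))
    have h2 : ∑ j, X i j ≤ 3 * x := (Finset.sum_le_sum fun j _ => hX i j).trans (by simp)
    have h3 : m i + ∑ j, X i j ≤ μ + 3 * x := add_le_add (hm i) h2
    exact (mul_le_mul_of_nonneg_left h3 (hS0 i)).trans
      (mul_le_mul_of_nonneg_right (hS i) (by positivity))
  refine (Finset.sum_le_sum fun i _ => h1 i).trans ?_
  simp only [Finset.sum_const, Finset.card_univ, Fintype.card_fin, nsmul_eq_mul]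
  push_cast
  nlinarith [mul_nonneg ha (mul_nonneg hs hμ), mul_nonneg ha (mul_nonneg hs hx)]

/-- The energy rate is at most minus the dissipation, up to a multiple of the energy with the
integrable factor `1 + ‖B‖²` and the size of the sources. The constants do not depend on `δ`, since
every term is homogeneous in the rescaled norms `δ⁻¹ ‖ζ‖`, `δ⁻¹ ‖∇ζ‖`, and so on. -/
theorem exists_energyRate_le (g : GasModel) (hN : 3 ≤ N) {M₀ : ℝ} (hM₀ : 0 < M₀) :
    ∃ k K : ℝ, 0 < k ∧ 0 < K ∧ ∀ {δ : ℝ}, 0 < δ → ∀ {c : ℝ} {B : SobolevH N} {m : VecH N}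
      {M : MatH N} {ζ G : SobolevH N} {Dζ DG : VecH N}
      {S₁ : VecH (N - 1)} {S₂ S₃ : SobolevH (N - 1)}
      {F₁ : Fin 3 → ℝ} {F₂ F₃ : ℝ}, (∀ᵐ x, M₀ ≤ c + fn B x) → (∀ i, IsGradient (m i) (M i)) →
      (∀ i, |F₁ i| ≤ Fintype.card (MultiIndex N) * (‖S₁ i‖ * (‖m i‖ + ∑ j, ‖M i j‖))) →
      |F₂| ≤ Fintype.card (MultiIndex N) * (‖S₂‖ * (‖ζ‖ + ∑ j, ‖Dζ j‖)) →
      |F₃| ≤ Fintype.card (MultiIndex N) * (δ⁻¹ * ‖S₃‖ * (‖G‖ + ∑ j, ‖DG j‖)) →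
      energyRate g δ hN c B M ζ G Dζ DG F₁ F₂ F₃ ≤
        -(k * (‖M‖ ^ 2 + (δ ^ 2)⁻¹ * (‖Dζ‖ ^ 2 + ‖DG‖ ^ 2 + ‖exchange g ζ G‖ ^ 2))) +
        K * ((1 + ‖B‖ ^ 2) * (‖m‖ ^ 2 + (δ ^ 2)⁻¹ * ‖ζ‖ ^ 2) +
          (‖S₁‖ ^ 2 + (δ ^ 2)⁻¹ * (‖S₂‖ ^ 2 + ‖S₃‖ ^ 2))) := by
  have hμ := g.μbar_pos
  have hl := g.lambar_add_μbar_nonneg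
  have hem := g.emission_pos
  have hθ := g.θbar_pos
  have hb := g.σa_pos
  have hc := g.heatCap_pos
  have hκ := g.κ_pos
  have hν := g.ν_pos
  set a : ℝ := (Fintype.card (MultiIndex N) : ℝ) with ha
  have ha0 : 0 ≤ a := Nat.cast_nonneg _
  set k₀ : ℝ := g.μbar * M₀ with hk₀
  set k₁ : ℝ := g.κ / g.θbar with hk₁
  set k₂ : ℝ := g.σa * g.ν / (g.emission * g.θbar) with hk₂
  set k₃ : ℝ := 1 / (g.emission * g.θbar) with hk₃
  have p0 : 0 < k₀ := mul_pos hμ hM₀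
  have p1 : 0 < k₁ := div_pos hκ hθ
  have p2 : 0 < k₂ := div_pos (mul_pos hb hν) (mul_pos hem hθ)
  have p3 : 0 < k₃ := div_pos one_pos (mul_pos hem hθ)
  set k := min (min k₀ k₁) (min k₂ k₃) with hk
  have hkp : 0 < k := lt_min (lt_min p0 p1) (lt_min p2 p3)
  have l0 : k ≤ k₀ := (min_le_left _ _).trans (min_le_left _ _)
  have l1 : k ≤ k₁ := (min_le_left _ _).trans (min_le_right _ _)
  have l2 : k ≤ k₂ := (min_le_right _ _).trans (min_le_left _ _)
  have l3 : k ≤ k₃ := (min_le_right _ _).trans (min_le_right _ _)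
  set C₀ : ℝ := (g.lambar + g.μbar + g.μbar) * coercConst hN with hC₀
  set C₂ : ℝ := g.heatCap / g.θbar * (9 * a) with hC₂
  set C₃ : ℝ := g.σa / (g.emission * g.θbar) * (9 * a) with hC₃
  set C₄ : ℝ := g.σa⁻¹ * g.emission with hC₄
  have q0 : 0 ≤ C₀ := mul_nonneg (by linarith) (coercConst_nonneg hN)
  have q2 : 0 ≤ C₂ := by positivity
  have q3 : 0 ≤ C₃ := by positivity
  have q4 : 0 < C₄ := by positivity
  have q5 : 0 < g.σa⁻¹ := by positivity
  set C : ℝ := C₀ + 9 * a + C₂ + C₃ + C₄ + g.σa⁻¹ with hC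
  have hCp : 0 < C := by positivity
  refine ⟨k / 2, 2 * (C ^ 2 / k + C + C ^ 4 / k + C ^ 2), by positivity, by positivity, ?_⟩
  intro δ hδ c B m M ζ G Dζ DG S₁ S₂ S₃ F₁ F₂ F₃ hA hM hF₁ hF₂ hF₃
  obtain ⟨v1, v2⟩ := viscous_ge hN hM₀.le hA hM
  have hG := norm_radiation_le (g := g) ζ G
  have hs1 : ∑ i, F₁ i ≤ 9 * a * (‖S₁‖ * (‖m‖ + ‖M‖)) :=
    sum_source_le ha0 (norm_nonneg _) (norm_nonneg _) (fun i => norm_nonneg (S₁ i))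
      (norm_coord_le S₁) (norm_coord_le m)
      (fun i j => (norm_coord_le (M i) j).trans (norm_coord_le M i)) (norm_nonneg _) hF₁
  have hZ : ∑ j, ‖Dζ j‖ ^ 2 = ‖Dζ‖ ^ 2 := (PiLp.norm_sq_eq_of_L2 _ _).symm
  have hY : ∑ j, ‖DG j‖ ^ 2 = ‖DG‖ ^ 2 := (PiLp.norm_sq_eq_of_L2 _ _).symm
  have hZ1 := sum_norm_coord_le Dζ
  have hY1 := sum_norm_coord_le DG
  unfold energyRate
  rw [hZ, hY, ← hk₁, ← hk₂, ← hk₃]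
  -- from here on only the norms matter
  have n0 := norm_nonneg (exchange g ζ G)
  generalize ‖exchange g ζ G‖ = R at *
  generalize (∑ i, ∑ j, inner ℝ (coefMul hN c B (M i j)) (M i j)) = I₁ at *
  generalize inner ℝ (coefMul hN c B (divH M)) (divH M) = I₂ at *
  generalize (∑ i, F₁ i) = f₁ at *
  generalize (∑ j, ‖Dζ j‖) = z₁ at *
  generalize (∑ j, ‖DG j‖) = y₁ at *
  have n1 := norm_nonneg M
  have n2 := norm_nonneg m
  have n3 := norm_nonneg B
  have n4 := norm_nonneg S₁
  have n5 := norm_nonneg S₂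
  have n6 := norm_nonneg S₃
  have n7 := norm_nonneg ζ
  have n8 := norm_nonneg G
  have n9 := norm_nonneg Dζ
  have n10 := norm_nonneg DG
  generalize ‖M‖ = X at *
  generalize ‖m‖ = μ at *
  generalize ‖B‖ = b at *
  generalize ‖S₁‖ = s₁ at *
  generalize ‖S₂‖ = s₂ at *
  generalize ‖S₃‖ = s₃ at *
  generalize ‖ζ‖ = z at *
  generalize ‖G‖ = y at *
  generalize ‖Dζ‖ = Z at *
  generalize ‖DG‖ = Y at *
  have hd : 0 < δ⁻¹ := inv_pos.2 hδ
  have e1 : (δ ^ 2)⁻¹ = δ⁻¹ ^ 2 := (inv_pow δ 2).symm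
  have e2 : g.heatCap / (g.θbar * δ ^ 2) = g.heatCap / g.θbar * δ⁻¹ ^ 2 := by
    field_simp
  have e3 : g.σa / (g.emission * g.θbar * δ) = g.σa / (g.emission * g.θbar) * δ⁻¹ := by
    field_simp
  rw [e1, e2, e3]
  generalize δ⁻¹ = d at *
  have hCC₀ : C₀ ≤ C := by linarith
  have hCa : 9 * a ≤ C := by linarith
  have hCC₂ : C₂ ≤ C := by linarith
  have hCC₃ : C₃ ≤ C := by linarith
  have hCC₄ : C₄ ≤ C := by linarith
  have hCb : g.σa⁻¹ ≤ C := by linarith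
  have t1 : -g.μbar * I₁ - (g.lambar + g.μbar) * I₂ ≤ -(k * X ^ 2) + C * (b * μ * X) := by
    have h1 := mul_le_mul_of_nonneg_left v1 hμ.le
    have h2 := mul_le_mul_of_nonneg_left v2 hl
    have h3 := mul_le_mul_of_nonneg_right hCC₀ (by positivity : 0 ≤ b * μ * X)
    have h4 := mul_le_mul_of_nonneg_right l0 (sq_nonneg X)
    have h5 : k₀ * X ^ 2 = g.μbar * (M₀ * X ^ 2) := by rw [hk₀]; ring
    have h6 : C₀ * (b * μ * X) = g.μbar * (coercConst hN * (b * μ * X)) +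
        (g.lambar + g.μbar) * (coercConst hN * (b * μ * X)) := by rw [hC₀]; ring
    linarith
  have t2 : f₁ ≤ C * (s₁ * (μ + X)) :=
    hs1.trans (mul_le_mul_of_nonneg_right hCa (by positivity))
  have t3 : g.heatCap / g.θbar * d ^ 2 * F₂ ≤ C * (d * s₂ * (d * z + d * Z)) := by
    have h1 : F₂ ≤ a * (s₂ * (9 * (z + Z))) := (le_abs_self _).trans (hF₂.trans (by
      gcongr
      linarith))
    have h2 := mul_le_mul_of_nonneg_left h1 (by positivity : 0 ≤ g.heatCap / g.θbar * d ^ 2)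
    have h3 := mul_le_mul_of_nonneg_right hCC₂ (by positivity : 0 ≤ d * s₂ * (d * z + d * Z))
    have h4 : g.heatCap / g.θbar * d ^ 2 * (a * (s₂ * (9 * (z + Z)))) =
        C₂ * (d * s₂ * (d * z + d * Z)) := by rw [hC₂]; ring
    linarith
  have t4 : g.σa / (g.emission * g.θbar) * d * F₃ ≤ C * (d * s₃ * (d * y + d * Y)) := by
    have h1 : F₃ ≤ a * (d * s₃ * (9 * (y + Y))) := (le_abs_self _).trans (hF₃.trans (by
      gcongr
      linarith))
    have h2 := mul_le_mul_of_nonneg_left h1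
      (by positivity : 0 ≤ g.σa / (g.emission * g.θbar) * d)
    have h3 := mul_le_mul_of_nonneg_right hCC₃ (by positivity : 0 ≤ d * s₃ * (d * y + d * Y))
    have h4 : g.σa / (g.emission * g.θbar) * d * (a * (d * s₃ * (9 * (y + Y)))) =
        C₃ * (d * s₃ * (d * y + d * Y)) := by rw [hC₃]; ring
    linarith
  have t5 : k * (d * Z) ^ 2 ≤ k₁ * d ^ 2 * Z ^ 2 := by
    have := mul_le_mul_of_nonneg_right l1 (sq_nonneg (d * Z))
    linarith
  have t6 : k * (d * Y) ^ 2 ≤ k₂ * d ^ 2 * Y ^ 2 := by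
    have := mul_le_mul_of_nonneg_right l2 (sq_nonneg (d * Y))
    linarith
  have t7 : k * (d * R) ^ 2 ≤ k₃ * d ^ 2 * R ^ 2 := by
    have := mul_le_mul_of_nonneg_right l3 (sq_nonneg (d * R))
    linarith
  -- `δ⁻¹ ‖G‖` is not controlled by the energy, which contains `δ^{-1/2} ‖G‖` only; the exchange term
  -- of the dissipation makes up for it
  have t8 : d * y ≤ C * (d * z + d * R) := by
    have h1 := mul_le_mul_of_nonneg_left hG hd.le
    have h2 := mul_le_mul_of_nonneg_right hCC₄ (by positivity : 0 ≤ d * z)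
    have h3 := mul_le_mul_of_nonneg_right hCb (by positivity : 0 ≤ d * R)
    have h4 : d * (g.σa⁻¹ * (g.emission * z + R)) = C₄ * (d * z) + g.σa⁻¹ * (d * R) := by
      rw [hC₄]; ring
    linarith
  have key := young_energy hkp hCp.le (b := b) (m := μ) (X := X) (s₁ := s₁) (z := d * z)
    (Z := d * Z) (s₂ := d * s₂) (y := d * y) (Y := d * Y) (R := d * R) (s₃ := d * s₃)
    (by positivity) t8
  have e4 : X ^ 2 + d ^ 2 * (Z ^ 2 + Y ^ 2 + R ^ 2) =
      X ^ 2 + ((d * Z) ^ 2 + (d * Y) ^ 2 + (d * R) ^ 2) := by ring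
  have e5 : (1 + b ^ 2) * (μ ^ 2 + d ^ 2 * z ^ 2) + (s₁ ^ 2 + d ^ 2 * (s₂ ^ 2 + s₃ ^ 2)) =
      (1 + b ^ 2) * (μ ^ 2 + (d * z) ^ 2) + (s₁ ^ 2 + (d * s₂) ^ 2 + (d * s₃) ^ 2) := by ring
  rw [e4, e5]
  refine le_trans ?_ key
  linarith

end System

/-! ### The energy estimate -/

theorem integrableOn_Icc_of_timeMeasure {T : ℝ} {f : ℝ → ℝ} (hf : Integrable f (timeMeasure T)) :
    IntegrableOn f (Icc 0 T) :=
  (integrableOn_Icc_iff_integrableOn_Ioo (by simp) (by simp)).2 hf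

/-- Gronwall's inequality for an energy `E` with rate `r`, dissipation `D`, source `s` and kernel
`w`. It is applied on `[0, t]` to `E + 2 k ∫ D`, so that the dissipation is controlled as well. -/
theorem gronwall_energy {T k K c : ℝ} (hk : 0 ≤ k) (hK : 0 ≤ K) (hc : 0 ≤ c)
    {E D s w r : ℝ → ℝ} (hEc : ContinuousOn E (Icc 0 T)) (hE : ∀ t, 0 ≤ E t)
    (hDi : Integrable D (timeMeasure T)) (hD : ∀ t, 0 ≤ D t)
    (hsi : Integrable s (timeMeasure T)) (hs : ∀ t, 0 ≤ s t)
    (hwi : Integrable w (timeMeasure T)) (hw : ∀ t, 0 ≤ w t)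
    (hri : Integrable r (timeMeasure T))
    (heq : ∀ t ∈ Icc 0 T, E t = E 0 + 2 * ∫ τ in 0..t, r τ)
    (hr : ∀ᵐ τ ∂timeMeasure T, r τ ≤ -(k * D τ) + K * (w τ * (c * E τ) + s τ))
    {t : ℝ} (ht : t ∈ Icc 0 T) :
    E t + 2 * k * (∫ τ in 0..t, D τ) ≤
      (E 0 + 2 * K * ∫ τ in 0..t, s τ) * Real.exp (2 * K * c * ∫ τ in 0..t, w τ) := by
  have hT : 0 ≤ T := ht.1.trans ht.2
  have hsub : Icc 0 t ⊆ Icc 0 T := Icc_subset_Icc_right ht.2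
  have hwE : Integrable (fun τ => w τ * E τ) (timeMeasure T) := by
    have h1 := (integrableOn_Icc_of_timeMeasure hwi).mul_continuousOn hEc isCompact_Icc
    exact h1.mono_set Ioo_subset_Icc_self
  have hi : ∀ {f : ℝ → ℝ}, Integrable f (timeMeasure T) → ∀ {s r : ℝ}, 0 ≤ s → s ≤ r → r ≤ T →
      IntervalIntegrable f volume s r := fun hf _ _ h0 h1 h2 =>
    intervalIntegrable_of_timeMeasure hf h0 h1 h2
  have hnn : ∀ {f : ℝ → ℝ}, (∀ t, 0 ≤ f t) → ∀ {s r : ℝ}, s ≤ r → 0 ≤ ∫ τ in s..r, f τ :=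
    fun hf _ _ h => intervalIntegral.integral_nonneg h fun τ _ => hf τ
  have hdiss : ∀ r ∈ Icc 0 T, E r + 2 * k * (∫ τ in 0..r, D τ) ≤
      E 0 + 2 * K * (∫ τ in 0..r, s τ) + 2 * K * c * ∫ τ in 0..r, w τ * E τ := by
    intro r' hr'
    have h1 : ∫ τ in 0..r', r τ ≤
        ∫ τ in 0..r', (-k * D τ + (K * c * (w τ * E τ) + K * s τ)) := by
      refine integral_mono_timeMeasure hri
        ((hDi.const_mul (-k)).add ((hwE.const_mul (K * c)).add (hsi.const_mul K))) ?_ le_rfl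
        hr'.1 hr'.2
      filter_upwards [hr] with τ h
      simp only [Pi.add_apply]
      linarith
    rw [intervalIntegral.integral_add ((hi hDi le_rfl hr'.1 hr'.2).const_mul _)
      (((hi hwE le_rfl hr'.1 hr'.2).const_mul _).add ((hi hsi le_rfl hr'.1 hr'.2).const_mul _)),
      intervalIntegral.integral_add ((hi hwE le_rfl hr'.1 hr'.2).const_mul _)
      ((hi hsi le_rfl hr'.1 hr'.2).const_mul _), intervalIntegral.integral_const_mul,
      intervalIntegral.integral_const_mul, intervalIntegral.integral_const_mul] at h1
    rw [heq r' hr']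
    linarith
  have hDc : ContinuousOn (fun r => ∫ τ in 0..r, D τ) (Icc 0 t) := by
    have h1 := intervalIntegral.continuousOn_primitive_interval (μ := volume) (a := 0) (b := t)
      (f := D) (by
        rw [uIcc_of_le ht.1]
        exact (integrableOn_Icc_of_timeMeasure hDi).mono_set hsub)
    rwa [uIcc_of_le ht.1] at h1
  have key := gronwall_integral (y := fun r => E r + 2 * k * ∫ τ in 0..r, D τ)
    (K := fun τ => 2 * K * c * w τ) (a := E 0 + 2 * K * ∫ τ in 0..t, s τ) (T := t)
    ((hEc.mono hsub).add (continuousOn_const.mul hDc))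
    (fun r hr' => add_nonneg (hE r) (mul_nonneg (by positivity) (hnn hD hr'.1)))
    (((integrableOn_Icc_of_timeMeasure hwi).mono_set hsub).const_mul _)
    (fun τ => mul_nonneg (by positivity) (hw τ)) ?_ (right_mem_Icc.2 ht.1)
  · rwa [intervalIntegral.integral_const_mul] at key
  · intro r' hr'
    have hr'T := hsub hr'
    refine (hdiss r' hr'T).trans ?_
    have h1 : ∫ τ in 0..r', s τ ≤ ∫ τ in 0..t, s τ := by
      rw [← intervalIntegral.integral_add_adjacent_intervals (hi hsi le_rfl hr'.1 hr'T.2)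
        (hi hsi hr'.1 hr'.2 ht.2)]
      have := hnn hs hr'.2
      linarith
    have hI : IntervalIntegrable (fun τ => w τ * E τ) volume 0 r' := hi hwE le_rfl hr'.1 hr'T.2
    have hI2 : IntervalIntegrable
        (fun τ => 2 * K * c * w τ * (E τ + 2 * k * ∫ σ in 0..τ, D σ)) volume 0 r' := by
      have h3 : ContinuousOn (fun τ => E τ + 2 * k * ∫ σ in 0..τ, D σ) (Icc 0 t) :=
        (hEc.mono hsub).add (continuousOn_const.mul hDc)
      have h4 : IntegrableOn (fun τ => 2 * K * c * w τ) (Icc 0 t) :=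
        ((integrableOn_Icc_of_timeMeasure hwi).mono_set hsub).const_mul (2 * K * c)
      have h5 := (h4.mul_continuousOn h3 isCompact_Icc).mono_set (Icc_subset_Icc_right hr'.2)
      rw [← uIcc_of_le hr'.1] at h5
      exact h5.intervalIntegrable
    have h2 : 2 * K * c * ∫ τ in 0..r', w τ * E τ ≤
        ∫ τ in 0..r', 2 * K * c * w τ * (E τ + 2 * k * ∫ σ in 0..τ, D σ) := by
      rw [← intervalIntegral.integral_const_mul]
      refine intervalIntegral.integral_mono_on hr'.1 (hI.const_mul _) hI2 fun τ hτ => ?_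
      have h3 : 0 ≤ 2 * k * ∫ σ in 0..τ, D σ := mul_nonneg (by positivity) (hnn hD hτ.1)
      have h4 : 0 ≤ 2 * K * c * w τ := mul_nonneg (by positivity) (hw τ)
      nlinarith
    have h3 := mul_le_mul_of_nonneg_left h1 (by positivity : 0 ≤ 2 * K)
    linarith

theorem integrable_norm_sq {X : Type*} [NormedAddCommGroup X] {T : ℝ} {f : ℝ → X}
    (hf : MemLp f 2 (timeMeasure T)) : Integrable (fun τ => ‖f τ‖ ^ 2) (timeMeasure T) :=
  hf.norm.integrable_sq

section System

variable {N : ℕ}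

theorem energy_nonneg (g : GasModel) {δ : ℝ} (hδ : 0 < δ) (n : SobolevH N) (m : VecH N)
    (ζ G : SobolevH N) : 0 ≤ energy g δ n m ζ G := by
  have := g.ρbar_pos
  have := g.Pρ_pos
  have := g.heatCap_pos
  have := g.θbar_pos
  have := g.σa_pos
  have := g.emission_pos
  unfold energy
  positivity

/-- The quantity `‖∇m‖² + δ⁻² (‖∇ζ‖² + ‖∇G‖² + ‖4 σt θbar³ ζ - σa G‖²)`, in the norms of `H^N`. -/
def dissipation (g : GasModel) (δ : ℝ) (M : MatH N) (ζ G : SobolevH N) (Dζ DG : VecH N) : ℝ :=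
  ‖M‖ ^ 2 + (δ ^ 2)⁻¹ * (‖Dζ‖ ^ 2 + ‖DG‖ ^ 2 + ‖exchange g ζ G‖ ^ 2)

/-- The quantity `‖S₁‖² + δ⁻² (‖S₂‖² + ‖S₃‖²)`, in the norms of `H^{N-1}`. -/
def sourceSq (δ : ℝ) (S₁ : VecH (N - 1)) (S₂ S₃ : SobolevH (N - 1)) : ℝ :=
  ‖S₁‖ ^ 2 + (δ ^ 2)⁻¹ * (‖S₂‖ ^ 2 + ‖S₃‖ ^ 2)

theorem dissipation_nonneg (g : GasModel) (δ : ℝ) (M : MatH N) (ζ G : SobolevH N)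
    (Dζ DG : VecH N) : 0 ≤ dissipation g δ M ζ G Dζ DG :=
  add_nonneg (sq_nonneg _) (mul_nonneg (inv_nonneg.2 (sq_nonneg _))
    (add_nonneg (add_nonneg (sq_nonneg _) (sq_nonneg _)) (sq_nonneg _)))

theorem sourceSq_nonneg (δ : ℝ) (S₁ : VecH (N - 1)) (S₂ S₃ : SobolevH (N - 1)) :
    0 ≤ sourceSq δ S₁ S₂ S₃ :=
  add_nonneg (sq_nonneg _) (mul_nonneg (inv_nonneg.2 (sq_nonneg _))
    (add_nonneg (sq_nonneg _) (sq_nonneg _)))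

theorem integrable_sourceSq {δ T : ℝ} {S₁ : ℝ → VecH (N - 1)} {S₂ S₃ : ℝ → SobolevH (N - 1)}
    (hS₁ : MemLp S₁ 2 (timeMeasure T)) (hS₂ : MemLp S₂ 2 (timeMeasure T))
    (hS₃ : MemLp S₃ 2 (timeMeasure T)) :
    Integrable (fun τ => sourceSq δ (S₁ τ) (S₂ τ) (S₃ τ)) (timeMeasure T) :=
  (integrable_norm_sq hS₁).add (((integrable_norm_sq hS₂).add
    (integrable_norm_sq hS₃)).const_mul _)

theorem integrable_add_mul {μ : Measure ℝ} {f₁ f₂ f₃ f₄ : ℝ → ℝ} (h₁ : Integrable f₁ μ)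
    (h₂ : Integrable f₂ μ) (h₃ : Integrable f₃ μ) (h₄ : Integrable f₄ μ) (c : ℝ) :
    Integrable (fun τ => f₁ τ + c * (f₂ τ + f₃ τ + f₄ τ)) μ :=
  h₁.add (((h₂.add h₃).add h₄).const_mul c)

theorem InEnergyClass.integrable_dissipation {g : GasModel} {δ T : ℝ}
    {n : ℝ → SobolevH N} {m : ℝ → VecH N} {ζ G : ℝ → SobolevH N}
    {Dn : ℝ → VecH (N - 1)} {Dm : ℝ → MatH N} {Dζ DG : ℝ → VecH N}
    (hreg : InEnergyClass N T n m ζ G Dn Dm Dζ DG) :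
    Integrable (fun τ => dissipation g δ (Dm τ) (ζ τ) (G τ) (Dζ τ) (DG τ)) (timeMeasure T) := by
  have h1 : Integrable (fun τ => ‖Dm τ‖ ^ 2) (timeMeasure T) := integrable_norm_sq hreg.Dm_memLp
  have h2 : Integrable (fun τ => ‖Dζ τ‖ ^ 2) (timeMeasure T) := integrable_norm_sq hreg.Dζ_memLp
  have h3 : Integrable (fun τ => ‖DG τ‖ ^ 2) (timeMeasure T) := integrable_norm_sq hreg.DG_memLp
  have h4 : Integrable (fun τ => ‖exchange g (ζ τ) (G τ)‖ ^ 2) (timeMeasure T) :=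
    integrable_norm_sq (memLp_exchange hreg)
  exact integrable_add_mul h1 h2 h3 h4 (δ ^ 2)⁻¹

theorem InEnergyClass.continuousOn_energy {g : GasModel} {δ T : ℝ}
    {n : ℝ → SobolevH N} {m : ℝ → VecH N} {ζ G : ℝ → SobolevH N}
    {Dn : ℝ → VecH (N - 1)} {Dm : ℝ → MatH N} {Dζ DG : ℝ → VecH N}
    (hreg : InEnergyClass N T n m ζ G Dn Dm Dζ DG) :
    ContinuousOn (fun t => energy g δ (n t) (m t) (ζ t) (G t)) (Icc 0 T) :=
  (((hreg.m_cont.norm.pow 2).add (continuousOn_const.mul (hreg.n_cont.norm.pow 2))).add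
    (continuousOn_const.mul (hreg.ζ_cont.norm.pow 2))).add
    (continuousOn_const.mul (hreg.G_cont.norm.pow 2))

/-- The part of the energy that the lower order terms of the energy rate involve. -/
theorem sq_add_sq_le_energy (g : GasModel) {δ : ℝ} (hδ : 0 < δ) (n : SobolevH N) (m : VecH N)
    (ζ G : SobolevH N) : ‖m‖ ^ 2 + (δ ^ 2)⁻¹ * ‖ζ‖ ^ 2 ≤
      (1 + g.θbar / g.heatCap) * energy g δ n m ζ G := by
  have hρ := g.ρbar_pos
  have hP := g.Pρ_pos
  have hc := g.heatCap_pos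
  have hθ := g.θbar_pos
  have hb := g.σa_pos
  have hem := g.emission_pos
  unfold energy
  have e0 := sq_nonneg ‖m‖
  have e1 := sq_nonneg ‖n‖
  have e2 := sq_nonneg ‖ζ‖
  have e3 := sq_nonneg ‖G‖
  generalize ‖m‖ ^ 2 = x at *
  generalize ‖n‖ ^ 2 = y at *
  generalize ‖ζ‖ ^ 2 = z at *
  generalize ‖G‖ ^ 2 = w at *
  have f1 : 0 ≤ g.ρbar * g.Pρ / δ ^ 2 * y := by positivity
  have f2 : 0 ≤ g.σa / (g.emission * g.θbar * δ) * w := by positivity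
  have f3 : (δ ^ 2)⁻¹ * z = g.θbar / g.heatCap * (g.heatCap / (g.θbar * δ ^ 2) * z) := by
    field_simp
  have f4 : 0 ≤ g.heatCap / (g.θbar * δ ^ 2) * z := by positivity
  have f5 : 0 < g.θbar / g.heatCap := by positivity
  rw [f3]
  have f7 := mul_nonneg f5.le f1
  have f8 := mul_nonneg f5.le f2
  have f9 := mul_nonneg f5.le e0
  linarith

/-- The energy estimate, for the weighted energy and in exponential form. -/
theorem exists_energy_estimate (g : GasModel) (hN : 3 ≤ N) {M₀ : ℝ} (hM₀ : 0 < M₀) :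
    ∃ k K c : ℝ, 0 < k ∧ 0 < K ∧ 0 < c ∧ ∀ {δ : ℝ}, 0 < δ → ∀ {T : ℝ}
      {A : ℝ → E3 → ℝ} {Ainf : ℝ} {B : ℝ → SobolevH N}
      {S₁ : ℝ → VecH (N - 1)} {S₂ S₃ : ℝ → SobolevH (N - 1)}
      {n₀ : SobolevH N} {m₀ : VecH N} {ζ₀ G₀ : SobolevH N}
      {n : ℝ → SobolevH N} {m : ℝ → VecH N} {ζ G : ℝ → SobolevH N}
      {Dn : ℝ → VecH (N - 1)} {Dm : ℝ → MatH N} {Dζ DG : ℝ → VecH N},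
      (∀ᵐ t ∂timeMeasure T, ∀ᵐ x : E3, M₀ ≤ A t x) →
      (∀ᵐ t ∂timeMeasure T, ∀ᵐ x : E3, A t x = Ainf + fn (B t) x) →
      MemLp B ⊤ (timeMeasure T) → MemLp S₁ 2 (timeMeasure T) →
      MemLp S₂ 2 (timeMeasure T) → MemLp S₃ 2 (timeMeasure T) →
      InEnergyClass N T n m ζ G Dn Dm Dζ DG →
      IsSolution g δ T A S₁ S₂ S₃ n₀ m₀ ζ₀ G₀ n m ζ G Dm Dζ DG → ∀ t ∈ Icc 0 T,
      energy g δ (n t) (m t) (ζ t) (G t) +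
          k * (∫ τ in 0..t, dissipation g δ (Dm τ) (ζ τ) (G τ) (Dζ τ) (DG τ)) ≤
        (energy g δ n₀ m₀ ζ₀ G₀ + K * ∫ τ in 0..t, sourceSq δ (S₁ τ) (S₂ τ) (S₃ τ)) *
          Real.exp (c * ∫ τ in 0..t, (1 + ‖B τ‖ ^ 2)) := by
  obtain ⟨k, K, hk, hK, hrate⟩ := exists_energyRate_le g hN hM₀
  have hc := g.heatCap_pos
  have hθ := g.θbar_pos
  set CE : ℝ := 1 + g.θbar / g.heatCap with hCE
  have hCE0 : 0 < CE := by positivity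
  refine ⟨2 * k, 2 * K, 2 * K * CE, by positivity, by positivity, by positivity, ?_⟩
  intro δ hδ T A Ainf B S₁ S₂ S₃ n₀ m₀ ζ₀ G₀ n m ζ G Dn Dm Dζ DG hA hAB hB hS₁ hS₂ hS₃ hreg hsol
    t ht
  obtain ⟨F₁, F₂, F₃, hF₁, hF₂, hF₃, hri, heq⟩ :=
    exists_energy_balance hN hδ hAB hB hS₁ hS₂ hS₃ hreg hsol
  have hB2 : MemLp B 2 (timeMeasure T) := hB.mono_exponent le_top
  have hwi : Integrable (fun τ => 1 + ‖B τ‖ ^ 2) (timeMeasure T) :=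
    (integrable_const 1).add (integrable_norm_sq hB2)
  have key := gronwall_energy hk.le hK.le hCE0.le hreg.continuousOn_energy
    (fun t => energy_nonneg g hδ _ _ _ _)
    hreg.integrable_dissipation (fun τ => dissipation_nonneg g δ _ _ _ _ _)
    (integrable_sourceSq hS₁ hS₂ hS₃) (fun τ => sourceSq_nonneg δ _ _ _)
    hwi (fun τ => add_nonneg zero_le_one (sq_nonneg _)) hri heq ?_ ht
  · rwa [hsol.n_init, hsol.m_init, hsol.ζ_init, hsol.G_init] at key
  · filter_upwards [hA, hAB, hF₂, hF₃, Filter.eventually_all.2 hF₁, hreg.Dm_grad]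
      with τ h1 h2 h3 h4 h5 h6
    have h7 : ∀ᵐ x, M₀ ≤ Ainf + fn (B τ) x := by
      filter_upwards [h1, h2] with x e1 e2
      rwa [← e2]
    refine (hrate hδ h7 h6 h5 h3 h4).trans ?_
    have h8 := sq_add_sq_le_energy g hδ (n τ) (m τ) (ζ τ) (G τ)
    have h9 := mul_le_mul_of_nonneg_left h8
      (mul_nonneg hK.le (add_nonneg zero_le_one (sq_nonneg ‖B τ‖)))
    unfold dissipation sourceSq
    linarith

end System

/-! ### Comparison of the norms -/

section System

variable {N : ℕ}

theorem rpow_neg_half_sq {δ : ℝ} (hδ : 0 < δ) : (δ ^ (-(1 / 2) : ℝ)) ^ 2 = δ⁻¹ := by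
  rw [← Real.rpow_natCast, ← Real.rpow_mul hδ.le]
  norm_num
  exact Real.rpow_neg_one δ

/-- The energy in terms of the entries of `energyNorm`. -/
theorem energy_eq (g : GasModel) {δ : ℝ} (hδ : 0 < δ) (n : SobolevH N) (m : VecH N)
    (ζ G : SobolevH N) : energy g δ n m ζ G =
      ‖m‖ ^ 2 + g.ρbar * g.Pρ * (δ⁻¹ * ‖n‖) ^ 2 + g.heatCap / g.θbar * (δ⁻¹ * ‖ζ‖) ^ 2 +
        g.σa / (g.emission * g.θbar) * (δ ^ (-(1 / 2) : ℝ) * ‖G‖) ^ 2 := by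
  have hθ := g.θbar_pos.ne'
  have hem := g.emission_pos.ne'
  have hδ' := hδ.ne'
  rw [mul_pow (δ ^ (-(1 / 2) : ℝ)), rpow_neg_half_sq hδ, energy]
  field_simp

/-- The energy is equivalent to the square of `energyNorm`, uniformly in `δ`; moreover it controls
`δ⁻² ‖n‖²`. -/
theorem exists_energy_equiv (g : GasModel) : ∃ C : ℝ, 0 < C ∧ ∀ {N : ℕ} {δ : ℝ}, 0 < δ →
    ∀ (n : SobolevH N) (m : VecH N) (ζ G : SobolevH N),
      energyNorm δ n m ζ G ^ 2 ≤ C * energy g δ n m ζ G ∧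
      energy g δ n m ζ G ≤ C * energyNorm δ n m ζ G ^ 2 ∧
      (δ ^ 2)⁻¹ * ‖n‖ ^ 2 ≤ C * energy g δ n m ζ G := by
  set w₁ := g.ρbar * g.Pρ with hw₁
  set w₂ := g.heatCap / g.θbar with hw₂
  set w₃ := g.σa / (g.emission * g.θbar) with hw₃
  have p₁ : 0 < w₁ := mul_pos g.ρbar_pos g.Pρ_pos
  have p₂ : 0 < w₂ := div_pos g.heatCap_pos g.θbar_pos
  have p₃ : 0 < w₃ := div_pos g.σa_pos (mul_pos g.emission_pos g.θbar_pos)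
  set C := 4 * (1 + w₁⁻¹ + w₂⁻¹ + w₃⁻¹) + (1 + w₁ + w₂ + w₃) with hC
  have i₁ := inv_pos.2 p₁
  have i₂ := inv_pos.2 p₂
  have i₃ := inv_pos.2 p₃
  refine ⟨C, by positivity, ?_⟩
  intro N δ hδ n m ζ G
  have e1 : (δ ^ 2)⁻¹ * ‖n‖ ^ 2 = (δ⁻¹ * ‖n‖) ^ 2 := by rw [mul_pow, inv_pow]
  rw [energy_eq g hδ, energyNorm, e1]
  have n1 := norm_nonneg m
  have n2 := mul_nonneg (inv_pos.2 hδ).le (norm_nonneg n)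
  have n3 := mul_nonneg (inv_pos.2 hδ).le (norm_nonneg ζ)
  have n4 := mul_nonneg (Real.rpow_nonneg hδ.le (-(1 / 2))) (norm_nonneg G)
  generalize ‖m‖ = p at *
  generalize δ⁻¹ * ‖n‖ = q at *
  generalize δ⁻¹ * ‖ζ‖ = r at *
  generalize δ ^ (-(1 / 2) : ℝ) * ‖G‖ = s at *
  rw [← hw₁, ← hw₂, ← hw₃]
  have hE0 : 0 ≤ p ^ 2 + w₁ * q ^ 2 + w₂ * r ^ 2 + w₃ * s ^ 2 := by positivity
  set E := p ^ 2 + w₁ * q ^ 2 + w₂ * r ^ 2 + w₃ * s ^ 2 with hE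
  have a₁ : p ^ 2 ≤ E := by
    have : 0 ≤ w₁ * q ^ 2 + w₂ * r ^ 2 + w₃ * s ^ 2 := by positivity
    linarith
  have a₂ : q ^ 2 ≤ w₁⁻¹ * E := by
    rw [← div_eq_inv_mul, le_div_iff₀ p₁]
    have : 0 ≤ p ^ 2 + w₂ * r ^ 2 + w₃ * s ^ 2 := by positivity
    linarith
  have a₃ : r ^ 2 ≤ w₂⁻¹ * E := by
    rw [← div_eq_inv_mul, le_div_iff₀ p₂]
    have : 0 ≤ p ^ 2 + w₁ * q ^ 2 + w₃ * s ^ 2 := by positivity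
    linarith
  have a₄ : s ^ 2 ≤ w₃⁻¹ * E := by
    rw [← div_eq_inv_mul, le_div_iff₀ p₃]
    have : 0 ≤ p ^ 2 + w₁ * q ^ 2 + w₂ * r ^ 2 := by positivity
    linarith
  have b₀ : C * E = 4 * E + 4 * (w₁⁻¹ * E) + 4 * (w₂⁻¹ * E) + 4 * (w₃⁻¹ * E) +
      (1 + w₁ + w₂ + w₃) * E := by rw [hC]; ring
  have b₁ : 0 ≤ (1 + w₁ + w₂ + w₃) * E := by positivity
  have b₂ := mul_nonneg i₁.le hE0
  have b₃ := mul_nonneg i₂.le hE0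
  have b₄ := mul_nonneg i₃.le hE0
  refine ⟨?_, ?_, ?_⟩
  · have : (p + q + r + s) ^ 2 ≤ 4 * (p ^ 2 + q ^ 2 + r ^ 2 + s ^ 2) := by
      nlinarith [sq_nonneg (p - q), sq_nonneg (p - r), sq_nonneg (p - s), sq_nonneg (q - r),
        sq_nonneg (q - s), sq_nonneg (r - s)]
    linarith
  · have hS : 0 ≤ p + q + r + s := by positivity
    have c₁ : p ^ 2 ≤ (p + q + r + s) ^ 2 := pow_le_pow_left₀ n1 (by linarith) 2
    have c₂ : q ^ 2 ≤ (p + q + r + s) ^ 2 := pow_le_pow_left₀ n2 (by linarith) 2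
    have c₃ : r ^ 2 ≤ (p + q + r + s) ^ 2 := pow_le_pow_left₀ n3 (by linarith) 2
    have c₄ : s ^ 2 ≤ (p + q + r + s) ^ 2 := pow_le_pow_left₀ n4 (by linarith) 2
    have d₁ := mul_le_mul_of_nonneg_left c₂ p₁.le
    have d₂ := mul_le_mul_of_nonneg_left c₃ p₂.le
    have d₃ := mul_le_mul_of_nonneg_left c₄ p₃.le
    have d₄ : 0 ≤ 4 * (1 + w₁⁻¹ + w₂⁻¹ + w₃⁻¹) * (p + q + r + s) ^ 2 := by positivity
    have d₅ : C * (p + q + r + s) ^ 2 =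
        4 * (1 + w₁⁻¹ + w₂⁻¹ + w₃⁻¹) * (p + q + r + s) ^ 2 + ((p + q + r + s) ^ 2 +
          w₁ * (p + q + r + s) ^ 2 + w₂ * (p + q + r + s) ^ 2 + w₃ * (p + q + r + s) ^ 2) := by
      rw [hC]; ring
    linarith
  · linarith

/-- The gradient of `u ∈ H^N` is controlled in `H^{N-1}` by the norm of `u`. -/
theorem IsGradient.norm_sq_le (hN : 1 ≤ N) {u : SobolevH N} {V : VecH (N - 1)}
    (h : IsGradient u V) : ‖V‖ ^ 2 ≤ 3 * Fintype.card (MultiIndex (N - 1)) ^ 2 * ‖u‖ ^ 2 := by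
  have h1 : ∀ j, ‖V j‖ ≤ Fintype.card (MultiIndex (N - 1)) * ‖u‖ := fun j => by
    refine norm_sobolev_le _ (norm_nonneg _) fun α hα => ?_
    rw [h.wderiv_eq j hα (by omega)]
    exact norm_wderiv_le _ u
  rw [PiLp.norm_sq_eq_of_L2]
  refine (Finset.sum_le_sum fun j _ => pow_le_pow_left₀ (norm_nonneg _) (h1 j) 2).trans_eq ?_
  simp only [Finset.sum_const, Finset.card_univ, Fintype.card_fin, nsmul_eq_mul]
  push_cast
  ring

theorem exp_le_one_add_mul_exp (x : ℝ) : Real.exp x ≤ 1 + x * Real.exp x := by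
  have h1 := Real.add_one_le_exp (-x)
  have h2 := Real.exp_pos x
  have h3 := mul_le_mul_of_nonneg_right h1 h2.le
  rw [← Real.exp_add, neg_add_cancel, Real.exp_zero] at h3
  linarith

theorem sq_sum_le_three (x y z : ℝ) : (x + y + z) ^ 2 ≤ 3 * (x ^ 2 + y ^ 2 + z ^ 2) := by
  nlinarith [sq_nonneg (x - y), sq_nonneg (x - z), sq_nonneg (y - z)]

theorem sourceSq_le {δ : ℝ} (hδ : 0 < δ) (S₁ : VecH (N - 1)) (S₂ S₃ : SobolevH (N - 1)) :
    sourceSq δ S₁ S₂ S₃ ≤ (‖S₁‖ + δ⁻¹ * ‖S₂‖ + δ⁻¹ * ‖S₃‖) ^ 2 := by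
  have n1 := norm_nonneg S₁
  have n2 := mul_nonneg (inv_pos.2 hδ).le (norm_nonneg S₂)
  have n3 := mul_nonneg (inv_pos.2 hδ).le (norm_nonneg S₃)
  have e : sourceSq δ S₁ S₂ S₃ = ‖S₁‖ ^ 2 + ((δ⁻¹ * ‖S₂‖) ^ 2 + (δ⁻¹ * ‖S₃‖) ^ 2) := by
    rw [sourceSq]
    ring
  rw [e]
  generalize ‖S₁‖ = x at *
  generalize δ⁻¹ * ‖S₂‖ = y at *
  generalize δ⁻¹ * ‖S₃‖ = z at *
  nlinarith [mul_nonneg n1 n2, mul_nonneg n1 n3, mul_nonneg n2 n3]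

end System

/-! ### The dissipation of the density and the constants -/

section System

variable {N : ℕ}

theorem timeMeasure_mono {t T : ℝ} (h : t ≤ T) : timeMeasure t ≤ timeMeasure T :=
  Measure.restrict_mono (Ioo_subset_Ioo_right h) le_rfl

/-- The density is not dissipated, but its gradient in `L²(0,t; H^{N-1})` costs no more than `t`
times the supremum of its norm in `H^N`. -/
theorem integral_norm_sq_gradient_le (hN : 1 ≤ N) {T t M : ℝ} (ht : t ∈ Icc 0 T)
    {n : ℝ → SobolevH N} {Dn : ℝ → VecH (N - 1)} (hDn : MemLp Dn 2 (timeMeasure T))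
    (hgrad : ∀ᵐ τ ∂timeMeasure T, IsGradient (n τ) (Dn τ)) (hM : ∀ τ ∈ Icc 0 t, ‖n τ‖ ^ 2 ≤ M) :
    ∫ τ in 0..t, ‖Dn τ‖ ^ 2 ≤ t * (3 * Fintype.card (MultiIndex (N - 1)) ^ 2 * M) := by
  have hle := timeMeasure_mono ht.2
  have h1 := integral_mono_timeMeasure (T := t) (s := 0) (r := t)
    ((integrable_norm_sq hDn).mono_measure hle)
    (integrable_const (3 * (Fintype.card (MultiIndex (N - 1)) : ℝ) ^ 2 * M))
    (by
      have h0 : ∀ᵐ τ ∂timeMeasure t, τ ∈ Ioo 0 t := ae_restrict_mem measurableSet_Ioo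
      filter_upwards [ae_mono hle hgrad, h0] with τ h2 h3
      exact (h2.norm_sq_le hN).trans
        (mul_le_mul_of_nonneg_left (hM τ (Ioo_subset_Icc_self h3)) (by positivity)))
    le_rfl ht.1 le_rfl
  rwa [intervalIntegral.integral_const, sub_zero, smul_eq_mul] at h1

theorem integral_dissipation_ge (g : GasModel) {δ T t : ℝ} (ht : t ∈ Icc 0 T)
    {n : ℝ → SobolevH N} {m : ℝ → VecH N} {ζ G : ℝ → SobolevH N}
    {Dn : ℝ → VecH (N - 1)} {Dm : ℝ → MatH N} {Dζ DG : ℝ → VecH N}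
    (hreg : InEnergyClass N T n m ζ G Dn Dm Dζ DG) :
    (∫ τ in 0..t, ‖Dm τ‖ ^ 2) + (δ ^ 2)⁻¹ * (∫ τ in 0..t,
        (‖Dζ τ‖ + ‖DG τ‖ + ‖exchange g (ζ τ) (G τ)‖) ^ 2) ≤
      3 * ∫ τ in 0..t, dissipation g δ (Dm τ) (ζ τ) (G τ) (Dζ τ) (DG τ) := by
  have h1 : Integrable (fun τ => ‖Dm τ‖ ^ 2) (timeMeasure T) := integrable_norm_sq hreg.Dm_memLp
  have h2 : Integrable (fun τ => (‖Dζ τ‖ + ‖DG τ‖ + ‖exchange g (ζ τ) (G τ)‖) ^ 2)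
      (timeMeasure T) := by
    have h3 : MemLp (fun τ => ‖Dζ τ‖ + ‖DG τ‖ + ‖exchange g (ζ τ) (G τ)‖) 2 (timeMeasure T) :=
      (hreg.Dζ_memLp.norm.add hreg.DG_memLp.norm).add (memLp_exchange hreg).norm
    exact h3.integrable_sq
  have h4 := hreg.integrable_dissipation (g := g) (δ := δ)
  have hi : ∀ {f : ℝ → ℝ}, Integrable f (timeMeasure T) → IntervalIntegrable f volume 0 t :=
    fun hf => intervalIntegrable_of_timeMeasure hf le_rfl ht.1 ht.2
  rw [← intervalIntegral.integral_const_mul, ← intervalIntegral.integral_const_mul,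
    ← intervalIntegral.integral_add (hi h1) ((hi h2).const_mul _)]
  refine intervalIntegral.integral_mono_on ht.1 ((hi h1).add ((hi h2).const_mul _))
    ((hi h4).const_mul 3) fun τ _ => ?_
  have h5 := mul_le_mul_of_nonneg_left
    (sq_sum_le_three ‖Dζ τ‖ ‖DG τ‖ ‖exchange g (ζ τ) (G τ)‖) (inv_nonneg.2 (sq_nonneg δ))
  have h6 := sq_nonneg ‖Dm τ‖
  unfold dissipation
  linarith

theorem integral_sourceSq_le {δ T t : ℝ} (hδ : 0 < δ) (ht : t ∈ Icc 0 T)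
    {S₁ : ℝ → VecH (N - 1)} {S₂ S₃ : ℝ → SobolevH (N - 1)}
    (hS₁ : MemLp S₁ 2 (timeMeasure T)) (hS₂ : MemLp S₂ 2 (timeMeasure T))
    (hS₃ : MemLp S₃ 2 (timeMeasure T)) :
    ∫ τ in 0..t, sourceSq δ (S₁ τ) (S₂ τ) (S₃ τ) ≤
      ∫ τ in 0..t, (‖S₁ τ‖ + δ⁻¹ * ‖S₂ τ‖ + δ⁻¹ * ‖S₃ τ‖) ^ 2 := by
  have h1 : MemLp (fun τ => ‖S₁ τ‖ + δ⁻¹ * ‖S₂ τ‖ + δ⁻¹ * ‖S₃ τ‖) 2 (timeMeasure T) :=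
    (hS₁.norm.add (hS₂.norm.const_mul _)).add (hS₃.norm.const_mul _)
  exact integral_mono_timeMeasure (integrable_sourceSq hS₁ hS₂ hS₃) h1.integrable_sq
    (.of_forall fun τ => sourceSq_le hδ _ _ _) le_rfl ht.1 ht.2

theorem integral_mono_right {T s t : ℝ} {f : ℝ → ℝ} (hf : Integrable f (timeMeasure T))
    (hf0 : ∀ τ, 0 ≤ f τ) (hs : 0 ≤ s) (hst : s ≤ t) (ht : t ≤ T) :
    ∫ τ in 0..s, f τ ≤ ∫ τ in 0..t, f τ := by
  rw [← intervalIntegral.integral_add_adjacent_intervals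
    (intervalIntegrable_of_timeMeasure hf le_rfl hs (hst.trans ht))
    (intervalIntegrable_of_timeMeasure hf hs hst ht)]
  have := intervalIntegral.integral_nonneg (μ := volume) hst fun τ _ => hf0 τ
  linarith

/-- Collecting the constants: an exponential bound with exponent `c X` becomes a bound by
`1 + exp (c X) X`, as `exp x ≤ 1 + x exp x`. The factor `X` in the bound for `e₂`, the density term,
is of this form already. -/
theorem collect_constants {a R X c k K Q L e₁ e₂ e₃ : ℝ} (hc : 0 ≤ c) (hX : 0 ≤ X) (hk : 0 < k)
    (hQ : 0 ≤ Q) (hL : 0 ≤ L) (ha0 : 0 ≤ a) (ha : a ≤ (Q + K) * R)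
    (h₁ : e₁ ≤ Q * (a * Real.exp (c * X))) (h₂ : e₂ ≤ X * (L * (Q * (a * Real.exp (c * X)))))
    (h₃ : k * e₃ ≤ 3 * (a * Real.exp (c * X))) :
    e₁ + e₂ + e₃ ≤
      ((Q + 3 / k) * (1 + c) + L * Q) * (Q + K) * R * (1 + Real.exp (c * X) * X) := by
  have hexp := exp_le_one_add_mul_exp (c * X)
  have hE := Real.exp_pos (c * X)
  set E := Real.exp (c * X)
  have h₃' : e₃ ≤ 3 / k * (a * E) := by
    rw [div_mul_eq_mul_div, le_div_iff₀ hk]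
    linarith
  have hk3 : 0 ≤ 3 / k := by positivity
  have h4 : a * E ≤ a * ((1 + c) * (1 + E * X)) := by
    refine mul_le_mul_of_nonneg_left ?_ ha0
    have : 0 ≤ E * X := by positivity
    nlinarith
  have h5 := mul_le_mul_of_nonneg_left h4 (add_nonneg hQ hk3)
  have h6 : 0 ≤ L * Q * a := by positivity
  have h7 : e₁ + e₂ + e₃ ≤ ((Q + 3 / k) * (1 + c) + L * Q) * (1 + E * X) * a := by
    linarith
  refine h7.trans ?_
  have h8 : 0 ≤ ((Q + 3 / k) * (1 + c) + L * Q) * (1 + E * X) := by positivity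
  have h9 := mul_le_mul_of_nonneg_left ha h8
  linarith

end System

end RadHydro

end

open RadHydro
theorem theorem2p1 (g : GasModel) (N : ℕ) (hN : 3 ≤ N) (M₀ M₁ : ℝ) (hM₀ : 0 < M₀) :
    ∃ C₀ c₀ : ℝ, 0 < C₀ ∧ 0 < c₀ ∧
      ∀ (δ : ℝ), 0 < δ → ∀ (T : ℝ), 0 < T →
      -- the coefficient `A`, equal to a constant `Ainf` plus `B ∈ L^∞(0,T; H^N)`
      ∀ (A : ℝ → E3 → ℝ) (Ainf : ℝ) (B : ℝ → SobolevH N),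
      (∀ᵐ t ∂(timeMeasure T), ∀ᵐ x : E3, M₀ ≤ A t x ∧ A t x ≤ M₁) →
      MemLp B ⊤ (timeMeasure T) →
      (∀ᵐ t ∂(timeMeasure T), ∀ᵐ x : E3, A t x = Ainf + fn (B t) x) →
      -- the sources
      ∀ (S₁ : ℝ → VecH (N - 1)) (S₂ S₃ : ℝ → SobolevH (N - 1)),
      MemLp S₁ 2 (timeMeasure T) →
      MemLp S₂ 2 (timeMeasure T) →
      MemLp S₃ 2 (timeMeasure T) →
      -- the initial data, the solution and its gradients
      ∀ (n₀ : SobolevH N) (m₀ : VecH N) (ζ₀ G₀ : SobolevH N)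
        (n : ℝ → SobolevH N) (m : ℝ → VecH N) (ζ G : ℝ → SobolevH N)
        (Dn : ℝ → VecH (N - 1)) (Dm : ℝ → MatH N) (Dζ DG : ℝ → VecH N),
      InEnergyClass N T n m ζ G Dn Dm Dζ DG →
      IsSolution g δ T A S₁ S₂ S₃ n₀ m₀ ζ₀ G₀ n m ζ G Dm Dζ DG →
      ∀ t ∈ Icc 0 T,
        energyNorm δ (n t) (m t) (ζ t) (G t) ^ 2
          + (δ ^ 2)⁻¹ * (∫ τ in 0..t, ‖Dn τ‖ ^ 2)
          + (∫ τ in 0..t, ‖Dm τ‖ ^ 2)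
          + (δ ^ 2)⁻¹ * (∫ τ in 0..t,
              (‖Dζ τ‖ + ‖DG τ‖ + ‖(4 * g.σt * g.θbar ^ 3) • ζ τ - g.σa • G τ‖) ^ 2)
        ≤ C₀ * (energyNorm δ n₀ m₀ ζ₀ G₀ ^ 2
              + (∫ τ in 0..t, (‖S₁ τ‖ + δ⁻¹ * ‖S₂ τ‖ + δ⁻¹ * ‖S₃ τ‖) ^ 2))
            * (1 + Real.exp (c₀ * (∫ τ in 0..T, (1 + ‖B τ‖ ^ 2)))
                * (∫ τ in 0..T, (1 + ‖B τ‖ ^ 2))) := by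
  obtain ⟨k, K, c, hk, hK, hc, hest⟩ := exists_energy_estimate g hN hM₀
  obtain ⟨Q, hQ, hequiv⟩ := exists_energy_equiv g
  set L : ℝ := 3 * (Fintype.card (MultiIndex (N - 1)) : ℝ) ^ 2 with hL
  have hL0 : 0 ≤ L := by positivity
  refine ⟨((Q + 3 / k) * (1 + c) + L * Q) * (Q + K), c, by positivity, hc, ?_⟩
  intro δ hδ T hT A Ainf B hA hB hAB S₁ S₂ S₃ hS₁ hS₂ hS₃ n₀ m₀ ζ₀ G₀ n m ζ G Dn Dm Dζ DG hreg hsol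
    t ht
  have hwi : Integrable (fun τ => 1 + ‖B τ‖ ^ 2) (timeMeasure T) :=
    (integrable_const 1).add (integrable_norm_sq (hB.mono_exponent le_top))
  have hw0 : ∀ τ, 0 ≤ 1 + ‖B τ‖ ^ 2 := fun τ => add_nonneg zero_le_one (sq_nonneg _)
  have hsi := integrable_sourceSq (δ := δ) hS₁ hS₂ hS₃
  have hs0 : ∀ τ, 0 ≤ sourceSq δ (S₁ τ) (S₂ τ) (S₃ τ) := fun τ => sourceSq_nonneg δ _ _ _
  set X := ∫ τ in 0..T, (1 + ‖B τ‖ ^ 2) with hX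
  set a := energy g δ n₀ m₀ ζ₀ G₀ + K * ∫ τ in 0..t, sourceSq δ (S₁ τ) (S₂ τ) (S₃ τ) with ha
  have hX0 : 0 ≤ X := intervalIntegral.integral_nonneg hT.le fun τ _ => hw0 τ
  -- the integrand of `X` is at least `1`
  have htX : t ≤ X := by
    have h1 := integral_mono_timeMeasure (integrable_const 1) hwi
      (.of_forall fun τ => le_add_of_nonneg_right (sq_nonneg ‖B τ‖)) le_rfl hT.le le_rfl
    rw [intervalIntegral.integral_const, sub_zero, smul_eq_mul, mul_one] at h1
    exact ht.2.trans h1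
  have ha0 : 0 ≤ a := add_nonneg (energy_nonneg g hδ _ _ _ _)
    (mul_nonneg hK.le (intervalIntegral.integral_nonneg ht.1 fun τ _ => hs0 τ))
  have hbound : ∀ τ ∈ Icc 0 t, energy g δ (n τ) (m τ) (ζ τ) (G τ) +
      k * (∫ s in 0..τ, dissipation g δ (Dm s) (ζ s) (G s) (Dζ s) (DG s)) ≤
        a * Real.exp (c * X) := by
    intro τ hτ
    have hτT := hτ.2.trans ht.2
    refine (hest hδ (hA.mono fun t h => h.mono fun x hx => hx.1) hAB hB hS₁ hS₂ hS₃ hreg hsol τ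
      ⟨hτ.1, hτT⟩).trans ?_
    have h1 := integral_mono_right hsi hs0 hτ.1 hτ.2 ht.2
    have h2 := integral_mono_right hwi hw0 hτ.1 hτT le_rfl
    have h3 := mul_le_mul_of_nonneg_left h1 hK.le
    have h4 : Real.exp (c * ∫ s in 0..τ, (1 + ‖B s‖ ^ 2)) ≤ Real.exp (c * X) :=
      Real.exp_le_exp.2 (mul_le_mul_of_nonneg_left h2 hc.le)
    exact mul_le_mul (by rw [ha]; linarith) h4 (Real.exp_pos _).le ha0
  have hD0 : ∀ {τ}, 0 ≤ τ →
      0 ≤ ∫ s in 0..τ, dissipation g δ (Dm s) (ζ s) (G s) (Dζ s) (DG s) := fun h =>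
    intervalIntegral.integral_nonneg h fun s _ => dissipation_nonneg g δ _ _ _ _ _
  have henergy : ∀ τ ∈ Icc 0 t, energy g δ (n τ) (m τ) (ζ τ) (G τ) ≤ a * Real.exp (c * X) :=
    fun τ hτ => (le_add_of_nonneg_right (mul_nonneg hk.le (hD0 hτ.1))).trans (hbound τ hτ)
  have htt := right_mem_Icc.2 ht.1
  have h₁ : energyNorm δ (n t) (m t) (ζ t) (G t) ^ 2 ≤ Q * (a * Real.exp (c * X)) :=
    (hequiv hδ _ _ _ _).1.trans (mul_le_mul_of_nonneg_left (henergy t htt) hQ.le)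
  have h₂ : (δ ^ 2)⁻¹ * (∫ τ in 0..t, ‖Dn τ‖ ^ 2) ≤
      X * (L * (Q * (a * Real.exp (c * X)))) := by
    have h3 := integral_norm_sq_gradient_le (by omega) ht hreg.Dn_memLp hreg.Dn_grad
      (M := δ ^ 2 * (Q * (a * Real.exp (c * X)))) fun τ hτ => by
        have h4 := (hequiv hδ (n τ) (m τ) (ζ τ) (G τ)).2.2.trans
          (mul_le_mul_of_nonneg_left (henergy τ hτ) hQ.le)
        rwa [inv_mul_le_iff₀ (by positivity)] at h4
    rw [inv_mul_le_iff₀ (by positivity)]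
    refine h3.trans ?_
    have h5 : 0 ≤ L * (δ ^ 2 * (Q * (a * Real.exp (c * X)))) := by positivity
    have h6 := mul_le_mul_of_nonneg_right htX h5
    rw [← hL]
    linarith
  have h₃ : k * ((∫ τ in 0..t, ‖Dm τ‖ ^ 2) + (δ ^ 2)⁻¹ * (∫ τ in 0..t,
      (‖Dζ τ‖ + ‖DG τ‖ + ‖(4 * g.σt * g.θbar ^ 3) • ζ τ - g.σa • G τ‖) ^ 2)) ≤
      3 * (a * Real.exp (c * X)) := by
    have h4 := mul_le_mul_of_nonneg_left (integral_dissipation_ge g (δ := δ) ht hreg) hk.le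
    have h5 := hbound t htt
    have h6 := energy_nonneg g hδ (n t) (m t) (ζ t) (G t)
    refine h4.trans ?_
    linarith
  have haR : a ≤ (Q + K) * (energyNorm δ n₀ m₀ ζ₀ G₀ ^ 2 +
      (∫ τ in 0..t, (‖S₁ τ‖ + δ⁻¹ * ‖S₂ τ‖ + δ⁻¹ * ‖S₃ τ‖) ^ 2)) := by
    have h4 := (hequiv hδ n₀ m₀ ζ₀ G₀).2.1
    have h5 := mul_le_mul_of_nonneg_left (integral_sourceSq_le hδ ht hS₁ hS₂ hS₃) hK.le
    have h6 : 0 ≤ ∫ τ in 0..t, (‖S₁ τ‖ + δ⁻¹ * ‖S₂ τ‖ + δ⁻¹ * ‖S₃ τ‖) ^ 2 :=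
      intervalIntegral.integral_nonneg ht.1 fun τ _ => sq_nonneg _
    have h7 := mul_nonneg hQ.le h6
    have h8 := mul_nonneg hK.le (sq_nonneg (energyNorm δ n₀ m₀ ζ₀ G₀))
    rw [ha]
    linarith
  have := collect_constants hc.le hX0 hk hQ.le hL0 ha0 haR h₁ h₂ h₃
  linarith
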